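/- **Conventions.** $X$ is a complex Banach space, $X'$ its dual, $T$ a bounded operator on $X$ with adjoint $T'$, $R(\lambda,T)=(\lambda-T)^{-1}$, $(r_n)$ are independent Rademacher variables and $(\gamma_n)$ independent standard Gaussian variables. $X$ has *finite cotype* if there are $q\in[2,\infty)$ and $c$ with $\bigl(\sum_{n\le N}\|x_n\|^q\bigr)^{1/q}\le c\,\mathbb E\bigl\|\sum_{n\le N} r_nx_n\bigr\|$ for all $N$ and all $x_1,\dots,x_N\in X$. $\gamma(\ell_2;X)$ is the space of sequences $(x_k)_{k\ge1}$ in $X$ (identified with the operators $e_k\mapsto x_k$ on $\ell_2$) for which $\sum_k\gamma_kx_k$ converges in $L^2(\Omega;X)$, with norm $\bigl(\mathbb E\|\sum_k\gamma_kx_k\|^2\bigr)^{1/2}$. A sequence $(x_k')$ in $X'$ is regarded as an element of the dual space $\gamma(\ell_2;X)'$ through $(x_k)\mapsto\sum_k\langle x_k',x_k\rangle$. For $\omega>1$ let $\mathrm{Stolz}_\omega=\{z:\ |z|<1,\ |1-z|/(1-|z|)<\omega\}$. $T$ is a *Ritt operator* if $\sigma(T)\subseteq\overline{\mathbb D}$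 and $(\lambda-1)R(\lambda,T)$ is bounded on $\{|\lambda|>1\}$. It is *of type $\omega$* if moreover $\sigma(T)\subseteq\overline{\mathrm{Stolz}_\omega}$ and, for every $\theta>\omega$, $(\lambda-1)R(\lambda,T)$ is bounded on $\{\lambda\ne 1:\ \lambda\notin\mathrm{Stolz}_\theta\}$. Let $T$ be a Ritt operator of type $\omega$ and $\nu>\omega$. $H^\infty(\mathrm{Stolz}_\nu)$ is the algebra of bounded holomorphic functions on $\mathrm{Stolz}_\nu$. A function $\varphi\in H^\infty(\mathrm{Stolz}_\nu)$ is *elementary* if $\varphi(z)/(1-z)\in L^1(\partial\,\mathrm{Stolz}_\theta)$ for some $\theta\in(\omega,\nu)$, and then $\varphi(T)=\frac1{2\pi i}\int_{\partial\,\mathrm{Stolz}_\theta}\varphi(z)R(z,T)\,dz$, the boundary being traversed counterclockwise. For $f\in H^\infty(\mathrm{Stolz}_\nu)$ put $f(T)=e(T)^{-1}(ef)(T)$ whenever there is an elementary $e$ such that $ef$ is elementary and $e(T)$ is injective. $T$ has a *bounded $H^\infty(\mathrm{Stolz}_\nu)$-calculus* if for every $f\in H^\infty(\mathrm{Stolz}_\nu)$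 such an $e$ exists and $f(T)$ is a bounded operator defined on all of $X$. **Proposition.** Let $X$ be a complex Banach space of finite cotype and let $T$ be a Ritt operator of type $\omega>1$ on $X$. If $T$ has a bounded $H^\infty(\mathrm{Stolz}_\nu)$-calculus for some $\nu>\omega$, then for every integer $m\ge1$ the square function $$\Phi_m:\ X\to\gamma(\ell_2;X),\qquad x\mapsto\bigl(k^{m-1/2}\,T^{k-1}(I-T)^mx\bigr)_{k\ge1}$$ and the dual square function $$\Phi_m^*:\ X'\to\gamma(\ell_2;X)',\qquad x'\mapsto\bigl(k^{m-1/2}\,(T')^{k-1}(I-T')^mx'\bigr)_{k\ge1}$$ are well-defined bounded operators. -/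

import Mathlib

open MeasureTheory ProbabilityTheory Filter Topology Set

noncomputable section

namespace RittCalculus

/-! ## Cotype -/

/-- The Rademacher average `𝔼 ‖∑ rₙ xₙ‖` of finitely many vectors, i.e. the average of
`‖∑ εₙ xₙ‖` over all choices of signs `εₙ ∈ {1, -1}`. -/
def rademacherAverage {X : Type*} [NormedAddCommGroup X] {N : ℕ} (x : Fin N → X) : ℝ :=
  (∑ ε : Fin N → ℤˣ, ‖∑ n, ((ε n : ℤˣ) : ℤ) • x n‖) / 2 ^ N

/-- `X` has (Rademacher) cotype `q` for the real number `q`. -/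
def HasCotype (X : Type*) [NormedAddCommGroup X] (q : ℝ) : Prop :=
  ∃ c : ℝ, ∀ (N : ℕ) (x : Fin N → X),
    (∑ n, ‖x n‖ ^ q) ^ (1 / q) ≤ c * rademacherAverage x

/-- `X` has finite cotype: it has cotype `q` for some `q ∈ [2, ∞)`. -/
def HasFiniteCotype (X : Type*) [NormedAddCommGroup X] : Prop :=
  ∃ q : ℝ, 2 ≤ q ∧ HasCotype X q

/-! ## Gaussian sums and the space `γ(ℓ₂; X)` -/

/-- The law of a sequence of independent standard Gaussian variables; the coordinates
`ω ↦ ω n` on `(ℕ → ℝ, gaussianSeq)` are the sequence `(γₙ)`. -/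
def gaussianSeq : Measure (ℕ → ℝ) :=
  Measure.infinitePi (fun _ : ℕ => gaussianReal 0 1)

instance : IsProbabilityMeasure gaussianSeq := by
  unfold gaussianSeq; infer_instance

theorem memLp_coord (n : ℕ) : MemLp (fun ω : ℕ → ℝ => ω n) 2 gaussianSeq :=
  (memLp_id_gaussianReal' 2 (by simp)).comp_measurePreserving
    (measurePreserving_eval_infinitePi (fun _ : ℕ => gaussianReal 0 1) n)

theorem memLp_gaussianTerm {X : Type*} [NormedAddCommGroup X] [NormedSpace ℂ X]
    (n : ℕ) (x : X) : MemLp (fun ω : ℕ → ℝ => (ω n : ℂ) • x) 2 gaussianSeq := by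
  have h : MemLp (fun ω : ℕ → ℝ => (ω n : ℂ)) 2 gaussianSeq := (memLp_coord n).ofReal
  exact (ContinuousLinearMap.toSpanSingleton ℂ x).comp_memLp' h

/-- The random variable `γₙ x`, as an element of `L²(Ω; X)`, linear in `x`. -/
def gaussianTerm (X : Type*) [NormedAddCommGroup X] [NormedSpace ℂ X] (n : ℕ) :
    X →ₗ[ℂ] Lp X 2 gaussianSeq where
  toFun x := (memLp_gaussianTerm n x).toLp
  map_add' x y := by
    rw [← MemLp.toLp_add]; congr 1; funext ω; simp
  map_smul' c x := by
    rw [RingHom.id_apply, ← MemLp.toLp_const_smul]; congr 1; funext ω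
    exact smul_comm _ _ _

/-- The partial sums `∑_{n < N} γₙ xₙ` in `L²(Ω; X)`. -/
def gaussianPartialSum {X : Type*} [NormedAddCommGroup X] [NormedSpace ℂ X]
    (x : ℕ → X) (N : ℕ) : Lp X 2 gaussianSeq :=
  ∑ n ∈ Finset.range N, gaussianTerm X n (x n)

/-- The sequences `x` in `X` for which the series `∑ γₙ xₙ` converges in `L²(Ω; X)`. -/
def gammaSubmodule (X : Type*) [NormedAddCommGroup X] [NormedSpace ℂ X] :
    Submodule ℂ (ℕ → X) where
  carrier := {x | ∃ S : Lp X 2 gaussianSeq, Tendsto (gaussianPartialSum x) atTop (𝓝 S)}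
  zero_mem' := ⟨0, by
    have h : gaussianPartialSum (0 : ℕ → X) = fun _ => 0 := by
      funext N; simp [gaussianPartialSum]
    rw [h]; exact tendsto_const_nhds⟩
  add_mem' := by
    rintro x y ⟨S, hS⟩ ⟨R, hR⟩
    refine ⟨S + R, (hS.add hR).congr fun N => ?_⟩
    simp [gaussianPartialSum, Finset.sum_add_distrib]
  smul_mem' := by
    rintro c x ⟨S, hS⟩
    refine ⟨c • S, (hS.const_smul c).congr fun N => ?_⟩
    simp [gaussianPartialSum, Finset.smul_sum]

/-- The space `γ(ℓ₂; X)`, an operator `u : ℓ₂ → X` being identified with the sequence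
`(u eₙ)` of its values on the unit vectors. -/
def GammaSpace (X : Type*) [NormedAddCommGroup X] [NormedSpace ℂ X] : Type _ :=
  gammaSubmodule X

namespace GammaSpace

variable {X : Type*} [NormedAddCommGroup X] [NormedSpace ℂ X]

instance : AddCommGroup (GammaSpace X) := inferInstanceAs (AddCommGroup (gammaSubmodule X))

instance : Module ℂ (GammaSpace X) := inferInstanceAs (Module ℂ (gammaSubmodule X))

/-- The sequence underlying an element of `γ(ℓ₂; X)`. -/
def seq (u : GammaSpace X) : ℕ → X := Subtype.val u

theorem exists_sum (u : GammaSpace X) :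
    ∃ S : Lp X 2 gaussianSeq, Tendsto (gaussianPartialSum u.seq) atTop (𝓝 S) := Subtype.prop u

/-- The sum `∑ γₙ xₙ` in `L²(Ω; X)`. -/
def gaussianSum : GammaSpace X →ₗ[ℂ] Lp X 2 gaussianSeq where
  toFun u := u.exists_sum.choose
  map_add' u v := by
    refine tendsto_nhds_unique (u + v).exists_sum.choose_spec
      ((u.exists_sum.choose_spec.add v.exists_sum.choose_spec).congr fun N => ?_)
    have h : (u + v).seq = u.seq + v.seq := rfl
    simp [gaussianPartialSum, Finset.sum_add_distrib, h]
  map_smul' c u := by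
    refine tendsto_nhds_unique (c • u).exists_sum.choose_spec
      ((u.exists_sum.choose_spec.const_smul c).congr fun N => ?_)
    have h : (c • u).seq = c • u.seq := rfl
    simp [gaussianPartialSum, Finset.smul_sum, h]

theorem tendsto_gaussianSum (u : GammaSpace X) :
    Tendsto (gaussianPartialSum u.seq) atTop (𝓝 (gaussianSum u)) := u.exists_sum.choose_spec

theorem inner_coord (n k : ℕ) (c : ℂ) :
    inner ℂ (gaussianTerm ℂ n 1) (gaussianTerm ℂ k c) = if n = k then c else 0 := by
  have hae : (fun ω => inner ℂ ((gaussianTerm ℂ n 1 : Lp ℂ 2 gaussianSeq) ω)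
      ((gaussianTerm ℂ k c : Lp ℂ 2 gaussianSeq) ω)) =ᵐ[gaussianSeq]
      fun ω => ((ω n * ω k : ℝ) : ℂ) * c := by
    filter_upwards [(memLp_gaussianTerm n (1 : ℂ)).coeFn_toLp,
      (memLp_gaussianTerm k c).coeFn_toLp] with ω h1 h2
    have h1' : (gaussianTerm ℂ n 1 : Lp ℂ 2 gaussianSeq) ω = (ω n : ℂ) • (1 : ℂ) := h1
    have h2' : (gaussianTerm ℂ k c : Lp ℂ 2 gaussianSeq) ω = (ω k : ℂ) • c := h2
    rw [h1', h2']
    simp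
    ring
  have hmean : ∀ j, ∫ ω, ω j ∂gaussianSeq = 0 := fun j => by
    have h := (measurePreserving_eval_infinitePi (fun _ : ℕ => gaussianReal 0 1) j).map_eq
    have h2 : ∫ x, x ∂((gaussianSeq).map (Function.eval j)) = 0 := by
      rw [gaussianSeq, h]; exact integral_id_gaussianReal
    rwa [integral_map (measurable_pi_apply j).aemeasurable (by fun_prop)] at h2
  have hsq : ∀ j, ∫ ω, ω j * ω j ∂gaussianSeq = 1 := fun j => by
    have h := (measurePreserving_eval_infinitePi (fun _ : ℕ => gaussianReal 0 1) j).map_eq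
    have h2 : ∫ x, x * x ∂((gaussianSeq).map (Function.eval j)) = 1 := by
      rw [gaussianSeq, h]
      have hv : Var[id; gaussianReal 0 1] = 1 := by simp [variance_id_gaussianReal]
      rw [variance_eq_integral (by fun_prop)] at hv
      simpa [integral_id_gaussianReal, pow_two] using hv
    rwa [integral_map (measurable_pi_apply j).aemeasurable (by fun_prop)] at h2
  rw [L2.inner_def, integral_congr_ae hae, integral_mul_const, integral_complex_ofReal]
  split_ifs with h
  · subst h; simp [hsq]
  · have hind : IndepFun (fun ω : ℕ → ℝ => ω n) (fun ω : ℕ → ℝ => ω k) gaussianSeq :=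
      (iIndepFun_infinitePi (P := fun _ : ℕ => gaussianReal 0 1) (X := fun _ x => x)
        (fun _ => measurable_id)).indepFun h
    have h0 := hind.integral_fun_mul_eq_mul_integral
      (memLp_coord n).aestronglyMeasurable (memLp_coord k).aestronglyMeasurable
    rw [h0]; simp [hmean]

theorem gaussianSum_injective : Function.Injective (gaussianSum (X := X)) := by
  rw [injective_iff_map_eq_zero]
  intro u hu
  refine Subtype.ext (funext fun n => ?_)
  change u.seq n = 0
  refine SeparatingDual.eq_zero_of_forall_dual_eq_zero (R := ℂ) fun φ => ?_
  have h0 := u.tendsto_gaussianSum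
  rw [hu] at h0
  have h1 := ((φ.compLpL 2 gaussianSeq).continuous.tendsto 0).comp h0
  have h2 : Tendsto (fun N => inner ℂ (gaussianTerm ℂ n 1)
      (φ.compLpL 2 gaussianSeq (gaussianPartialSum u.seq N))) atTop (𝓝 0) := by
    have := (tendsto_const_nhds (x := gaussianTerm ℂ n 1)).inner (𝕜 := ℂ) h1
    simpa using this
  have hterm : ∀ k x, φ.compLpL 2 gaussianSeq (gaussianTerm X k x) = gaussianTerm ℂ k (φ x) := by
    intro k x
    apply Lp.ext
    filter_upwards [ContinuousLinearMap.coeFn_compLpL (p := 2) (μ := gaussianSeq) φ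
      (gaussianTerm X k x),
      (memLp_gaussianTerm k x).coeFn_toLp, (memLp_gaussianTerm k (φ x)).coeFn_toLp]
      with ω e1 e2 e3
    have e2' : (gaussianTerm X k x : Lp X 2 gaussianSeq) ω = (ω k : ℂ) • x := e2
    have e3' : (gaussianTerm ℂ k (φ x) : Lp ℂ 2 gaussianSeq) ω = (ω k : ℂ) • φ x := e3
    rw [e1, e2', e3', map_smul]
  refine tendsto_nhds_unique (tendsto_const_nhds.congr' ?_) h2
  filter_upwards [eventually_gt_atTop n] with N hN
  simp only [gaussianPartialSum, map_sum, hterm, inner_sum, inner_coord]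
  simp [hN]

/-- The norm of `γ(ℓ₂; X)` is `‖u‖ = (𝔼 ‖∑ γₙ u(eₙ)‖²)^{1/2}`. -/
instance : NormedAddCommGroup (GammaSpace X) :=
  NormedAddCommGroup.induced (GammaSpace X) (Lp X 2 gaussianSeq) gaussianSum
    gaussianSum_injective

instance : NormedSpace ℂ (GammaSpace X) :=
  NormedSpace.induced ℂ (GammaSpace X) (Lp X 2 gaussianSeq) gaussianSum

end GammaSpace

/-! ## Stolz domains and Ritt operators -/

/-- The Stolz domain `{z ∈ 𝔻 : |1 - z| / (1 - |z|) < ω}`. -/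
def stolz (ω : ℝ) : Set ℂ :=
  {z | ‖z‖ < 1 ∧ ‖1 - z‖ / (1 - ‖z‖) < ω}

/-- The boundary of `stolz θ` (for `θ > 1`), run through once counterclockwise, from `1` to `1`,
as the parameter runs through `[-arccos (1/θ), arccos (1/θ)]`. -/
def stolzCurve (θ t : ℝ) : ℂ :=
  1 - ((2 * θ / (θ ^ 2 - 1) * (θ * Real.cos t - 1) : ℝ) : ℂ) * Complex.exp (t * Complex.I)

variable {X : Type*} [NormedAddCommGroup X] [NormedSpace ℂ X]

/-- A Ritt operator: `σ(T)` lies in the closed unit disc and `(λ - 1) R(λ, T)` is bounded on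
`|λ| > 1`. -/
def IsRitt (T : X →L[ℂ] X) : Prop :=
  spectrum ℂ T ⊆ Metric.closedBall 0 1 ∧
    ∃ K : ℝ, 0 < K ∧ ∀ z : ℂ, 1 < ‖z‖ → ‖(z - 1) • resolvent T z‖ ≤ K

/-- A Ritt operator of type `ω`: its spectrum lies in the closure of `stolz ω`, and
`(λ - 1) R(λ, T)` is bounded outside every larger Stolz domain. -/
def IsRittOfType (T : X →L[ℂ] X) (ω : ℝ) : Prop :=
  IsRitt T ∧ spectrum ℂ T ⊆ closure (stolz ω) ∧
    ∀ θ : ℝ, ω < θ → ∃ C : ℝ, ∀ z : ℂ, z ∉ stolz θ → ‖(z - 1) • resolvent T z‖ ≤ C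

/-! ## The `H^∞`-calculus -/

/-- `f` is a bounded holomorphic function on `stolz ν`. -/
def IsHInfty (ν : ℝ) (f : ℂ → ℂ) : Prop :=
  DifferentiableOn ℂ f (stolz ν) ∧ ∃ M : ℝ, ∀ z ∈ stolz ν, ‖f z‖ ≤ M

/-- `φ(z) / (1 - z)` is integrable along the boundary of `stolz θ`. -/
def IntegrableOnStolzBoundary (θ : ℝ) (φ : ℂ → ℂ) : Prop :=
  IntervalIntegrable
    (fun t : ℝ => φ (stolzCurve θ t) / (1 - stolzCurve θ t) * deriv (stolzCurve θ) t)
    volume (-Real.arccos (1 / θ)) (Real.arccos (1 / θ))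

/-- `(2πi)⁻¹ ∫ φ(z) R(z, T) dz` over the boundary of `stolz θ`. -/
def cauchyIntegral (T : X →L[ℂ] X) (θ : ℝ) (φ : ℂ → ℂ) : X →L[ℂ] X :=
  (2 * Real.pi * Complex.I : ℂ)⁻¹ •
    ∫ t in (-Real.arccos (1 / θ))..(Real.arccos (1 / θ)),
      (φ (stolzCurve θ t) * deriv (stolzCurve θ) t) • resolvent T (stolzCurve θ t)

/-- The elementary calculus: `φ` is an elementary function (that is, `φ ∈ H^∞(stolz ν)` and
`φ(z) / (1 - z)` is integrable over the boundary of `stolz θ` for some `θ ∈ (ω, ν)`), and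
`A = φ(T)` is given by the Cauchy integral over such a boundary. -/
def ElementaryCalculus (T : X →L[ℂ] X) (ω ν : ℝ) (φ : ℂ → ℂ) (A : X →L[ℂ] X) : Prop :=
  IsHInfty ν φ ∧ ∃ θ : ℝ, ω < θ ∧ θ < ν ∧ IntegrableOnStolzBoundary θ φ ∧
    A = cauchyIntegral T θ φ

/-- `f(T) = S`, where `f(T) = e(T)⁻¹ (e f)(T)` for a regulariser `e` of `f`: an elementary
function for which `e(T)` is injective and `e f` is elementary. Here `S` is an everywhere defined
bounded operator, so that `e(T)⁻¹ (e f)(T) = S` says that `e(T) S = (e f)(T)`. -/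
def ExtendedCalculus (T : X →L[ℂ] X) (ω ν : ℝ) (f : ℂ → ℂ) (S : X →L[ℂ] X) : Prop :=
  ∃ (e : ℂ → ℂ) (A B : X →L[ℂ] X),
    ElementaryCalculus T ω ν e A ∧ Function.Injective A ∧
    ElementaryCalculus T ω ν (fun z => e z * f z) B ∧ A ∘L S = B

/-- `T` has a bounded `H^∞(stolz ν)`-calculus: for every `f ∈ H^∞(stolz ν)` the operator
`f(T)` is defined and bounded. -/
def HasBoundedHInftyCalculus (T : X →L[ℂ] X) (ω ν : ℝ) : Prop :=
  ∀ f : ℂ → ℂ, IsHInfty ν f → ∃ S : X →L[ℂ] X, ExtendedCalculus T ω ν f S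

/-! ## Square functions -/

/-- The adjoint `T'` on the dual space `X'`. -/
def adjoint (T : X →L[ℂ] X) : StrongDual ℂ X →L[ℂ] StrongDual ℂ X :=
  (ContinuousLinearMap.compL ℂ X X ℂ).flip T

/-- The sequence `(k^{m - 1/2} T^{k-1} (I - T)^m x)_{k ≥ 1}`, indexed by `n = k - 1 ≥ 0`. -/
def squareFunctionSeq (T : X →L[ℂ] X) (m : ℕ) (x : X) (n : ℕ) : X :=
  ((((n : ℝ) + 1) ^ ((m : ℝ) - 1 / 2) : ℝ) : ℂ) • (T ^ n) (((1 - T) ^ m) x)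

/-- The square function `Φ_m` of `T` is a bounded operator `X → γ(ℓ₂; X)`. -/
def HasSquareFunction (T : X →L[ℂ] X) (m : ℕ) : Prop :=
  ∃ Φ : X →L[ℂ] GammaSpace X, ∀ x n, (Φ x).seq n = squareFunctionSeq T m x n

/-- The dual square function `Φ_m^*` of `T` is a bounded operator `X' → γ(ℓ₂; X)'`, where a
sequence `(x'ₙ)` in `X'` acts on `γ(ℓ₂; X)` by `u ↦ ∑ ⟨x'ₙ, u(eₙ)⟩`. -/
def HasDualSquareFunction (T : X →L[ℂ] X) (m : ℕ) : Prop :=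
  ∃ Ψ : StrongDual ℂ X →L[ℂ] StrongDual ℂ (GammaSpace X), ∀ x' u,
    HasSum (fun n => squareFunctionSeq (adjoint T) m x' n (u.seq n)) (Ψ x' u)

end RittCalculus

end

namespace RittCalculus

/-! ### Geometry of Stolz domains -/

/-! Put `A n = (n+1)^(m-1/2) T^n (1-T)^m` and `D l = √(l+1) (A l - A (l+1))`. The proof treats `A`
as sums of its differences and shows that the `D l` may be multiplied by arbitrary bounded
coefficients.

On a Stolz domain `|1-z| ≤ ν (1-|z|)`, and `∑ (l+1)^m |z|^l` is of order `(1-|z|)^(-m-1)`. Hence the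
polynomials behind `D l` are absolutely summable, uniformly in `z`, and those behind `A R` are
`O(R^(-1/2))`. The closed graph theorem turns the bounded calculus into `‖p(T)‖ ≤ K sup |p|` for
polynomials (`IsRittOfType.exists_polynomial_bound`). So `‖∑ α_l D l‖ ≤ K` whenever `|α_l| ≤ 1`, and
`A R → 0` (`IsRittOfType.exists_unconditional_bound`). To get there, the calculus with arbitrary
regularisers is compared with `f ↦ ((1-z) f)(T)`, whose Cauchy integral always converges because
`1-z` cancels the singularity of the resolvent at the vertex.

Summation by parts gives `∑ γ_n A n x = ∑ g_l D l x`, where `g_l = (l+1)^(-1/2) ∑_{n ≤ l} γ_n`. The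
`g_l` have variance one, but are neither bounded nor independent. This is where cotype `q` enters:
`α ↦ ∑ α_l D l x` is `(q,1)`-summing on `ℓ_∞`, and Pisier's factorization argument shows that
multipliers bounded by one and of mean modulus at most `p` contribute at most a constant times `p`
to the `q`-th moment (`integral_rpow_norm_le`). Cutting `g_l` into the levels `n ≤ |g_l| < n+1`,
with `p` of order `exp(-n)`, gives a convergent sum (`eLpNorm_sum_smul_le`). Cotype also makes the
tails small, so that the Gaussian series converges.

For the dual estimate the Gaussian multipliers are replaced by bounded ones with the same
correlations with the `γ_n`: a normalised `sin` of the Gaussian combination has this property, by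
Gaussian integration by parts. The pairing `∑ ⟨φ, A n x_n⟩` thus becomes, in the limit, the
expectation of `⟨φ, (∑ α_l D l)(∑ γ_n x_n)⟩` with bounded `α_l` (`norm_sum_mul_apply_le`). -/

theorem mem_stolz_iff {ω : ℝ} (hω : 0 < ω) {z : ℂ} :
    z ∈ stolz ω ↔ ‖1 - z‖ + ω * ‖z‖ < ω := by
  constructor
  · rintro ⟨h1, h2⟩
    rw [div_lt_iff₀ (by linarith)] at h2
    linarith
  · intro h
    have h1 : ‖z‖ < 1 := by
      by_contra! hz
      nlinarith [norm_nonneg (1 - z)]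
    refine ⟨h1, ?_⟩
    rw [div_lt_iff₀ (by linarith)]
    linarith

theorem isOpen_stolz {ω : ℝ} (hω : 0 < ω) : IsOpen (stolz ω) := by
  have : stolz ω = {z | ‖1 - z‖ + ω * ‖z‖ < ω} := by
    ext z; exact mem_stolz_iff hω
  rw [this]
  exact isOpen_lt (by fun_prop) continuous_const

/-- By `mem_stolz_iff` the domain is a strict sublevel set of a convex function. Convexity provides
primitives, and together with `0` in the domain it provides star-shapedness. -/
theorem convex_stolz {ω : ℝ} (hω : 0 < ω) : Convex ℝ (stolz ω) := by
  intro x hx y hy a b ha hb hab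
  rw [mem_stolz_iff hω] at hx hy ⊢
  have h1 : ‖1 - (a • x + b • y)‖ ≤ a * ‖1 - x‖ + b * ‖1 - y‖ := by
    have : 1 - (a • x + b • y) = a • (1 - x) + b • (1 - y) := by
      have hab' : (a : ℂ) + b = 1 := by exact_mod_cast hab
      simp only [Complex.real_smul]
      linear_combination - hab'
    rw [this]
    refine (norm_add_le _ _).trans ?_
    rw [norm_smul, norm_smul, Real.norm_of_nonneg ha, Real.norm_of_nonneg hb]
  have h2 : ‖a • x + b • y‖ ≤ a * ‖x‖ + b * ‖y‖ := by
    refine (norm_add_le _ _).trans ?_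
    rw [norm_smul, norm_smul, Real.norm_of_nonneg ha, Real.norm_of_nonneg hb]
  rcases ha.eq_or_lt with rfl | ha'
  · obtain rfl : b = 1 := by linarith
    nlinarith
  · nlinarith

theorem stolz_mono {ω θ : ℝ} (h : ω ≤ θ) : stolz ω ⊆ stolz θ :=
  fun _ hz => ⟨hz.1, hz.2.trans_le h⟩

theorem norm_le_of_mem_closure_stolz {ω : ℝ} (hω : 0 < ω) {z : ℂ} (hz : z ∈ closure (stolz ω)) :
    ‖1 - z‖ + ω * ‖z‖ ≤ ω := by
  have hc : IsClosed {z : ℂ | ‖1 - z‖ + ω * ‖z‖ ≤ ω} := isClosed_le (by fun_prop) continuous_const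
  exact closure_minimal (fun z hz => ((mem_stolz_iff hω).1 hz).le) hc hz

theorem norm_lt_one_of_mem_stolz {ω : ℝ} {z : ℂ} (hz : z ∈ stolz ω) : ‖z‖ < 1 := hz.1

/-- Away from the vertex `1 - ‖z‖` is positive, so enlarging the aperture makes the inequality
strict. The vertex is the only point of the smaller closed domain that the larger open one misses.
-/
theorem mem_stolz_of_le {ω θ : ℝ} (hω : 0 < ω) (hθ : ω < θ) {z : ℂ} (hz1 : z ≠ 1)
    (hz : ‖1 - z‖ + ω * ‖z‖ ≤ ω) : z ∈ stolz θ := by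
  rw [mem_stolz_iff (hω.trans hθ)]
  have h1 : 0 < ‖1 - z‖ := norm_pos_iff.2 (sub_ne_zero.2 hz1.symm)
  have h2 : ‖z‖ < 1 := by
    by_contra! h
    nlinarith
  nlinarith

/-- Points outside a Stolz domain are separated from a smaller one, relative to the distance
to the vertex. -/
theorem separation_stolz {θ θ' : ℝ} (hθ : 0 < θ) (hθ' : θ < θ') {z w : ℂ}
    (hz : ‖1 - z‖ + θ * ‖z‖ ≤ θ) (hw : θ' ≤ ‖1 - w‖ + θ' * ‖w‖) :
    (θ' - θ) * ‖1 - w‖ ≤ θ' * (1 + θ) * ‖w - z‖ := by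
  have h1 : ‖1 - w‖ ≤ ‖1 - z‖ + ‖w - z‖ := by
    have : 1 - w = (1 - z) - (w - z) := by ring
    rw [this]; exact norm_sub_le _ _
  have h2 : ‖w‖ ≤ ‖z‖ + ‖w - z‖ := by
    have : w = z + (w - z) := by ring
    nth_rw 1 [this]; exact norm_add_le _ _
  have h3 : θ' * ‖1 - w‖ ≤ θ' * (θ * (1 - ‖w‖) + (1 + θ) * ‖w - z‖) := by
    refine mul_le_mul_of_nonneg_left ?_ (hθ.trans hθ').le
    nlinarith
  nlinarith

/-! ### The boundary curve -/

/-- Half of the opening angle of `stolz θ` at its vertex `1`. -/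
noncomputable def halfAngle (θ : ℝ) : ℝ := Real.arccos (1 / θ)

theorem halfAngle_pos {θ : ℝ} (hθ : 1 < θ) : 0 < halfAngle θ := by
  rw [halfAngle, Real.arccos_pos, div_lt_one (by linarith)]; exact hθ

theorem halfAngle_lt {θ : ℝ} (hθ : 1 < θ) : halfAngle θ < Real.pi / 2 := by
  rw [halfAngle, Real.arccos_lt_pi_div_two]; positivity

theorem cos_halfAngle {θ : ℝ} (hθ : 1 < θ) : Real.cos (halfAngle θ) = 1 / θ := by
  have h0 : 0 < 1 / θ := by positivity
  have h1 : 1 / θ < 1 := by rw [div_lt_one (by linarith)]; exact hθ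
  exact Real.cos_arccos (by linarith) h1.le

theorem one_lt_mul_cos {θ t : ℝ} (hθ : 1 < θ) (ht : t ∈ Ioo (-halfAngle θ) (halfAngle θ)) :
    1 < θ * Real.cos t := by
  have h1 : Real.cos (halfAngle θ) < Real.cos t := by
    rw [← Real.cos_abs t]
    refine Real.cos_lt_cos_of_nonneg_of_le_pi_div_two (abs_nonneg t) (halfAngle_lt hθ).le ?_
    exact abs_lt.2 ht
  rw [cos_halfAngle hθ, div_lt_iff₀ (by linarith)] at h1
  linarith

/-- Distance of `stolzCurve θ t` to the vertex. -/
noncomputable def stolzRadius (θ t : ℝ) : ℝ := 2 * θ / (θ ^ 2 - 1) * (θ * Real.cos t - 1)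

theorem stolzCurve_eq (θ t : ℝ) :
    stolzCurve θ t = 1 - (stolzRadius θ t : ℂ) * Complex.exp (t * Complex.I) := rfl

theorem stolzRadius_pos {θ t : ℝ} (hθ : 1 < θ) (ht : t ∈ Ioo (-halfAngle θ) (halfAngle θ)) :
    0 < stolzRadius θ t := by
  have h1 := one_lt_mul_cos hθ ht
  have h2 : 0 < θ ^ 2 - 1 := by nlinarith
  have h3 : 0 < θ * Real.cos t - 1 := by linarith
  unfold stolzRadius
  positivity

theorem norm_one_sub_stolzCurve {θ t : ℝ} (hθ : 1 < θ)
    (ht : t ∈ Ioo (-halfAngle θ) (halfAngle θ)) : ‖1 - stolzCurve θ t‖ = stolzRadius θ t := by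
  rw [stolzCurve_eq, sub_sub_cancel, norm_mul, Complex.norm_exp_ofReal_mul_I, mul_one,
    Complex.norm_real, Real.norm_of_nonneg (stolzRadius_pos hθ ht).le]

theorem stolzCurve_re (θ t : ℝ) :
    (stolzCurve θ t).re = 1 - stolzRadius θ t * Real.cos t := by
  rw [stolzCurve_eq, Complex.sub_re, Complex.re_ofReal_mul, Complex.exp_ofReal_mul_I_re]; simp

theorem stolzCurve_im (θ t : ℝ) :
    (stolzCurve θ t).im = - (stolzRadius θ t * Real.sin t) := by
  rw [stolzCurve_eq, Complex.sub_im, Complex.im_ofReal_mul, Complex.exp_ofReal_mul_I_im]; simp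

/-- In polar coordinates `z = 1 - ρ e^{it}` the boundary equation is `|z| = 1 - ρ/θ`. Squaring and
dividing by `ρ` gives `ρ (θ² - 1) = 2θ (θ cos t - 1)`, which is the formula for `stolzRadius`. -/
theorem norm_stolzCurve {θ t : ℝ} (hθ : 1 < θ) :
    ‖stolzCurve θ t‖ = 1 - stolzRadius θ t / θ := by
  have hθ0 : 0 < θ := by linarith
  have h2 : 0 < θ ^ 2 - 1 := by nlinarith
  have hle : 0 ≤ 1 - stolzRadius θ t / θ := by
    have h3 : stolzRadius θ t / θ = 2 * (θ * Real.cos t - 1) / (θ ^ 2 - 1) := by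
      unfold stolzRadius; field_simp
    rw [h3, sub_nonneg, div_le_one h2]
    nlinarith [mul_le_mul_of_nonneg_left (Real.cos_le_one t) hθ0.le, sq_nonneg (θ - 1)]
  rw [← sq_eq_sq₀ (norm_nonneg _) hle, ← Complex.normSq_eq_norm_sq, Complex.normSq_apply,
    stolzCurve_re, stolzCurve_im]
  have hρ : stolzRadius θ t * (θ ^ 2 - 1) = 2 * θ * (θ * Real.cos t - 1) := by
    unfold stolzRadius; field_simp
  have hs := Real.sin_sq_add_cos_sq t
  field_simp
  linear_combination (stolzRadius θ t * θ) ^ 2 * hs + stolzRadius θ t * hρ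

theorem stolzCurve_boundary {θ t : ℝ} (hθ : 1 < θ) (ht : t ∈ Ioo (-halfAngle θ) (halfAngle θ)) :
    ‖1 - stolzCurve θ t‖ + θ * ‖stolzCurve θ t‖ = θ := by
  have : θ ≠ 0 := by linarith
  rw [norm_one_sub_stolzCurve hθ ht, norm_stolzCurve hθ]
  field_simp
  ring

theorem stolzCurve_ne_one {θ t : ℝ} (hθ : 1 < θ) (ht : t ∈ Ioo (-halfAngle θ) (halfAngle θ)) :
    stolzCurve θ t ≠ 1 := by
  intro h
  have := norm_one_sub_stolzCurve hθ ht
  rw [h] at this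
  simp at this
  exact (stolzRadius_pos hθ ht).ne this

theorem stolzCurve_notMem {θ t : ℝ} (hθ : 1 < θ) (ht : t ∈ Ioo (-halfAngle θ) (halfAngle θ)) :
    stolzCurve θ t ∉ stolz θ := by
  rw [mem_stolz_iff (by linarith), stolzCurve_boundary hθ ht]
  exact lt_irrefl _

theorem stolzCurve_mem {θ θ' t : ℝ} (hθ : 1 < θ) (hθ' : θ < θ')
    (ht : t ∈ Ioo (-halfAngle θ) (halfAngle θ)) : stolzCurve θ t ∈ stolz θ' :=
  mem_stolz_of_le (by linarith) hθ' (stolzCurve_ne_one hθ ht) (stolzCurve_boundary hθ ht).le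

theorem stolzCurve_halfAngle {θ : ℝ} (hθ : 1 < θ) : stolzCurve θ (halfAngle θ) = 1 := by
  have : θ ≠ 0 := by linarith
  rw [stolzCurve_eq, stolzRadius, cos_halfAngle hθ]
  field_simp
  simp

theorem stolzCurve_neg_halfAngle {θ : ℝ} (hθ : 1 < θ) : stolzCurve θ (-halfAngle θ) = 1 := by
  have : θ ≠ 0 := by linarith
  rw [stolzCurve_eq, stolzRadius, Real.cos_neg, cos_halfAngle hθ]
  field_simp
  simp

theorem contDiff_stolzCurve (θ : ℝ) : ContDiff ℝ 1 (stolzCurve θ) := by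
  unfold stolzCurve
  refine contDiff_const.sub (ContDiff.mul ?_ ?_)
  · exact Complex.ofRealCLM.contDiff.comp
      (contDiff_const.mul ((contDiff_const.mul Real.contDiff_cos).sub contDiff_const))
  · exact Complex.contDiff_exp.comp (Complex.ofRealCLM.contDiff.mul contDiff_const)

theorem hasDerivAt_stolzCurve (θ t : ℝ) :
    HasDerivAt (stolzCurve θ) (deriv (stolzCurve θ) t) t :=
  ((contDiff_stolzCurve θ).differentiable one_ne_zero t).hasDerivAt

theorem continuous_stolzCurve (θ : ℝ) : Continuous (stolzCurve θ) := (contDiff_stolzCurve θ).continuous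

theorem continuous_deriv_stolzCurve (θ : ℝ) : Continuous (deriv (stolzCurve θ)) :=
  (contDiff_stolzCurve θ).continuous_deriv le_rfl

theorem norm_stolzCurve_le_one {θ t : ℝ} (hθ : 1 < θ)
    (ht : t ∈ Icc (-halfAngle θ) (halfAngle θ)) : ‖stolzCurve θ t‖ ≤ 1 := by
  by_cases h : t ∈ Ioo (-halfAngle θ) (halfAngle θ)
  · have := stolzRadius_pos hθ h
    rw [norm_stolzCurve hθ]
    have : 0 < stolzRadius θ t / θ := by positivity
    linarith
  · have : t = -halfAngle θ ∨ t = halfAngle θ := by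
      rcases ht with ⟨h1, h2⟩
      rcases h1.eq_or_lt with h1 | h1
      · left; exact h1.symm
      · rcases h2.eq_or_lt with h2 | h2
        · right; exact h2
        · exact absurd ⟨h1, h2⟩ h
    rcases this with rfl | rfl
    · rw [stolzCurve_neg_halfAngle hθ]; simp
    · rw [stolzCurve_halfAngle hθ]; simp

/-! ### Contour integrals over the boundary of a Stolz domain -/

section Contour

variable {E : Type*} [NormedAddCommGroup E] [NormedSpace ℂ E]

/-- The boundary of `stolz θ` without its vertex. -/
def stolzArc (θ : ℝ) : Set ℂ := stolzCurve θ '' Ioo (-halfAngle θ) (halfAngle θ)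

/-- `F` is integrable along the boundary of `stolz θ`. -/
def StolzIntegrable (θ : ℝ) (F : ℂ → E) : Prop :=
  IntervalIntegrable (fun t => deriv (stolzCurve θ) t • F (stolzCurve θ t)) volume
    (-halfAngle θ) (halfAngle θ)

/-- The contour integral `∫ F(z) dz` along the boundary of `stolz θ`. -/
noncomputable def stolzIntegral (θ : ℝ) (F : ℂ → E) : E :=
  ∫ t in (-halfAngle θ)..(halfAngle θ), deriv (stolzCurve θ) t • F (stolzCurve θ t)

theorem stolzArc_subset {θ θ' : ℝ} (hθ : 1 < θ) (hθ' : θ < θ') : stolzArc θ ⊆ stolz θ' := by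
  rintro _ ⟨t, ht, rfl⟩
  exact stolzCurve_mem hθ hθ' ht

theorem ne_one_of_mem_stolzArc {θ : ℝ} (hθ : 1 < θ) {z : ℂ} (hz : z ∈ stolzArc θ) : z ≠ 1 := by
  obtain ⟨t, ht, rfl⟩ := hz
  exact stolzCurve_ne_one hθ ht

theorem norm_of_mem_stolzArc {θ : ℝ} (hθ : 1 < θ) {z : ℂ} (hz : z ∈ stolzArc θ) :
    ‖1 - z‖ + θ * ‖z‖ = θ := by
  obtain ⟨t, ht, rfl⟩ := hz
  exact stolzCurve_boundary hθ ht

theorem notMem_of_mem_stolzArc {θ : ℝ} (hθ : 1 < θ) {z : ℂ} (hz : z ∈ stolzArc θ) :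
    z ∉ stolz θ := by
  obtain ⟨t, ht, rfl⟩ := hz
  exact stolzCurve_notMem hθ ht

theorem neg_halfAngle_lt {θ : ℝ} (hθ : 1 < θ) : -halfAngle θ < halfAngle θ := by
  have := halfAngle_pos hθ; linarith

theorem exists_bound_deriv_stolzCurve (θ : ℝ) :
    ∃ D : ℝ, 0 ≤ D ∧ ∀ t ∈ Icc (-halfAngle θ) (halfAngle θ), ‖deriv (stolzCurve θ) t‖ ≤ D := by
  obtain ⟨D, hD⟩ := (isCompact_Icc (a := -halfAngle θ) (b := halfAngle θ)).exists_bound_of_continuousOn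
    (continuous_deriv_stolzCurve θ).continuousOn
  exact ⟨max D 0, le_max_right _ _, fun t ht => (hD t ht).trans (le_max_left _ _)⟩

theorem StolzIntegrable.of_bounded {θ : ℝ} (hθ : 1 < θ) {F : ℂ → E}
    (hF : ContinuousOn F (stolzArc θ)) {M : ℝ} (hM : ∀ z ∈ stolzArc θ, ‖F z‖ ≤ M) :
    StolzIntegrable θ F := by
  obtain ⟨D, hD0, hD⟩ := exists_bound_deriv_stolzCurve θ
  rw [StolzIntegrable, intervalIntegrable_iff_integrableOn_Ioo_of_le (neg_halfAngle_lt hθ).le]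
  have hmeas : AEStronglyMeasurable (fun t => deriv (stolzCurve θ) t • F (stolzCurve θ t))
      (volume.restrict (Ioo (-halfAngle θ) (halfAngle θ))) := by
    refine ContinuousOn.aestronglyMeasurable ?_ measurableSet_Ioo
    exact (continuous_deriv_stolzCurve θ).continuousOn.smul
      (hF.comp (continuous_stolzCurve θ).continuousOn (mapsTo_image _ _))
  refine Integrable.of_bound hmeas (D * M) ?_
  refine (ae_restrict_iff' measurableSet_Ioo).2 (.of_forall fun t ht => ?_)
  rw [norm_smul]
  exact mul_le_mul (hD t (Ioo_subset_Icc_self ht)) (hM _ (mem_image_of_mem _ ht)) (norm_nonneg _) hD0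

theorem stolzIntegral_congr {θ : ℝ} (hθ : 1 < θ) {F G : ℂ → E} (h : EqOn F G (stolzArc θ)) :
    stolzIntegral θ F = stolzIntegral θ G := by
  unfold stolzIntegral
  rw [intervalIntegral.integral_of_le (neg_halfAngle_lt hθ).le,
    intervalIntegral.integral_of_le (neg_halfAngle_lt hθ).le, integral_Ioc_eq_integral_Ioo,
    integral_Ioc_eq_integral_Ioo]
  refine setIntegral_congr_fun measurableSet_Ioo fun t ht => ?_
  rw [h (mem_image_of_mem _ ht)]

theorem StolzIntegrable.congr {θ : ℝ} (hθ : 1 < θ) {F G : ℂ → E} (hF : StolzIntegrable θ F)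
    (h : EqOn F G (stolzArc θ)) : StolzIntegrable θ G := by
  rw [StolzIntegrable, intervalIntegrable_iff_integrableOn_Ioo_of_le (neg_halfAngle_lt hθ).le] at *
  refine hF.congr_fun (fun t ht => ?_) measurableSet_Ioo
  beta_reduce
  rw [h (mem_image_of_mem _ ht)]

theorem stolzIntegral_sub {θ : ℝ} {F G : ℂ → E} (hF : StolzIntegrable θ F)
    (hG : StolzIntegrable θ G) :
    stolzIntegral θ (fun z => F z - G z) = stolzIntegral θ F - stolzIntegral θ G := by
  unfold stolzIntegral
  rw [← intervalIntegral.integral_sub hF hG]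
  simp only [smul_sub]

theorem stolzIntegral_add {θ : ℝ} {F G : ℂ → E} (hF : StolzIntegrable θ F)
    (hG : StolzIntegrable θ G) :
    stolzIntegral θ (fun z => F z + G z) = stolzIntegral θ F + stolzIntegral θ G := by
  unfold stolzIntegral
  rw [← intervalIntegral.integral_add hF hG]
  simp only [smul_add]

theorem StolzIntegrable.add {θ : ℝ} {F G : ℂ → E} (hF : StolzIntegrable θ F)
    (hG : StolzIntegrable θ G) : StolzIntegrable θ (fun z => F z + G z) := by
  have := IntervalIntegrable.add hF hG
  refine this.congr (fun t _ => ?_)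
  simp [smul_add]

theorem StolzIntegrable.sub {θ : ℝ} {F G : ℂ → E} (hF : StolzIntegrable θ F)
    (hG : StolzIntegrable θ G) : StolzIntegrable θ (fun z => F z - G z) := by
  have := IntervalIntegrable.sub hF hG
  refine this.congr (fun t _ => ?_)
  simp [smul_sub]

theorem stolzIntegral_const_smul {θ : ℝ} (c : ℂ) (F : ℂ → E) :
    stolzIntegral θ (fun z => c • F z) = c • stolzIntegral θ F := by
  unfold stolzIntegral
  rw [← intervalIntegral.integral_smul]
  simp only [smul_comm c]

theorem stolzIntegral_smul_const [CompleteSpace E] {θ : ℝ} (F : ℂ → ℂ) (A : E) :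
    stolzIntegral θ (fun z => F z • A) = stolzIntegral θ F • A := by
  unfold stolzIntegral
  rw [← intervalIntegral.integral_smul_const]
  simp only [smul_assoc]

theorem StolzIntegrable.smul_const {θ : ℝ} {F : ℂ → ℂ} (hF : StolzIntegrable θ F) (A : E) :
    StolzIntegrable θ (fun z => F z • A) := by
  have : IntervalIntegrable (fun t => (deriv (stolzCurve θ) t • F (stolzCurve θ t)) • A) volume
      (-halfAngle θ) (halfAngle θ) := by
    refine ⟨?_, ?_⟩
    · exact hF.1.smul_const A
    · exact hF.2.smul_const A
  simpa only [smul_assoc] using! this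

theorem stolzIntegral_clm {G : Type*} [NormedAddCommGroup G] [NormedSpace ℂ G] [CompleteSpace E]
    [CompleteSpace G] {θ : ℝ} (L : E →L[ℂ] G) {F : ℂ → E} (hF : StolzIntegrable θ F) :
    stolzIntegral θ (fun z => L (F z)) = L (stolzIntegral θ F) := by
  unfold stolzIntegral
  rw [← L.intervalIntegral_comp_comm hF]
  simp only [map_smul]

theorem norm_stolzIntegral_le {θ : ℝ} (hθ : 1 < θ) : ∃ D : ℝ, 0 ≤ D ∧
    ∀ (F : ℂ → E) (M : ℝ), (∀ z ∈ stolzArc θ, ‖F z‖ ≤ M) → ‖stolzIntegral θ F‖ ≤ D * M := by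
  obtain ⟨D, hD0, hD⟩ := exists_bound_deriv_stolzCurve θ
  have h0 := neg_halfAngle_lt hθ
  refine ⟨D * (halfAngle θ - -halfAngle θ), mul_nonneg hD0 (by linarith), fun F M hM => ?_⟩
  unfold stolzIntegral
  rw [intervalIntegral.integral_of_le h0.le, integral_Ioc_eq_integral_Ioo]
  have := norm_setIntegral_le_of_norm_le_const (μ := volume) (s := Ioo (-halfAngle θ) (halfAngle θ))
    (f := fun t => deriv (stolzCurve θ) t • F (stolzCurve θ t)) (C := D * M) (by simp)
    (fun t ht => by
      rw [norm_smul]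
      exact mul_le_mul (hD t (Ioo_subset_Icc_self ht)) (hM _ (mem_image_of_mem _ ht))
        (norm_nonneg _) hD0)
  rw [Real.volume_real_Ioo_of_le h0.le] at this
  linarith

/-- Integrals of derivatives along the boundary curve. -/
theorem stolzIntegral_eq_zero_of_primitive [CompleteSpace E] {θ : ℝ} (hθ : 1 < θ) {F G : ℂ → E}
    (hG : ∀ z ∈ stolzArc θ, HasDerivAt G (F z) z) (hc : ContinuousOn G (stolzCurve θ ''
      Icc (-halfAngle θ) (halfAngle θ)))
    (hF : StolzIntegrable θ F) : stolzIntegral θ F = 0 := by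
  have := intervalIntegral.integral_eq_sub_of_hasDerivAt_of_le (f := G ∘ stolzCurve θ)
    (neg_halfAngle_lt hθ).le
    (hc.comp (continuous_stolzCurve θ).continuousOn (mapsTo_image _ _))
    (fun t ht => (hG _ (mem_image_of_mem _ ht)).scomp t (hasDerivAt_stolzCurve θ t)) hF
  rw [stolzIntegral, this]
  simp [stolzCurve_halfAngle hθ, stolzCurve_neg_halfAngle hθ]

/-- **Cauchy's theorem** for bounded holomorphic functions on a larger Stolz domain. -/
theorem stolzIntegral_eq_zero {θ μ : ℝ} (hθ : 1 < θ) (hμ : θ < μ) {F : ℂ → ℂ}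
    (hF : DifferentiableOn ℂ F (stolz μ)) {M : ℝ} (hM : ∀ z ∈ stolz μ, ‖F z‖ ≤ M) :
    stolzIntegral θ F = 0 := by
  have hμ0 : 0 < μ := by linarith
  obtain ⟨G, hG⟩ := (convex_stolz hμ0).exists_forall_hasDerivWithinAt hF
  have hM0 : 0 ≤ M := (norm_nonneg _).trans (hM 0 (by rw [mem_stolz_iff hμ0]; simp; linarith))
  -- The closed contour passes through `1`, which is not in `stolz μ`. The primitive has bounded
  -- derivative on a convex set, hence is Lipschitz and extends continuously to the vertex.
  have hlip : LipschitzOnWith ⟨M, hM0⟩ G (stolz μ) :=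
    (convex_stolz hμ0).lipschitzOnWith_of_nnnorm_hasDerivWithin_le hG fun z hz => hM z hz
  obtain ⟨g, hg, hgG⟩ := hlip.extend_finite_dimension
  refine stolzIntegral_eq_zero_of_primitive (G := g) hθ (fun z hz => ?_) hg.continuous.continuousOn ?_
  · have hz' := stolzArc_subset hθ hμ hz
    have h1 := (hG z hz').hasDerivAt ((isOpen_stolz hμ0).mem_nhds hz')
    refine h1.congr_of_eventuallyEq ?_
    filter_upwards [(isOpen_stolz hμ0).mem_nhds hz'] with w hw
    exact (hgG hw).symm
  · exact .of_bounded hθ (hF.continuousOn.mono (stolzArc_subset hθ hμ))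
      fun z hz => hM z (stolzArc_subset hθ hμ hz)

end Contour

/-! ### Winding numbers and Cauchy's integral formula -/

theorem zero_mem_stolz {ω : ℝ} (hω : 1 < ω) : (0 : ℂ) ∈ stolz ω := by
  rw [mem_stolz_iff (by linarith)]; simpa using hω

theorem stolzCurve_closed_boundary {θ t : ℝ} (hθ : 1 < θ)
    (ht : t ∈ Icc (-halfAngle θ) (halfAngle θ)) :
    ‖1 - stolzCurve θ t‖ + θ * ‖stolzCurve θ t‖ = θ := by
  rcases ht.1.eq_or_lt with h | h
  · rw [← h, stolzCurve_neg_halfAngle hθ]; simp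
  rcases ht.2.eq_or_lt with h' | h'
  · rw [h', stolzCurve_halfAngle hθ]; simp
  exact stolzCurve_boundary hθ ⟨h, h'⟩

theorem stolzCurve_ne_zero {θ t : ℝ} (hθ : 1 < θ)
    (ht : t ∈ Icc (-halfAngle θ) (halfAngle θ)) : stolzCurve θ t ≠ 0 := by
  intro h
  have := stolzCurve_closed_boundary hθ ht
  rw [h] at this
  simp at this
  linarith

theorem hasDerivAt_log_const_mul {a z : ℂ} (ha : a ≠ 0) (hz : a * z ∈ Complex.slitPlane) :
    HasDerivAt (fun w => Complex.log (a * w)) z⁻¹ z := by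
  have h := ((hasDerivAt_id z).const_mul a).clog hz
  simp only [id, mul_one] at h
  convert h using 1
  rw [div_mul_cancel_left₀ ha]

theorem stolzCurve_zero (θ : ℝ) (hθ : 1 < θ) :
    stolzCurve θ 0 = -(((θ - 1) / (θ + 1) : ℝ) : ℂ) := by
  have h1 : θ - 1 ≠ 0 := by linarith
  have h2 : θ + 1 ≠ 0 := by linarith
  have h4 : θ ^ 2 - 1 ≠ 0 := by nlinarith
  have h3 : stolzRadius θ 0 = 1 + (θ - 1) / (θ + 1) := by
    rw [stolzRadius, Real.cos_zero]
    field_simp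
    ring
  rw [stolzCurve_eq, h3]
  push_cast
  simp

theorem continuousOn_inv_stolzCurve {θ : ℝ} (hθ : 1 < θ) :
    ContinuousOn (fun t => deriv (stolzCurve θ) t • (stolzCurve θ t)⁻¹)
      (Icc (-halfAngle θ) (halfAngle θ)) :=
  (continuous_deriv_stolzCurve θ).continuousOn.smul
    ((continuous_stolzCurve θ).continuousOn.inv₀ fun _ ht => stolzCurve_ne_zero hθ ht)

/-- The contour is cut at `t = 0`, where it crosses the negative real axis. The first half lies in
the closed upper half plane and the second in the closed lower one, so `log (-i w)` and `log (i w)`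
are primitives of `1/w` there; the jumps of the argument add up to `2π`. -/
theorem stolzIntegral_inv {θ : ℝ} (hθ : 1 < θ) :
    stolzIntegral θ (fun w : ℂ => w⁻¹) = 2 * Real.pi * Complex.I := by
  have ha := halfAngle_pos hθ
  have hpi := halfAngle_lt hθ
  have hpi2 := Real.pi_pos
  have hsub1 : Icc (-halfAngle θ) 0 ⊆ Icc (-halfAngle θ) (halfAngle θ) :=
    Icc_subset_Icc le_rfl ha.le
  have hsub2 : Icc 0 (halfAngle θ) ⊆ Icc (-halfAngle θ) (halfAngle θ) :=
    Icc_subset_Icc (by linarith) le_rfl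
  have hcont := continuousOn_inv_stolzCurve hθ
  have hρ : ∀ t ∈ Icc (-halfAngle θ) (halfAngle θ), 0 ≤ stolzRadius θ t := by
    intro t ht
    have h : stolzRadius θ t / θ = 1 - ‖stolzCurve θ t‖ := by rw [norm_stolzCurve hθ]; ring
    have h' := norm_stolzCurve_le_one hθ ht
    have h3 : 0 ≤ stolzRadius θ t / θ := by rw [h]; linarith
    rw [le_div_iff₀ (by linarith)] at h3
    linarith
  have hup : ∀ t ∈ Icc (-halfAngle θ) 0, -Complex.I * stolzCurve θ t ∈ Complex.slitPlane := by
    intro t ht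
    have him : 0 ≤ (stolzCurve θ t).im := by
      rw [stolzCurve_im]
      have := Real.sin_nonpos_of_nonpos_of_neg_pi_le ht.2 (by linarith [ht.1])
      nlinarith [hρ t (hsub1 ht)]
    rcases him.eq_or_lt with h | h
    · right
      have := stolzCurve_ne_zero hθ (hsub1 ht)
      intro h2
      apply this
      apply Complex.ext
      · simpa using h2
      · exact h.symm
    · left; simpa using h
  have hdown : ∀ t ∈ Icc 0 (halfAngle θ), Complex.I * stolzCurve θ t ∈ Complex.slitPlane := by
    intro t ht
    have him : (stolzCurve θ t).im ≤ 0 := by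
      rw [stolzCurve_im]
      have := Real.sin_nonneg_of_nonneg_of_le_pi ht.1 (by linarith [ht.2])
      nlinarith [hρ t (hsub2 ht)]
    rcases him.eq_or_lt with h | h
    · right
      have := stolzCurve_ne_zero hθ (hsub2 ht)
      intro h2
      apply this
      apply Complex.ext
      · simpa using h2
      · exact h
    · left; simpa using h
  have e1 := intervalIntegral.integral_eq_sub_of_hasDerivAt
    (f := fun t => Complex.log (-Complex.I * stolzCurve θ t))
    (f' := fun t => deriv (stolzCurve θ) t • (stolzCurve θ t)⁻¹) (a := -halfAngle θ) (b := 0)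
    (fun t ht => by
      rw [uIcc_of_le (by linarith)] at ht
      exact (hasDerivAt_log_const_mul (by simp) (hup t ht)).scomp t (hasDerivAt_stolzCurve θ t))
    (ContinuousOn.intervalIntegrable (by rw [uIcc_of_le (by linarith)]; exact hcont.mono hsub1))
  have e2 := intervalIntegral.integral_eq_sub_of_hasDerivAt
    (f := fun t => Complex.log (Complex.I * stolzCurve θ t))
    (f' := fun t => deriv (stolzCurve θ) t • (stolzCurve θ t)⁻¹) (a := 0) (b := halfAngle θ)
    (fun t ht => by
      rw [uIcc_of_le (by linarith)] at ht
      exact (hasDerivAt_log_const_mul (by simp) (hdown t ht)).scomp t (hasDerivAt_stolzCurve θ t))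
    (ContinuousOn.intervalIntegrable (by rw [uIcc_of_le (by linarith)]; exact hcont.mono hsub2))
  have hpos : 0 < (θ - 1) / (θ + 1) := div_pos (by linarith) (by linarith)
  rw [stolzIntegral, ← intervalIntegral.integral_add_adjacent_intervals (b := 0)
    (ContinuousOn.intervalIntegrable (by rw [uIcc_of_le (by linarith)]; exact hcont.mono hsub1))
    (ContinuousOn.intervalIntegrable (by rw [uIcc_of_le (by linarith)]; exact hcont.mono hsub2)),
    e1, e2, stolzCurve_halfAngle hθ, stolzCurve_neg_halfAngle hθ, stolzCurve_zero θ hθ]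
  have l1 : -Complex.I * -(((θ - 1) / (θ + 1) : ℝ) : ℂ) = ((θ - 1) / (θ + 1) : ℝ) * Complex.I := by
    ring
  have l2 : Complex.I * -(((θ - 1) / (θ + 1) : ℝ) : ℂ) = ((θ - 1) / (θ + 1) : ℝ) * -Complex.I := by
    ring
  rw [l1, l2, Complex.log_ofReal_mul hpos Complex.I_ne_zero,
    Complex.log_ofReal_mul hpos (neg_ne_zero.2 Complex.I_ne_zero), mul_one, mul_one,
    Complex.log_I, Complex.log_neg_I]
  ring

theorem sub_ne_zero_of_mem_stolz {θ : ℝ} (hθ : 1 < θ) {z w : ℂ} (hz : z ∈ stolz θ)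
    (hw : w ∈ stolzArc θ) : w - z ≠ 0 := by
  intro h
  rw [sub_eq_zero] at h
  exact notMem_of_mem_stolzArc hθ hw (h ▸ hz)

/-- The winding number does not change when the pole moves from `0` to `z`: the difference of the
two kernels has the primitive `log (1 - z/w)`. This is well defined along the contour since `1 - z/w
≤ 0` would place `w` on the segment from `0` to `z`, inside the domain. -/
theorem stolzIntegral_inv_sub {θ : ℝ} (hθ : 1 < θ) {z : ℂ} (hz : z ∈ stolz θ) :
    stolzIntegral θ (fun w : ℂ => (w - z)⁻¹) = 2 * Real.pi * Complex.I := by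
  have hθ0 : 0 < θ := by linarith
  have hslit : ∀ w : ℂ, w ≠ 0 → ‖1 - w‖ + θ * ‖w‖ = θ → 1 - z / w ∈ Complex.slitPlane := by
    intro w hw0 hw
    rw [Complex.mem_slitPlane_iff_not_le_zero]
    intro hle
    obtain ⟨r, hr, hr'⟩ : ∃ r : ℝ, 0 ≤ r ∧ 1 - z / w = -(r : ℂ) := by
      refine ⟨-(1 - z / w).re, by simpa using (Complex.le_def.1 hle).1, ?_⟩
      apply Complex.ext
      · simp
      · simpa using (Complex.le_def.1 hle).2
    have hzw : z = (1 + r : ℂ) * w := by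
      field_simp at hr'
      linear_combination -hr'
    have h1 : w = ((1 + r)⁻¹ : ℝ) • z := by
      have : (1 + r : ℂ) ≠ 0 := by
        have : (0 : ℝ) < 1 + r := by linarith
        exact_mod_cast this.ne'
      rw [hzw, Complex.real_smul]
      push_cast
      field_simp
    have h2 : w ∈ stolz θ := by
      rw [h1]
      exact (convex_stolz hθ0).smul_mem_of_zero_mem (zero_mem_stolz hθ) hz
        ⟨by positivity, inv_le_one_of_one_le₀ (by linarith)⟩
    rw [mem_stolz_iff hθ0] at h2
    linarith
  have hne : ∀ w ∈ stolzArc θ, w ≠ 0 := by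
    rintro _ ⟨t, ht, rfl⟩
    exact stolzCurve_ne_zero hθ (Ioo_subset_Icc_self ht)
  have hcl : ∀ w ∈ stolzCurve θ '' Icc (-halfAngle θ) (halfAngle θ),
      w ≠ 0 ∧ 1 - z / w ∈ Complex.slitPlane := by
    rintro _ ⟨t, ht, rfl⟩
    exact ⟨stolzCurve_ne_zero hθ ht,
      hslit _ (stolzCurve_ne_zero hθ ht) (stolzCurve_closed_boundary hθ ht)⟩
  have hsub : ∀ w ∈ stolzCurve θ '' Icc (-halfAngle θ) (halfAngle θ), w - z ≠ 0 := by
    intro w hw h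
    have := (hcl w hw).2
    rw [sub_eq_zero] at h
    rw [← h, div_self (hcl w hw).1, sub_self] at this
    exact Complex.slitPlane_ne_zero this rfl
  have harc : stolzArc θ ⊆ stolzCurve θ '' Icc (-halfAngle θ) (halfAngle θ) :=
    image_mono Ioo_subset_Icc_self
  have hcpt : IsCompact (stolzCurve θ '' Icc (-halfAngle θ) (halfAngle θ)) :=
    isCompact_Icc.image (continuous_stolzCurve θ)
  have hint : ∀ F : ℂ → ℂ, ContinuousOn F (stolzCurve θ '' Icc (-halfAngle θ) (halfAngle θ)) →
      StolzIntegrable θ F := by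
    intro F hF
    obtain ⟨M, hM⟩ := hcpt.exists_bound_of_continuousOn hF
    exact .of_bounded hθ (hF.mono harc) fun w hw => hM w (harc hw)
  have i1 : StolzIntegrable θ (fun w : ℂ => (w - z)⁻¹) :=
    hint _ ((continuousOn_id.sub continuousOn_const).inv₀ hsub)
  have i2 : StolzIntegrable θ (fun w : ℂ => w⁻¹) :=
    hint _ (continuousOn_id.inv₀ fun w hw => (hcl w hw).1)
  have hzero : stolzIntegral θ (fun w : ℂ => (w - z)⁻¹ - w⁻¹) = 0 := by
    refine stolzIntegral_eq_zero_of_primitive (G := fun w => Complex.log (1 - z / w)) hθ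
      (fun w hw => ?_) ?_ (i1.sub i2)
    · obtain ⟨h1, h2⟩ := hcl w (harc hw)
      have h3 := hsub w (harc hw)
      have hd : HasDerivAt (fun w : ℂ => 1 - z / w) (z / w ^ 2) w := by
        have := ((hasDerivAt_inv h1).const_mul z).const_sub 1
        have e : -(z * -(w ^ 2)⁻¹) = z / w ^ 2 := by
          rw [div_eq_mul_inv]; ring
        rw [← e]
        simpa only [div_eq_mul_inv] using this
      have e : (w - z)⁻¹ - w⁻¹ = z / w ^ 2 / (1 - z / w) := by
        have h4 : 1 - z / w = (w - z) / w := by field_simp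
        rw [h4]
        field_simp
        ring
      rw [e]
      exact hd.clog h2
    · exact (continuousOn_const.sub (continuousOn_const.div continuousOn_id
        fun w hw => (hcl w hw).1)).clog fun w hw => (hcl w hw).2
  rw [stolzIntegral_sub i1 i2, stolzIntegral_inv hθ, sub_eq_zero] at hzero
  exact hzero

/-- **Cauchy's integral formula** for bounded holomorphic functions on a larger Stolz domain. -/
theorem stolzIntegral_div_sub {θ μ : ℝ} (hθ : 1 < θ) (hμ : θ < μ) {F : ℂ → ℂ}
    (hF : DifferentiableOn ℂ F (stolz μ)) {M : ℝ} (hM : ∀ z ∈ stolz μ, ‖F z‖ ≤ M) {z : ℂ}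
    (hz : z ∈ stolz θ) :
    stolzIntegral θ (fun w => F w / (w - z)) = 2 * Real.pi * Complex.I * F z := by
  have hμ0 : 0 < μ := by linarith
  have hz' : z ∈ stolz μ := stolz_mono hμ.le hz
  have hnhds : stolz μ ∈ 𝓝 z := (isOpen_stolz hμ0).mem_nhds hz'
  have hd : DifferentiableOn ℂ (dslope F z) (stolz μ) := (Complex.differentiableOn_dslope hnhds).2 hF
  obtain ⟨r, hr, hrs⟩ := Metric.nhds_basis_closedBall.mem_iff.1 hnhds
  obtain ⟨M', hM'⟩ := (isCompact_closedBall z r).exists_bound_of_continuousOn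
    (hd.continuousOn.mono hrs)
  have hM0 : 0 ≤ M := (norm_nonneg _).trans (hM z hz')
  -- Close to `z` the slope is bounded by compactness, and at distance at least `r` by `2M/r`.
  have hb : ∀ w ∈ stolz μ, ‖dslope F z w‖ ≤ max M' ((M + M) / r) := by
    intro w hw
    by_cases hwr : w ∈ Metric.closedBall z r
    · exact (hM' w hwr).trans (le_max_left _ _)
    · refine le_trans ?_ (le_max_right _ _)
      rw [Metric.mem_closedBall, not_le, dist_eq_norm] at hwr
      have hne : w ≠ z := by
        rintro rfl
        simp at hwr
        linarith
      rw [dslope_of_ne _ hne, slope_def_field, norm_div]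
      exact div_le_div₀ (by linarith) ((norm_sub_le _ _).trans (add_le_add (hM w hw) (hM z hz')))
        hr hwr.le
  have h0 := stolzIntegral_eq_zero hθ hμ hd hb
  have hiF : StolzIntegrable θ (dslope F z) :=
    .of_bounded hθ (hd.continuousOn.mono (stolzArc_subset hθ hμ))
      fun w hw => hb w (stolzArc_subset hθ hμ hw)
  -- A non-integrable function has interval integral `0` by convention, while this integral is
  -- `2πi`; integrability follows.
  have hiz : StolzIntegrable θ (fun w => (w - z)⁻¹) := by
    have h1 : (2 * Real.pi * Complex.I : ℂ) ≠ 0 := by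
      simp [Real.pi_ne_zero]
    by_contra hcon
    apply h1
    rw [← stolzIntegral_inv_sub hθ hz, stolzIntegral]
    exact intervalIntegral.integral_undef hcon
  have hEq : EqOn (fun w => F w / (w - z)) (fun w => dslope F z w + (w - z)⁻¹ • F z)
      (stolzArc θ) := by
    intro w hw
    have h3 := sub_ne_zero_of_mem_stolz hθ hz hw
    simp only [smul_eq_mul]
    rw [dslope_of_ne _ (sub_ne_zero.1 h3), slope_def_field]
    field_simp
    ring
  rw [stolzIntegral_congr hθ hEq, stolzIntegral_add hiF (hiz.smul_const _), h0,
    stolzIntegral_smul_const, stolzIntegral_inv_sub hθ hz]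
  simp

/-- Cauchy's theorem with a pole outside the contour. -/
theorem stolzIntegral_div_sub_eq_zero {θ θ' μ : ℝ} (hθ : 1 < θ) (hθ' : θ < θ') (hμ : θ < μ)
    {F : ℂ → ℂ} (hF : DifferentiableOn ℂ F (stolz μ)) {M : ℝ} (hM : ∀ z ∈ stolz μ, ‖F z‖ ≤ M)
    {w : ℂ} (hw1 : w ≠ 1) (hw : w ∉ stolz θ') :
    stolzIntegral θ (fun z => F z / (w - z)) = 0 := by
  obtain ⟨η, hη, hη'⟩ := exists_between (lt_min hθ' hμ)
  have hη1 : η < θ' := hη'.trans_le (min_le_left _ _)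
  have hη2 : η < μ := hη'.trans_le (min_le_right _ _)
  have hη0 : 0 < η := by linarith
  have hsub := stolz_mono hη2.le
  rw [mem_stolz_iff (by linarith), not_lt] at hw
  have hpos : 0 < ‖1 - w‖ := norm_pos_iff.2 (sub_ne_zero.2 hw1.symm)
  have hδ : 0 < (θ' - η) * ‖1 - w‖ / (θ' * (1 + η)) := by
    have : 0 < θ' - η := by linarith
    have : 0 < θ' := by linarith
    positivity
  have hdist : ∀ z ∈ stolz η, (θ' - η) * ‖1 - w‖ / (θ' * (1 + η)) ≤ ‖w - z‖ := by
    intro z hz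
    rw [div_le_iff₀ (by have : 0 < θ' := by linarith
                        positivity)]
    have := separation_stolz hη0 hη1 ((mem_stolz_iff hη0).1 hz).le hw
    linarith
  have hM0 : 0 ≤ M := (norm_nonneg _).trans (hM 0 (zero_mem_stolz (by linarith)))
  refine stolzIntegral_eq_zero (M := M / ((θ' - η) * ‖1 - w‖ / (θ' * (1 + η)))) hθ hη ?_ ?_
  · refine (hF.mono hsub).div (differentiableOn_id.const_sub w) fun z hz h => ?_
    have := hdist z hz
    rw [h, norm_zero] at this
    linarith
  · intro z hz
    rw [norm_div]
    exact div_le_div₀ hM0 (hM z (hsub hz)) hδ (hdist z hz)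

/-! ### Dilations of the contour -/

section Scaling

variable {E : Type*} [NormedAddCommGroup E] [NormedSpace ℂ E]

theorem isCompact_stolzCurve (θ : ℝ) :
    IsCompact (stolzCurve θ '' Icc (-halfAngle θ) (halfAngle θ)) :=
  isCompact_Icc.image (continuous_stolzCurve θ)

theorem stolzArc_subset_image (θ : ℝ) :
    stolzArc θ ⊆ stolzCurve θ '' Icc (-halfAngle θ) (halfAngle θ) :=
  image_mono Ioo_subset_Icc_self

theorem StolzIntegrable.of_continuousOn {θ : ℝ} (hθ : 1 < θ) {F : ℂ → E}
    (hF : ContinuousOn F (stolzCurve θ '' Icc (-halfAngle θ) (halfAngle θ))) :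
    StolzIntegrable θ F := by
  obtain ⟨M, hM⟩ := (isCompact_stolzCurve θ).exists_bound_of_continuousOn hF
  exact .of_bounded hθ (hF.mono (stolzArc_subset_image θ)) fun w hw => hM w (stolzArc_subset_image θ hw)

/-- Invariance of a contour integral under dilations of the contour. -/
theorem stolzIntegral_scale [CompleteSpace E] {θ : ℝ} (hθ : 1 < θ) {F : ℂ → E} {U : Set ℂ}
    (hU : IsOpen U) (hF : DifferentiableOn ℂ F U)
    (hsub : ∀ s : ℝ, 1 < s → ∀ w ∈ stolzCurve θ '' Icc (-halfAngle θ) (halfAngle θ),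
      (s : ℂ) * w ∈ U) {s s' : ℝ} (hs : 1 < s) (hs' : 1 < s') :
    stolzIntegral θ (fun w => (s : ℂ) • F (s * w)) =
      stolzIntegral θ (fun w => (s' : ℂ) • F (s' * w)) := by
  set K := stolzCurve θ '' Icc (-halfAngle θ) (halfAngle θ) with hK
  -- The function `H (s w)` is at once the `s`-derivative of `s F(s w)` and the `w`-derivative of `w
  -- F(s w)`. The second description makes its contour integral vanish, so the first shows that the
  -- dilated integral is constant in `s`.
  set H : ℂ → E := fun z => F z + z • deriv F z with hH
  have hF' : DifferentiableOn ℂ (deriv F) U := hF.deriv hU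
  have hHc : ContinuousOn H U := hF.continuousOn.add (continuousOn_id.smul hF'.continuousOn)
  have hd : ∀ z ∈ U, HasDerivAt F (deriv F z) z := fun z hz =>
    (hF.differentiableAt (hU.mem_nhds hz)).hasDerivAt
  have hmaps : ∀ s : ℝ, 1 < s → MapsTo (fun w : ℂ => (s : ℂ) * w) K U := hsub
  have hzero : ∀ s : ℝ, 1 < s → stolzIntegral θ (fun w => H (s * w)) = 0 := by
    intro s hs
    refine stolzIntegral_eq_zero_of_primitive (G := fun w => w • F (s * w)) hθ (fun w hw => ?_) ?_ ?_
    · have hw' := hsub s hs w (stolzArc_subset_image θ hw)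
      have h1 : HasDerivAt (fun w : ℂ => F (s * w)) ((s : ℂ) • deriv F (s * w)) w := by
        have := (hd _ hw').scomp w ((hasDerivAt_id w).const_mul (s : ℂ))
        simpa using! this
      have := (hasDerivAt_id w).smul h1
      convert! this using 1
      simp only [hH, id, smul_smul, one_smul]
      rw [add_comm, mul_comm]
    · exact continuousOn_id.smul (hF.continuousOn.comp (by fun_prop) (hmaps s hs))
    · exact .of_continuousOn hθ (hHc.comp (by fun_prop) (hmaps s hs))
  have hderiv : ∀ s : ℝ, 1 < s →
      HasDerivAt (fun s : ℝ => stolzIntegral θ (fun w => (s : ℂ) • F (s * w))) 0 s := by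
    intro s₀ hs₀
    obtain ⟨a, ha, ha'⟩ := exists_between hs₀
    have hL : IsCompact ((fun p : ℝ × ℂ => (p.1 : ℂ) * p.2) '' (Icc a (s₀ + 1) ×ˢ K)) :=
      (isCompact_Icc.prod (isCompact_stolzCurve θ)).image (by fun_prop)
    have hLU : (fun p : ℝ × ℂ => (p.1 : ℂ) * p.2) '' (Icc a (s₀ + 1) ×ˢ K) ⊆ U := by
      rintro _ ⟨⟨s, w⟩, ⟨h1, h2⟩, rfl⟩
      exact hsub s (ha.trans_le h1.1) w h2
    obtain ⟨M, hM⟩ := hL.exists_bound_of_continuousOn (hHc.mono hLU)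
    obtain ⟨D, hD0, hD⟩ := exists_bound_deriv_stolzCurve θ
    have hcs : ∀ s : ℝ, 1 < s → ContinuousOn (fun t => deriv (stolzCurve θ) t •
        ((s : ℂ) • F (s * stolzCurve θ t))) (Icc (-halfAngle θ) (halfAngle θ)) := by
      intro s hs
      refine (continuous_deriv_stolzCurve θ).continuousOn.smul (continuousOn_const.smul ?_)
      exact hF.continuousOn.comp ((continuous_const.mul (continuous_stolzCurve θ)).continuousOn)
        fun t ht => hsub s hs _ (mem_image_of_mem _ ht)
    have hcs' : ∀ s : ℝ, 1 < s → ContinuousOn (fun t => deriv (stolzCurve θ) t •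
        H (s * stolzCurve θ t)) (Icc (-halfAngle θ) (halfAngle θ)) := by
      intro s hs
      refine (continuous_deriv_stolzCurve θ).continuousOn.smul ?_
      exact hHc.comp ((continuous_const.mul (continuous_stolzCurve θ)).continuousOn)
        fun t ht => hsub s hs _ (mem_image_of_mem _ ht)
    have hIoc : uIoc (-halfAngle θ) (halfAngle θ) = Ioc (-halfAngle θ) (halfAngle θ) :=
      uIoc_of_le (neg_halfAngle_lt hθ).le
    have huIcc : uIcc (-halfAngle θ) (halfAngle θ) = Icc (-halfAngle θ) (halfAngle θ) :=
      uIcc_of_le (neg_halfAngle_lt hθ).le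
    have key := intervalIntegral.hasDerivAt_integral_of_dominated_loc_of_deriv_le
      (F := fun (s : ℝ) t => deriv (stolzCurve θ) t • ((s : ℂ) • F (s * stolzCurve θ t)))
      (F' := fun (s : ℝ) t => deriv (stolzCurve θ) t • H (s * stolzCurve θ t))
      (a := -halfAngle θ) (b := halfAngle θ) (μ := volume) (bound := fun _ => D * M)
      (x₀ := s₀) (s := Ioo a (s₀ + 1)) (Ioo_mem_nhds ha' (by linarith)) ?_ ?_ ?_ ?_ ?_ ?_
    · have h2 := key.2
      have h3 := hzero s₀ hs₀
      rw [stolzIntegral] at h3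
      rw [h3] at h2
      exact h2
    · filter_upwards [Ioi_mem_nhds hs₀] with s hs
      rw [hIoc]
      exact ((hcs s hs).mono Ioc_subset_Icc_self).aestronglyMeasurable measurableSet_Ioc
    · exact ContinuousOn.intervalIntegrable (by rw [huIcc]; exact hcs s₀ hs₀)
    · rw [hIoc]
      exact ((hcs' s₀ hs₀).mono Ioc_subset_Icc_self).aestronglyMeasurable measurableSet_Ioc
    · refine .of_forall fun t ht s hs => ?_
      rw [hIoc] at ht
      rw [norm_smul]
      refine mul_le_mul (hD t (Ioc_subset_Icc_self ht)) (hM _ ?_) (norm_nonneg _) hD0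
      exact ⟨(s, stolzCurve θ t), ⟨Ioo_subset_Icc_self hs,
        mem_image_of_mem _ (Ioc_subset_Icc_self ht)⟩, rfl⟩
    · exact intervalIntegrable_const
    · refine .of_forall fun t ht s hs => ?_
      rw [hIoc] at ht
      have hU' := hsub s (ha.trans hs.1) _ (mem_image_of_mem _ (Ioc_subset_Icc_self ht))
      have h1 : HasDerivAt (fun s : ℝ => F (s * stolzCurve θ t))
          ((stolzCurve θ t) • deriv F (s * stolzCurve θ t)) s := by
        have h2 : HasDerivAt (fun s : ℝ => (s : ℂ) * stolzCurve θ t) (stolzCurve θ t) s := by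
          simpa using (Complex.ofRealCLM.hasDerivAt (x := s)).mul_const (stolzCurve θ t)
        exact (hd _ hU').scomp s h2
      have h3 := ((Complex.ofRealCLM.hasDerivAt (x := s)).smul h1).const_smul
        (deriv (stolzCurve θ) t)
      convert! h3 using 1
      simp only [hH, smul_smul, Complex.ofRealCLM_apply, Complex.ofReal_one, one_smul]
      rw [add_comm]
  refine isOpen_Ioi.is_const_of_deriv_eq_zero (s := Ioi (1 : ℝ)) (f := fun s : ℝ =>
    stolzIntegral θ (fun w => (s : ℂ) • F (s * w))) isPreconnected_Ioi
    (fun s hs => (hderiv s hs).differentiableAt.differentiableWithinAt)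
    (fun s hs => (hderiv s hs).deriv) hs hs'

end Scaling

section Resolvent

variable {X : Type*} [NormedAddCommGroup X] [NormedSpace ℂ X]

/-! ### The resolvent of a Ritt operator on the boundary of a Stolz domain -/

theorem IsRittOfType.mem_resolventSet {T : X →L[ℂ] X} {ω θ : ℝ} (hω : 1 < ω)
    (hT : IsRittOfType T ω) (hθ : ω < θ) {z : ℂ} (hz1 : z ≠ 1) (hz : z ∉ stolz θ) :
    z ∈ resolventSet ℂ T := by
  by_contra h
  exact hz (mem_stolz_of_le (by linarith) hθ hz1
    (norm_le_of_mem_closure_stolz (by linarith) (hT.2.1 h)))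

theorem IsRittOfType.exists_bound {T : X →L[ℂ] X} {ω θ : ℝ} (hT : IsRittOfType T ω) (hθ : ω < θ) :
    ∃ C : ℝ, 0 ≤ C ∧ ∀ z ∉ stolz θ, ‖(1 - z) • resolvent T z‖ ≤ C := by
  obtain ⟨C, hC⟩ := hT.2.2 θ hθ
  refine ⟨max C 0, le_max_right _ _, fun z hz => ?_⟩
  rw [← neg_sub, neg_smul, norm_neg]
  exact (hC z hz).trans (le_max_left _ _)

theorem sub_mul_resolvent {T : X →L[ℂ] X} {z : ℂ} (hz : z ∈ resolventSet ℂ T) :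
    z • resolvent T z - T * resolvent T z = 1 := by
  have := Ring.mul_inverse_cancel _ hz
  rw [sub_mul, Algebra.algebraMap_eq_smul_one, smul_mul_assoc, one_mul] at this
  exact this

theorem resolvent_mul_sub {T : X →L[ℂ] X} {z : ℂ} (hz : z ∈ resolventSet ℂ T) :
    z • resolvent T z - resolvent T z * T = 1 := by
  have := Ring.inverse_mul_cancel _ hz
  rw [mul_sub, Algebra.algebraMap_eq_smul_one, mul_smul_comm, mul_one] at this
  exact this

theorem mul_resolvent {T : X →L[ℂ] X} {z : ℂ} (hz : z ∈ resolventSet ℂ T) :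
    T * resolvent T z = z • resolvent T z - 1 := by
  rw [← sub_mul_resolvent hz]; abel

theorem one_sub_mul_resolvent {T : X →L[ℂ] X} {z : ℂ} (hz : z ∈ resolventSet ℂ T) :
    (1 - T) * resolvent T z = (1 - z) • resolvent T z + 1 := by
  rw [sub_mul, mul_resolvent hz, one_mul, sub_smul, one_smul]; abel

/-- The first resolvent identity. -/
theorem resolvent_mul_resolvent {T : X →L[ℂ] X} {z w : ℂ} (hz : z ∈ resolventSet ℂ T)
    (hw : w ∈ resolventSet ℂ T) :
    (w - z) • (resolvent T z * resolvent T w) = resolvent T z - resolvent T w := by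
  have h1 := sub_mul_resolvent hw
  have h2 := resolvent_mul_sub hz
  calc (w - z) • (resolvent T z * resolvent T w)
      = resolvent T z * (w • resolvent T w - T * resolvent T w)
        - (z • resolvent T z - resolvent T z * T) * resolvent T w := by
        rw [mul_sub, sub_mul, mul_smul_comm, smul_mul_assoc, sub_smul, mul_assoc]; abel
    _ = _ := by rw [h1, h2, mul_one, one_mul]

theorem IsRittOfType.stolzArc_subset {T : X →L[ℂ] X} {ω θ : ℝ} (hω : 1 < ω)
    (hT : IsRittOfType T ω) (hθ : ω < θ) : stolzArc θ ⊆ resolventSet ℂ T := fun _ hz =>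
  hT.mem_resolventSet hω hθ (ne_one_of_mem_stolzArc (hω.trans hθ) hz)
    (notMem_of_mem_stolzArc (hω.trans hθ) hz)

/-- Neumann expansion of the resolvent with two terms. -/
theorem resolvent_expansion {T : X →L[ℂ] X} {z : ℂ} (hz : z ∈ resolventSet ℂ T) (hz0 : z ≠ 0) :
    resolvent T z = z⁻¹ • 1 + (z ^ 2)⁻¹ • T + (z ^ 2)⁻¹ • (T * (T * resolvent T z)) := by
  have h1 := mul_resolvent hz
  have h2 : T * (T * resolvent T z) = z ^ 2 • resolvent T z - z • 1 - T := by
    rw [h1, mul_sub, mul_smul_comm, h1, smul_sub, smul_smul, mul_one, pow_two]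
  rw [h2, smul_sub, smul_sub, smul_smul, smul_smul, inv_mul_cancel₀ (pow_ne_zero 2 hz0), one_smul]
  have : (z ^ 2)⁻¹ * z = z⁻¹ := by field_simp
  rw [this]
  abel

theorem two_pi_I_ne_zero : (2 * Real.pi * Complex.I : ℂ) ≠ 0 := by
  simp [Real.pi_ne_zero]

theorem cauchyIntegral_eq (T : X →L[ℂ] X) (θ : ℝ) (φ : ℂ → ℂ) :
    cauchyIntegral T θ φ = (2 * Real.pi * Complex.I : ℂ)⁻¹ •
      stolzIntegral θ (fun z => φ z • resolvent T z) := by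
  unfold cauchyIntegral stolzIntegral halfAngle
  simp only [smul_smul, mul_comm]

theorem norm_le_of_closed_arc {θ : ℝ} (hθ : 1 < θ) {w : ℂ}
    (hw : w ∈ stolzCurve θ '' Icc (-halfAngle θ) (halfAngle θ)) : (θ - 1) / (θ + 1) ≤ ‖w‖ := by
  obtain ⟨t, ht, rfl⟩ := hw
  have h1 := stolzCurve_closed_boundary hθ ht
  have h2 : ‖1 - stolzCurve θ t‖ ≤ 1 + ‖stolzCurve θ t‖ := by
    simpa using norm_sub_le 1 (stolzCurve θ t)
  rw [div_le_iff₀ (by linarith)]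
  linarith

theorem notMem_stolz_of_scale {θ : ℝ} (hθ : 1 < θ) {s : ℝ} (hs : 1 ≤ s) {w : ℂ}
    (hw : w ∈ stolzCurve θ '' Icc (-halfAngle θ) (halfAngle θ)) : (s : ℂ) * w ∉ stolz θ := by
  intro h
  have hs0 : s ≠ 0 := by linarith
  have h1 : w = (s⁻¹ : ℝ) • ((s : ℂ) * w) := by
    rw [Complex.real_smul]
    push_cast
    have : (s : ℂ) ≠ 0 := by exact_mod_cast hs0
    field_simp
  have h2 : w ∈ stolz θ := by
    rw [h1]
    exact (convex_stolz (by linarith)).smul_mem_of_zero_mem (zero_mem_stolz hθ) h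
      ⟨by positivity, inv_le_one_of_one_le₀ hs⟩
  obtain ⟨t, ht, rfl⟩ := hw
  rw [mem_stolz_iff (by linarith), stolzCurve_closed_boundary hθ ht] at h2
  exact lt_irrefl _ h2

theorem scale_ne_one {θ : ℝ} (hθ : 1 < θ) {s : ℝ} (hs : 1 < s) {w : ℂ}
    (hw : w ∈ stolzCurve θ '' Icc (-halfAngle θ) (halfAngle θ)) : (s : ℂ) * w ≠ 1 := by
  intro h
  obtain ⟨t, ht, rfl⟩ := hw
  have hs0 : (s : ℂ) ≠ 0 := by exact_mod_cast (by linarith : s ≠ 0)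
  have h1 : stolzCurve θ t = ((s⁻¹ : ℝ) : ℂ) := by
    push_cast
    field_simp
    linear_combination h
  have h2 := stolzCurve_closed_boundary hθ ht
  have h3 : s⁻¹ < 1 := inv_lt_one_of_one_lt₀ hs
  have h4 : 0 < s⁻¹ := by positivity
  rw [h1, ← Complex.ofReal_one, ← Complex.ofReal_sub, Complex.norm_real, Complex.norm_real,
    Real.norm_of_nonneg h4.le, Real.norm_of_nonneg (by linarith)] at h2
  nlinarith

variable [CompleteSpace X]

theorem differentiableOn_resolvent (T : X →L[ℂ] X) :
    DifferentiableOn ℂ (resolvent T) (resolventSet ℂ T) := fun _ hz =>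
  (spectrum.hasDerivAt_resolvent_const_left hz).differentiableAt.differentiableWithinAt

theorem IsRittOfType.continuousOn_resolvent {T : X →L[ℂ] X} {ω θ : ℝ} (hω : 1 < ω)
    (hT : IsRittOfType T ω) (hθ : ω < θ) : ContinuousOn (resolvent T) (stolzArc θ) :=
  (differentiableOn_resolvent T).continuousOn.mono (hT.stolzArc_subset hω hθ)

/-- The contour meets the spectrum at most at the vertex, and dilating it by `s > 1` moves it into
the resolvent set without changing the integral. As `s → 1` dominated convergence recovers the
original integral; as `s → ∞` the expansion of the resolvent at infinity gives its value. -/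
theorem stolzIntegral_one_sub_smul_resolvent {T : X →L[ℂ] X} {ω θ : ℝ} (hω : 1 < ω)
    (hT : IsRittOfType T ω) (hθω : ω < θ) :
    stolzIntegral θ (fun z => (1 - z) • resolvent T z) =
      (2 * Real.pi * Complex.I : ℂ) • (1 - T) := by
  have hθ : 1 < θ := hω.trans hθω
  obtain ⟨C, hC0, hC⟩ := hT.exists_bound hθω
  set F : ℂ → X →L[ℂ] X := fun z => (1 - z) • resolvent T z with hF
  have hFd : DifferentiableOn ℂ F (resolventSet ℂ T) :=
    (differentiableOn_id.const_sub 1).smul (differentiableOn_resolvent T)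
  have hsub : ∀ s : ℝ, 1 < s → ∀ w ∈ stolzCurve θ '' Icc (-halfAngle θ) (halfAngle θ),
      (s : ℂ) * w ∈ resolventSet ℂ T := fun s hs w hw =>
    hT.mem_resolventSet hω hθω (scale_ne_one hθ hs hw) (notMem_stolz_of_scale hθ hs.le hw)
  set J : ℝ → X →L[ℂ] X := fun s => stolzIntegral θ (fun w => (s : ℂ) • F (s * w)) with hJ
  have hconst : ∀ s : ℝ, 1 < s → J s = J 2 := fun s hs =>
    stolzIntegral_scale hθ (spectrum.isOpen_resolventSet T) hFd hsub hs (by norm_num)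
  have hleft : Tendsto J (𝓝[>] 1) (𝓝 (stolzIntegral θ F)) := by
    obtain ⟨D, hD0, hD⟩ := exists_bound_deriv_stolzCurve θ
    have hIoc : uIoc (-halfAngle θ) (halfAngle θ) = Ioc (-halfAngle θ) (halfAngle θ) :=
      uIoc_of_le (neg_halfAngle_lt hθ).le
    refine intervalIntegral.tendsto_integral_filter_of_dominated_convergence
      (fun _ => D * (2 * C)) ?_ ?_ intervalIntegrable_const ?_
    · filter_upwards [self_mem_nhdsWithin] with s hs
      rw [hIoc]
      refine ContinuousOn.aestronglyMeasurable ?_ measurableSet_Ioc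
      have hFc : ContinuousOn (fun t => F (s * stolzCurve θ t))
          (Ioc (-halfAngle θ) (halfAngle θ)) :=
        hFd.continuousOn.comp ((continuous_const.mul (continuous_stolzCurve θ)).continuousOn)
          fun t ht => hsub s hs _ (mem_image_of_mem _ (Ioc_subset_Icc_self ht))
      have hcd := (continuous_deriv_stolzCurve θ).continuousOn
        (s := Ioc (-halfAngle θ) (halfAngle θ))
      have hcc : ContinuousOn (fun _ : ℝ => (s : ℂ)) (Ioc (-halfAngle θ) (halfAngle θ)) :=
        continuousOn_const
      exact hcd.smul (hcc.smul hFc)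
    · filter_upwards [self_mem_nhdsWithin, mem_nhdsWithin_of_mem_nhds
        (Iio_mem_nhds (show (1 : ℝ) < 2 by norm_num))] with s hs hs2
      refine .of_forall fun t ht => ?_
      rw [hIoc] at ht
      rw [norm_smul, norm_smul]
      have h1 : ‖(s : ℂ)‖ ≤ 2 := by
        rw [Complex.norm_real, Real.norm_of_nonneg (by linarith [mem_Ioi.1 hs])]
        exact (mem_Iio.1 hs2).le
      have h2 := hC _ (notMem_stolz_of_scale hθ (mem_Ioi.1 hs).le
        (mem_image_of_mem _ (Ioc_subset_Icc_self ht)))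
      gcongr
      · exact hD t (Ioc_subset_Icc_self ht)
    · have hae : ∀ᵐ t : ℝ, t ≠ halfAngle θ := by
        simp [ae_iff, measure_singleton]
      filter_upwards [hae] with t ht' ht
      rw [hIoc] at ht
      have hmem : stolzCurve θ t ∈ resolventSet ℂ T :=
        hT.stolzArc_subset hω hθω (mem_image_of_mem _ ⟨ht.1, lt_of_le_of_ne ht.2 ht'⟩)
      have hc : ContinuousAt F (stolzCurve θ t) :=
        hFd.continuousOn.continuousAt ((spectrum.isOpen_resolventSet T).mem_nhds hmem)
      have h1 : Tendsto (fun s : ℝ => (s : ℂ) * stolzCurve θ t) (𝓝[>] 1) (𝓝 (stolzCurve θ t)) := by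
        have : Continuous (fun s : ℝ => (s : ℂ) * stolzCurve θ t) := by fun_prop
        have := this.tendsto 1
        simp only [Complex.ofReal_one, one_mul] at this
        exact this.mono_left nhdsWithin_le_nhds
      have h2 : Tendsto (fun s : ℝ => (s : ℂ)) (𝓝[>] 1) (𝓝 1) := by
        have := Complex.continuous_ofReal.tendsto 1
        rw [Complex.ofReal_one] at this
        exact this.mono_left nhdsWithin_le_nhds
      have h3 := (h2.smul (hc.tendsto.comp h1)).const_smul (deriv (stolzCurve θ) t)
      simpa using h3
  have hright : Tendsto J atTop (𝓝 ((2 * Real.pi * Complex.I : ℂ) • (1 - T))) := by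
    obtain ⟨D, hD0, hD⟩ := norm_stolzIntegral_le (E := X →L[ℂ] X) hθ
    set d := (θ - 1) / (θ + 1) with hd
    have hd0 : 0 < d := div_pos (by linarith) (by linarith)
    set M := (d ^ 2)⁻¹ * (‖T‖ * (‖T‖ * C)) with hM
    have hnorm : ∀ s : ℝ, 1 < s →
        ‖J s - (2 * Real.pi * Complex.I : ℂ) • (1 - T)‖ ≤ s⁻¹ * (D * M) := by
      intro s hs
      have hs0 : (s : ℂ) ≠ 0 := by exact_mod_cast (by linarith : s ≠ 0)
      have hw0 : ∀ w ∈ stolzCurve θ '' Icc (-halfAngle θ) (halfAngle θ), w ≠ 0 := by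
        intro w hw h
        have := norm_le_of_closed_arc hθ hw
        rw [h, norm_zero] at this
        linarith
      have hc0 : ContinuousOn (fun w : ℂ => F (s * w))
          (stolzCurve θ '' Icc (-halfAngle θ) (halfAngle θ)) :=
        hFd.continuousOn.comp (by fun_prop) (hsub s hs)
      have hcinv : ContinuousOn (fun w : ℂ => w⁻¹)
          (stolzCurve θ '' Icc (-halfAngle θ) (halfAngle θ)) := continuousOn_id.inv₀ hw0
      have hcinv2 : ContinuousOn (fun w : ℂ => (w ^ 2)⁻¹)
          (stolzCurve θ '' Icc (-halfAngle θ) (halfAngle θ)) :=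
        (continuousOn_id.pow 2).inv₀ fun w hw => pow_ne_zero 2 (hw0 w hw)
      -- This is `resolvent_expansion` multiplied by `s (1 - s w)`. Only the two terms in `w⁻¹` have
      -- a nonzero integral, and they yield `2πi (1 - T)`; the last term is `O(1/s)`.
      have hEq : EqOn (fun w => (s : ℂ) • F (s * w)) (fun w => ((w⁻¹ - (s : ℂ)) • (1 : X →L[ℂ] X) +
          ((s : ℂ)⁻¹ * (w ^ 2)⁻¹ - w⁻¹) • T) +
          (s : ℂ)⁻¹ • ((w ^ 2)⁻¹ • (T * (T * F (s * w))))) (stolzArc θ) := by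
        intro w hw
        have hw' := stolzArc_subset_image θ hw
        have hne := hw0 w hw'
        have hz := mul_ne_zero hs0 hne
        simp only [hF, mul_smul_comm]
        nth_rw 1 [resolvent_expansion (hsub s hs w hw') hz]
        simp only [smul_add, smul_smul]
        congr 1
        · congr 1 <;> congr 1 <;> field_simp
        · congr 1
          field_simp
      have i1 : StolzIntegrable θ (fun w : ℂ => w⁻¹ - (s : ℂ)) :=
        .of_continuousOn hθ (hcinv.sub continuousOn_const)
      have i2 : StolzIntegrable θ (fun w : ℂ => (s : ℂ)⁻¹ * (w ^ 2)⁻¹ - w⁻¹) :=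
        .of_continuousOn hθ ((continuousOn_const.mul hcinv2).sub hcinv)
      have i3 : StolzIntegrable θ (fun w : ℂ => (s : ℂ)⁻¹ • ((w ^ 2)⁻¹ • (T * (T * F (s * w))))) :=
by
        have hcT : ContinuousOn (fun _ : ℂ => T)
          (stolzCurve θ '' Icc (-halfAngle θ) (halfAngle θ)) := continuousOn_const
        have hcs : ContinuousOn (fun _ : ℂ => (s : ℂ)⁻¹)
          (stolzCurve θ '' Icc (-halfAngle θ) (halfAngle θ)) := continuousOn_const
        exact .of_continuousOn hθ (hcs.smul (hcinv2.smul (hcT.mul (hcT.mul hc0))))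
      have iinv : StolzIntegrable θ (fun w : ℂ => w⁻¹) := .of_continuousOn hθ hcinv
      have iinv2 : StolzIntegrable θ (fun w : ℂ => (s : ℂ)⁻¹ * (w ^ 2)⁻¹) :=
        .of_continuousOn hθ (continuousOn_const.mul hcinv2)
      have iconst : StolzIntegrable θ (fun _ : ℂ => (s : ℂ)) := .of_continuousOn hθ continuousOn_const
      have z1 : stolzIntegral θ (fun _ : ℂ => (s : ℂ)) = 0 :=
        stolzIntegral_eq_zero_of_primitive (G := fun w => (s : ℂ) * w) hθ
          (fun w _ => by simpa using (hasDerivAt_id w).const_mul (s : ℂ)) (by fun_prop) iconst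
      have z2 : stolzIntegral θ (fun w : ℂ => (s : ℂ)⁻¹ * (w ^ 2)⁻¹) = 0 :=
        stolzIntegral_eq_zero_of_primitive (G := fun w => -(s : ℂ)⁻¹ * w⁻¹) hθ
          (fun w hw => by
            have := (hasDerivAt_inv (hw0 w (stolzArc_subset_image θ hw))).const_mul (-(s : ℂ)⁻¹)
            convert! this using 1
            ring) (continuousOn_const.mul hcinv) iinv2
      have hJs : J s = (2 * Real.pi * Complex.I : ℂ) • (1 - T) +
          (s : ℂ)⁻¹ • stolzIntegral θ (fun w => (w ^ 2)⁻¹ • (T * (T * F (s * w)))) := by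
        rw [hJ]
        simp only
        rw [stolzIntegral_congr hθ hEq, stolzIntegral_add ((i1.smul_const _).add (i2.smul_const _)) i3,
          stolzIntegral_add (i1.smul_const _) (i2.smul_const _), stolzIntegral_smul_const,
          stolzIntegral_smul_const, stolzIntegral_sub iinv iconst, stolzIntegral_sub iinv2 iinv,
          stolzIntegral_inv hθ, z1, z2, stolzIntegral_const_smul]
        simp only [sub_zero, zero_sub, neg_smul, smul_sub]
        abel
      rw [hJs, add_sub_cancel_left, norm_smul, norm_inv, Complex.norm_real,
        Real.norm_of_nonneg (by linarith)]
      refine mul_le_mul_of_nonneg_left (hD _ M fun w hw => ?_) (by positivity)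
      have hw' := stolzArc_subset_image θ hw
      rw [norm_smul, norm_inv, norm_pow]
      have h1 := norm_le_of_closed_arc hθ hw'
      have h2 : ‖T * (T * F (s * w))‖ ≤ ‖T‖ * (‖T‖ * C) := by
        refine (norm_mul_le _ _).trans ?_
        gcongr
        refine (norm_mul_le _ _).trans ?_
        gcongr
        exact hC _ (notMem_stolz_of_scale hθ hs.le hw')
      rw [hM]
      gcongr
    have h0 : Tendsto (fun s : ℝ => s⁻¹ * (D * M)) atTop (𝓝 0) := by
      simpa using tendsto_inv_atTop_zero.mul_const (D * M)
    rw [tendsto_iff_norm_sub_tendsto_zero]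
    refine squeeze_zero' (.of_forall fun _ => norm_nonneg _) ?_ h0
    filter_upwards [eventually_gt_atTop 1] with s hs using hnorm s hs
  have e1 : stolzIntegral θ F = J 2 :=
    tendsto_nhds_unique hleft (tendsto_const_nhds.congr' (by
      filter_upwards [self_mem_nhdsWithin] with s hs using (hconst s hs).symm))
  have e2 : (2 * Real.pi * Complex.I : ℂ) • (1 - T) = J 2 :=
    tendsto_nhds_unique hright (tendsto_const_nhds.congr' (by
      filter_upwards [eventually_gt_atTop 1] with s hs using (hconst s hs).symm))
  rw [e1, e2]

end Resolvent

/-! ### Bounded holomorphic functions -/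

theorem IsHInfty.mul {ν : ℝ} {f g : ℂ → ℂ} (hf : IsHInfty ν f) (hg : IsHInfty ν g) :
    IsHInfty ν (fun z => f z * g z) := by
  obtain ⟨hf, M, hM⟩ := hf
  obtain ⟨hg, N, hN⟩ := hg
  refine ⟨hf.mul hg, M * N, fun z hz => ?_⟩
  rw [norm_mul]
  exact mul_le_mul (hM z hz) (hN z hz) (norm_nonneg _) ((norm_nonneg _).trans (hM z hz))

theorem isHInfty_one_sub (ν : ℝ) : IsHInfty ν (fun z => 1 - z) := by
  refine ⟨differentiableOn_id.const_sub 1, 2, fun z hz => ?_⟩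
  refine (norm_sub_le _ _).trans ?_
  have := norm_lt_one_of_mem_stolz hz
  rw [norm_one]
  linarith

theorem isHInfty_const (ν : ℝ) (c : ℂ) : IsHInfty ν (fun _ => c) :=
  ⟨differentiableOn_const c, ‖c‖, fun _ _ => le_rfl⟩

theorem isHInfty_polynomial (ν : ℝ) (p : Polynomial ℂ) : IsHInfty ν (fun z => p.eval z) := by
  obtain ⟨M, hM⟩ := (isCompact_closedBall (0 : ℂ) 1).exists_bound_of_continuousOn
    p.continuous.continuousOn
  exact ⟨p.differentiable.differentiableOn, M, fun z hz => hM z (by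
    simpa using (norm_lt_one_of_mem_stolz hz).le)⟩

section Integrability

variable {E : Type*} [NormedAddCommGroup E] [NormedSpace ℂ E]

theorem StolzIntegrable.smul_bounded {θ : ℝ} (hθ : 1 < θ) {φ : ℂ → ℂ} (hφ : StolzIntegrable θ φ)
    {G : ℂ → E} (hG : ContinuousOn G (stolzArc θ)) {M : ℝ} (hM : ∀ z ∈ stolzArc θ, ‖G z‖ ≤ M) :
    StolzIntegrable θ (fun z => φ z • G z) := by
  rw [StolzIntegrable, intervalIntegrable_iff_integrableOn_Ioo_of_le (neg_halfAngle_lt hθ).le] at *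
  have hm : AEStronglyMeasurable (fun t => G (stolzCurve θ t))
      (volume.restrict (Ioo (-halfAngle θ) (halfAngle θ))) :=
    (hG.comp (continuous_stolzCurve θ).continuousOn (mapsTo_image _ _)).aestronglyMeasurable
      measurableSet_Ioo
  have := Integrable.smul_bdd hφ M hm ((ae_restrict_iff' measurableSet_Ioo).2
    (.of_forall fun t ht => hM _ (mem_image_of_mem _ ht)))
  refine this.congr (.of_forall fun t => ?_)
  simp [smul_smul]

/-- Fubini's theorem for bounded integrands on a product of two contours. -/
theorem stolzIntegral_swap {θ θ' : ℝ} (hθ : 1 < θ) (hθ' : 1 < θ') {H : ℂ → ℂ → E}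
    (hH : ContinuousOn (Function.uncurry H) (stolzArc θ ×ˢ stolzArc θ')) {M : ℝ}
    (hM : ∀ z ∈ stolzArc θ, ∀ w ∈ stolzArc θ', ‖H z w‖ ≤ M) :
    stolzIntegral θ (fun z => stolzIntegral θ' (fun w => H z w)) =
      stolzIntegral θ' (fun w => stolzIntegral θ (fun z => H z w)) := by
  obtain ⟨D, hD0, hD⟩ := exists_bound_deriv_stolzCurve θ
  obtain ⟨D', hD0', hD'⟩ := exists_bound_deriv_stolzCurve θ'
  unfold stolzIntegral
  simp_rw [← intervalIntegral.integral_smul]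
  rw [intervalIntegral_intervalIntegral_swap]
  · refine intervalIntegral.integral_congr fun t _ => ?_
    refine intervalIntegral.integral_congr fun s _ => ?_
    exact smul_comm _ _ _
  · have hS : (uIoc (-halfAngle θ) (halfAngle θ) ×ˢ uIoc (-halfAngle θ') (halfAngle θ') : Set (ℝ × ℝ))
        =ᵐ[volume] Ioo (-halfAngle θ) (halfAngle θ) ×ˢ Ioo (-halfAngle θ') (halfAngle θ') := by
      rw [uIoc_of_le (neg_halfAngle_lt hθ).le, uIoc_of_le (neg_halfAngle_lt hθ').le]
      exact Measure.set_prod_ae_eq Ioo_ae_eq_Ioc.symm Ioo_ae_eq_Ioc.symm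
    refine IntegrableOn.congr_set_ae ?_ hS
    have hmeas : MeasurableSet
        (Ioo (-halfAngle θ) (halfAngle θ) ×ˢ Ioo (-halfAngle θ') (halfAngle θ')) :=
      measurableSet_Ioo.prod measurableSet_Ioo
    have : IsFiniteMeasure ((volume : Measure (ℝ × ℝ)).restrict
        (Ioo (-halfAngle θ) (halfAngle θ) ×ˢ Ioo (-halfAngle θ') (halfAngle θ'))) := by
      refine ⟨?_⟩
      rw [Measure.restrict_apply_univ, Measure.volume_eq_prod, Measure.prod_prod]
      simp [ENNReal.mul_lt_top]
    refine Integrable.of_bound (C := D * (D' * M)) ?_ ?_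
    · refine ContinuousOn.aestronglyMeasurable ?_ hmeas
      have h1 : ContinuousOn (fun p : ℝ × ℝ => H (stolzCurve θ p.1) (stolzCurve θ' p.2))
          (Ioo (-halfAngle θ) (halfAngle θ) ×ˢ Ioo (-halfAngle θ') (halfAngle θ')) := by
        refine hH.comp (f := fun p : ℝ × ℝ => (stolzCurve θ p.1, stolzCurve θ' p.2)) ?_ ?_
        · exact (((continuous_stolzCurve θ).comp continuous_fst).prodMk
            ((continuous_stolzCurve θ').comp continuous_snd)).continuousOn
        · rintro ⟨s, t⟩ ⟨hs, ht⟩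
          exact ⟨mem_image_of_mem _ hs, mem_image_of_mem _ ht⟩
      exact ((continuous_deriv_stolzCurve θ).comp continuous_fst).continuousOn.smul
        (((continuous_deriv_stolzCurve θ').comp continuous_snd).continuousOn.smul h1)
    · refine (ae_restrict_iff' hmeas).2 (.of_forall ?_)
      rintro ⟨s, t⟩ ⟨hs, ht⟩
      simp only [Function.uncurry]
      rw [norm_smul, norm_smul]
      have e1 := hD s (Ioo_subset_Icc_self hs)
      have e2 := hD' t (Ioo_subset_Icc_self ht)
      have e3 := hM _ (mem_image_of_mem _ hs) _ (mem_image_of_mem _ ht)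
      gcongr

end Integrability

/-! ### The regularised calculus and its behaviour on fixed vectors -/

section Calculus

variable {X : Type*} [NormedAddCommGroup X] [NormedSpace ℂ X] [CompleteSpace X]
  {T : X →L[ℂ] X} {ω ν θ θ' : ℝ} {e f : ℂ → ℂ}

theorem IntegrableOnStolzBoundary.stolzIntegrable (h : IntegrableOnStolzBoundary θ e) :
    StolzIntegrable θ (fun z => e z / (1 - z)) := by
  refine IntervalIntegrable.congr (fun t _ => ?_) h
  simp [mul_comm]

theorem IsHInfty.stolzIntegrable (hθ : 1 < θ) (hν : θ < ν) (hf : IsHInfty ν f) :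
    StolzIntegrable θ f := by
  obtain ⟨hf, M, hM⟩ := hf
  exact .of_bounded hθ (hf.continuousOn.mono (RittCalculus.stolzArc_subset hθ hν)) fun z hz =>
    hM z (RittCalculus.stolzArc_subset hθ hν hz)

theorem IsHInfty.stolzIntegral_eq_zero (hθ : 1 < θ) (hν : θ < ν) (hf : IsHInfty ν f) :
    stolzIntegral θ f = 0 := by
  obtain ⟨hf, M, hM⟩ := hf
  exact RittCalculus.stolzIntegral_eq_zero hθ hν hf hM

theorem IsRittOfType.continuousOn_one_sub_smul_resolvent (hω : 1 < ω) (hT : IsRittOfType T ω)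
    (hθ : ω < θ) : ContinuousOn (fun z => (1 - z) • resolvent T z) (stolzArc θ) := by
  have h1 := hT.continuousOn_resolvent hω hθ
  have h2 : ContinuousOn (fun z : ℂ => 1 - z) (stolzArc θ) := by fun_prop
  exact h2.smul h1

theorem IsRittOfType.stolzIntegrable_smul_resolvent (hω : 1 < ω) (hT : IsRittOfType T ω)
    (hθ : ω < θ) (he : StolzIntegrable θ (fun z => e z / (1 - z))) :
    StolzIntegrable θ (fun z => e z • resolvent T z) := by
  have hθ1 := hω.trans hθ
  obtain ⟨C, hC0, hC⟩ := hT.exists_bound hθ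
  refine (he.smul_bounded hθ1 (hT.continuousOn_one_sub_smul_resolvent hω hθ)
    fun z hz => hC z (notMem_of_mem_stolzArc hθ1 hz)).congr hθ1 fun z hz => ?_
  have : 1 - z ≠ 0 := sub_ne_zero.2 (ne_one_of_mem_stolzArc hθ1 hz).symm
  beta_reduce
  rw [smul_smul, div_mul_cancel₀ _ this]

theorem stolzIntegrable_one_sub_mul_div (hθ : 1 < θ) (hν : θ < ν) (hf : IsHInfty ν f) :
    StolzIntegrable θ (fun z => (1 - z) * f z / (1 - z)) := by
  refine (hf.stolzIntegrable hθ hν).congr hθ fun z hz => ?_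
  have : 1 - z ≠ 0 := sub_ne_zero.2 (ne_one_of_mem_stolzArc hθ hz).symm
  rw [mul_div_cancel_left₀ _ this]

/-- The regularised calculus `f ↦ ((1 - z) f)(T)`, which is defined on all of `H^∞`. -/
noncomputable def regCalculus (T : X →L[ℂ] X) (θ : ℝ) (f : ℂ → ℂ) : X →L[ℂ] X :=
  cauchyIntegral T θ (fun z => (1 - z) * f z)

theorem IsRittOfType.stolzIntegrable_reg (hω : 1 < ω) (hT : IsRittOfType T ω) (hθ : ω < θ)
    (hν : θ < ν) (hf : IsHInfty ν f) :
    StolzIntegrable θ (fun z => ((1 - z) * f z) • resolvent T z) :=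
  hT.stolzIntegrable_smul_resolvent hω hθ (stolzIntegrable_one_sub_mul_div (hω.trans hθ) hν hf)

theorem IsRittOfType.regCalculus_one (hω : 1 < ω) (hT : IsRittOfType T ω) (hθ : ω < θ) :
    regCalculus T θ (fun _ => 1) = 1 - T := by
  rw [regCalculus, cauchyIntegral_eq]
  simp only [mul_one]
  rw [stolzIntegral_one_sub_smul_resolvent hω hT hθ, smul_smul,
    inv_mul_cancel₀ two_pi_I_ne_zero, one_smul]

/-- Since `(1-T) R(z,T) = (1-z) R(z,T) + 1`, multiplying by `1 - T` outside or by `1 - z` under the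
integral differs by `∫ e`, which is zero by Cauchy's theorem. -/
theorem IsRittOfType.one_sub_mul_cauchyIntegral (hω : 1 < ω) (hT : IsRittOfType T ω) (hθ : ω < θ)
    (hν : θ < ν) (he : IsHInfty ν e) (hi : StolzIntegrable θ (fun z => e z / (1 - z))) :
    (1 - T) * cauchyIntegral T θ e = regCalculus T θ e := by
  have hθ1 := hω.trans hθ
  have h1 := hT.stolzIntegrable_smul_resolvent hω hθ hi
  have h2 := stolzIntegral_clm (ContinuousLinearMap.mul ℂ (X →L[ℂ] X) (1 - T)) h1
  simp only [ContinuousLinearMap.mul_apply'] at h2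
  rw [regCalculus, cauchyIntegral_eq, cauchyIntegral_eq, mul_smul_comm, ← h2]
  congr 1
  have hEq : EqOn (fun z => (1 - T) * e z • resolvent T z)
      (fun z => ((1 - z) * e z) • resolvent T z + e z • (1 : X →L[ℂ] X)) (stolzArc θ) := by
    intro z hz
    simp only
    rw [mul_smul_comm, one_sub_mul_resolvent (hT.stolzArc_subset hω hθ hz), smul_add, smul_smul,
      mul_comm]
  rw [stolzIntegral_congr hθ1 hEq, stolzIntegral_add (hT.stolzIntegrable_reg hω hθ hν he)
    ((he.stolzIntegrable hθ1 hν).smul_const _), stolzIntegral_smul_const,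
    he.stolzIntegral_eq_zero hθ1 hν, zero_smul, add_zero]

/-- Elementary functions have mean zero against `(1 - z)⁻¹`. -/
theorem IsHInfty.stolzIntegral_div_one_sub (hθ : 1 < θ) (hν : θ < ν) (he : IsHInfty ν e)
    (hi : StolzIntegrable θ (fun z => e z / (1 - z))) :
    stolzIntegral θ (fun z => e z / (1 - z)) = 0 := by
  have hre : ∀ (δ : ℝ), 0 ≤ δ → ∀ z : ℂ, ‖z‖ < 1 → ‖1 - z‖ ≤ ‖1 + (δ : ℂ) - z‖ := by
    intro δ hδ z hz
    have h1 : z.re ≤ ‖z‖ := Complex.re_le_norm z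
    rw [← sq_le_sq₀ (norm_nonneg _) (norm_nonneg _), ← Complex.normSq_eq_norm_sq,
      ← Complex.normSq_eq_norm_sq, Complex.normSq_apply, Complex.normSq_apply]
    simp
    nlinarith
  have hδ : ∀ n : ℕ, 0 < 1 / ((n : ℝ) + 1) := fun n => by positivity
  -- The pole is moved from `1` to `1 + δ`, outside the disc, where Cauchy's theorem applies. By
  -- `hre` this only increases the modulus of the denominator, so the original integrand dominates
  -- as `δ → 0`.
  have hzero : ∀ n : ℕ, stolzIntegral θ (fun z => e z / (1 + ((1 / ((n : ℝ) + 1) : ℝ) : ℂ) - z)) = 0 := by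
    intro n
    refine IsHInfty.stolzIntegral_eq_zero hθ hν ?_
    obtain ⟨hd, M, hM⟩ := he
    have hlow : ∀ z : ℂ, ‖z‖ < 1 → 1 / ((n : ℝ) + 1) ≤ ‖1 + ((1 / ((n : ℝ) + 1) : ℝ) : ℂ) - z‖ := by
      intro z hz
      have h1 : z.re ≤ ‖z‖ := Complex.re_le_norm z
      refine le_trans ?_ (Complex.re_le_norm _)
      rw [Complex.sub_re, Complex.add_re, Complex.ofReal_re, Complex.one_re]
      linarith
    refine ⟨hd.div (by fun_prop) fun z hz h => ?_, M / (1 / ((n : ℝ) + 1)), fun z hz => ?_⟩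
    · have := hlow z (norm_lt_one_of_mem_stolz hz)
      rw [h, norm_zero] at this
      linarith [hδ n]
    · rw [norm_div]
      exact div_le_div₀ ((norm_nonneg _).trans (hM z hz)) (hM z hz) (hδ n)
        (hlow z (norm_lt_one_of_mem_stolz hz))
  have hIoc : uIoc (-halfAngle θ) (halfAngle θ) = Ioc (-halfAngle θ) (halfAngle θ) :=
    uIoc_of_le (neg_halfAngle_lt hθ).le
  have hlim : Tendsto (fun n : ℕ => stolzIntegral θ
      (fun z => e z / (1 + ((1 / ((n : ℝ) + 1) : ℝ) : ℂ) - z))) atTop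
      (𝓝 (stolzIntegral θ (fun z => e z / (1 - z)))) := by
    have hae : ∀ᵐ t : ℝ, t ≠ halfAngle θ := by
      simp [ae_iff, measure_singleton]
    refine intervalIntegral.tendsto_integral_filter_of_dominated_convergence
      (fun t => ‖deriv (stolzCurve θ) t • (e (stolzCurve θ t) / (1 - stolzCurve θ t))‖)
      ?_ ?_ hi.norm ?_
    · refine .of_forall fun n => ?_
      rw [hIoc, ← restrict_Ioo_eq_restrict_Ioc]
      refine ContinuousOn.aestronglyMeasurable ?_ measurableSet_Ioo
      have hec : ContinuousOn (fun t => e (stolzCurve θ t)) (Ioo (-halfAngle θ) (halfAngle θ)) :=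
        (he.1.continuousOn.mono (RittCalculus.stolzArc_subset hθ hν)).comp
          (continuous_stolzCurve θ).continuousOn (mapsTo_image _ _)
      refine (continuous_deriv_stolzCurve θ).continuousOn.smul (hec.div ?_ fun t ht h => ?_)
      · exact (continuous_const.sub (continuous_stolzCurve θ)).continuousOn
      · have h1 := norm_lt_one_of_mem_stolz (stolzCurve_mem hθ hν ht)
        have h2 := (norm_pos_iff.2 (sub_ne_zero.2 (stolzCurve_ne_one hθ ht).symm)).trans_le
          (hre _ (hδ n).le _ h1)
        rw [h, norm_zero] at h2
        exact lt_irrefl _ h2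
    · refine .of_forall fun n => ?_
      filter_upwards [hae] with t ht' ht
      rw [hIoc] at ht
      have ht2 : t ∈ Ioo (-halfAngle θ) (halfAngle θ) := ⟨ht.1, lt_of_le_of_ne ht.2 ht'⟩
      rw [norm_smul, norm_smul, norm_div, norm_div]
      refine mul_le_mul_of_nonneg_left ?_ (norm_nonneg _)
      refine div_le_div_of_nonneg_left (norm_nonneg _)
        (norm_pos_iff.2 (sub_ne_zero.2 (stolzCurve_ne_one hθ ht2).symm)) ?_
      exact hre _ (hδ n).le _ (norm_lt_one_of_mem_stolz (stolzCurve_mem hθ hν ht2))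
    · filter_upwards [hae] with t ht' ht
      rw [hIoc] at ht
      have ht2 : t ∈ Ioo (-halfAngle θ) (halfAngle θ) := ⟨ht.1, lt_of_le_of_ne ht.2 ht'⟩
      refine Tendsto.const_smul (Tendsto.div tendsto_const_nhds ?_
        (sub_ne_zero.2 (stolzCurve_ne_one hθ ht2).symm)) _
      have h0 : Tendsto (fun n : ℕ => ((1 / ((n : ℝ) + 1) : ℝ) : ℂ)) atTop (𝓝 ((0 : ℝ) : ℂ)) :=
        (Complex.continuous_ofReal.tendsto 0).comp tendsto_one_div_add_atTop_nhds_zero_nat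
      have h1 := (h0.const_add 1).sub_const (stolzCurve θ t)
      simpa using h1
  simp only [hzero] at hlim
  exact tendsto_nhds_unique hlim tendsto_const_nhds |>.symm ▸ rfl

/-- On a fixed vector the resolvent is `-(1-z)⁻¹`, so `e(T) x` is a multiple of `∫ e(z)/(1-z) dz =
0`. Every elementary operator kills the fixed vectors of `T`; hence a single injective regulariser
forces `1 - T` to be injective. -/
theorem IsRittOfType.cauchyIntegral_apply_eq_zero (hω : 1 < ω) (hT : IsRittOfType T ω) (hθ : ω < θ)
    (hν : θ < ν) (he : IsHInfty ν e) (hi : StolzIntegrable θ (fun z => e z / (1 - z))) {x : X}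
    (hx : (1 - T) x = 0) : cauchyIntegral T θ e x = 0 := by
  have hθ1 := hω.trans hθ
  have h1 := hT.stolzIntegrable_smul_resolvent hω hθ hi
  have h2 := stolzIntegral_clm (ContinuousLinearMap.apply ℂ X x) h1
  simp only [ContinuousLinearMap.apply_apply, smul_apply] at h2
  have hTx : T x = x := by
    have : x - T x = 0 := hx
    rw [sub_eq_zero] at this
    exact this.symm
  have hEq : EqOn (fun z => e z • resolvent T z x) (fun z => (e z / (1 - z)) • (-x))
      (stolzArc θ) := by
    intro z hz
    have hz1 : 1 - z ≠ 0 := sub_ne_zero.2 (ne_one_of_mem_stolzArc hθ1 hz).symm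
    have h3 := congrArg (fun A : X →L[ℂ] X => A x)
      (resolvent_mul_sub (hT.stolzArc_subset hω hθ hz))
    simp only [sub_apply, smul_apply,
      mul_apply_eq_comp, hTx, one_apply_eq_self] at h3
    have h4 : (1 - z) • resolvent T z x = -x := by
      calc (1 - z) • resolvent T z x = -(z • resolvent T z x - resolvent T z x) := by
            rw [sub_smul, one_smul]; abel
        _ = -x := by rw [h3]
    simp only
    rw [← h4, smul_smul, div_mul_cancel₀ _ hz1]
  rw [cauchyIntegral_eq, smul_apply, ← h2, stolzIntegral_congr hθ1 hEq,
    stolzIntegral_smul_const, he.stolzIntegral_div_one_sub hθ1 hν hi, zero_smul, smul_zero]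

end Calculus

/-! ### Multiplicativity, independence of the contour, comparison with the extended calculus -/

section Multiplicativity

variable {X : Type*} [NormedAddCommGroup X] [NormedSpace ℂ X] [CompleteSpace X]
  {T : X →L[ℂ] X} {ω ν θ θ' : ℝ} {e f : ℂ → ℂ}

/-- Comparison of the distance between two contours with the distance to the vertex. -/
theorem exists_norm_one_sub_le (hθ : 1 < θ) (hθ' : θ < θ') : ∃ c : ℝ, 0 ≤ c ∧
    ∀ z ∈ stolzArc θ, ∀ w ∈ stolzArc θ', ‖1 - w‖ ≤ c * ‖w - z‖ ∧ ‖1 - z‖ ≤ (c + 1) * ‖w - z‖ := by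
  have h1 : 0 < θ' - θ := by linarith
  have h2 : 0 < θ := by linarith
  have h3 : 0 < θ' := by linarith
  refine ⟨θ' * (1 + θ) / (θ' - θ), by positivity, fun z hz w hw => ?_⟩
  have h4 := separation_stolz h2 hθ' (norm_of_mem_stolzArc hθ hz).le
    (norm_of_mem_stolzArc (hθ.trans hθ') hw).ge
  have h5 : ‖1 - w‖ ≤ θ' * (1 + θ) / (θ' - θ) * ‖w - z‖ := by
    rw [div_mul_eq_mul_div, le_div_iff₀ h1]
    linarith
  refine ⟨h5, ?_⟩
  have h6 : ‖1 - z‖ ≤ ‖1 - w‖ + ‖w - z‖ := by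
    have : 1 - z = (1 - w) + (w - z) := by ring
    rw [this]; exact norm_add_le _ _
  linarith

theorem sub_ne_zero_of_mem_stolzArc (hθ : 1 < θ) (hθ' : θ < θ') {z w : ℂ} (hz : z ∈ stolzArc θ)
    (hw : w ∈ stolzArc θ') : w - z ≠ 0 :=
  sub_ne_zero_of_mem_stolz (hθ.trans hθ') (stolzArc_subset hθ hθ' hz) hw

theorem norm_div_le_of_le_mul {a b : ℂ} {c : ℝ} (hb : b ≠ 0) (h : ‖a‖ ≤ c * ‖b‖) : ‖a / b‖ ≤ c := by
  rwa [norm_div, div_le_iff₀ (norm_pos_iff.2 hb)]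

/-- The regularised calculus is multiplicative, up to the regulariser. -/
theorem IsRittOfType.regCalculus_mul_regCalculus (hω : 1 < ω) (hT : IsRittOfType T ω) (hθ : ω < θ)
    (hθ' : θ < θ') (hν : θ' < ν) (he : IsHInfty ν e) (hf : IsHInfty ν f) :
    regCalculus T θ e * regCalculus T θ' f = regCalculus T θ (fun z => (1 - z) * (e z * f z)) := by
  have hθ1 := hω.trans hθ
  have hθ1' := hθ1.trans hθ'
  have hω' := hθ.trans hθ'
  have hνθ := hθ'.trans hν
  obtain ⟨c, hc0, hc⟩ := exists_norm_one_sub_le hθ1 hθ'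
  obtain ⟨C, hC0, hC⟩ := hT.exists_bound hω'
  obtain ⟨hed, Me, hMe⟩ := id he
  obtain ⟨hfd, Mf, hMf⟩ := id hf
  have hsubθ := RittCalculus.stolzArc_subset hθ1 hνθ
  have hsubθ' := RittCalculus.stolzArc_subset hθ1' hν
  have hMe0 : 0 ≤ Me := (norm_nonneg _).trans (hMe 0 (zero_mem_stolz (hθ1'.trans hν)))
  have hMf0 : 0 ≤ Mf := (norm_nonneg _).trans (hMf 0 (zero_mem_stolz (hθ1'.trans hν)))
  have hR' := hT.continuousOn_resolvent hω hω'
  have hRR' := hT.continuousOn_one_sub_smul_resolvent hω hω'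
  set a : ℂ → ℂ := fun z => (1 - z) * e z with ha
  set b : ℂ → ℂ := fun w => (1 - w) * f w with hb
  have haH : IsHInfty ν a := (isHInfty_one_sub ν).mul he
  have hbH : IsHInfty ν b := (isHInfty_one_sub ν).mul hf
  have ia := hT.stolzIntegrable_reg hω hθ hνθ he
  have ib := hT.stolzIntegrable_reg hω hω' hν hf
  set A := stolzIntegral θ (fun z => a z • resolvent T z) with hA
  set B := stolzIntegral θ' (fun w => b w • resolvent T w) with hB
  set Q : ℂ → X →L[ℂ] X := fun z => stolzIntegral θ' (fun w => (b w / (w - z)) • resolvent T w)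
    with hQ
  have hbb : ∀ w ∈ stolzArc θ', ‖b w • resolvent T w‖ ≤ Mf * C := by
    intro w hw
    have : b w • resolvent T w = f w • ((1 - w) • resolvent T w) := by
      rw [smul_smul, mul_comm]
    rw [this, norm_smul]
    exact mul_le_mul (hMf w (hsubθ' hw)) (hC w (notMem_of_mem_stolzArc hθ1' hw)) (norm_nonneg _) hMf0
  have hbcR : ContinuousOn (fun w => b w • resolvent T w) (stolzArc θ') :=
    (hbH.1.continuousOn.mono hsubθ').smul hR'
  -- the inner integral, for a fixed point of the inner contour
  have hRB : ∀ z ∈ stolzArc θ, resolvent T z * B =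
      (2 * Real.pi * Complex.I * b z) • resolvent T z - Q z := by
    intro z hz
    have hzr := hT.stolzArc_subset hω hθ hz
    have hne : ∀ w ∈ stolzArc θ', w - z ≠ 0 := fun w hw =>
      sub_ne_zero_of_mem_stolzArc hθ1 hθ' hz hw
    have hcd : ContinuousOn (fun w : ℂ => b w / (w - z)) (stolzArc θ') :=
      (hbH.1.continuousOn.mono hsubθ').div (by fun_prop) hne
    have hpos : 0 < ‖1 - z‖ :=
      norm_pos_iff.2 (sub_ne_zero.2 (ne_one_of_mem_stolzArc hθ1 hz).symm)
    have i1 : StolzIntegrable θ' (fun w => b w / (w - z)) := by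
      refine .of_bounded (M := c * Mf) hθ1' hcd fun w hw => ?_
      refine norm_div_le_of_le_mul (hne w hw) ?_
      rw [hb, norm_mul]
      calc ‖1 - w‖ * ‖f w‖ ≤ (c * ‖w - z‖) * Mf :=
            mul_le_mul (hc z hz w hw).1 (hMf w (hsubθ' hw)) (norm_nonneg _) (by positivity)
        _ = _ := by ring
    have i2 : StolzIntegrable θ' (fun w => (b w / (w - z)) • resolvent T w) := by
      refine .of_bounded (M := (c + 1) / ‖1 - z‖ * (Mf * C)) hθ1' (hcd.smul hR') fun w hw => ?_
      have h1 : (b w / (w - z)) • resolvent T w = (w - z)⁻¹ • (b w • resolvent T w) := by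
        rw [smul_smul, div_eq_inv_mul]
      rw [h1, norm_smul]
      refine mul_le_mul ?_ (hbb w hw) (norm_nonneg _) (by positivity)
      rw [norm_inv, le_div_iff₀ hpos, inv_mul_le_iff₀ (norm_pos_iff.2 (hne w hw))]
      linarith [(hc z hz w hw).2]
    have h2 := stolzIntegral_clm (ContinuousLinearMap.mul ℂ (X →L[ℂ] X) (resolvent T z)) ib
    simp only [ContinuousLinearMap.mul_apply'] at h2
    have hEq : EqOn (fun w => resolvent T z * ((1 - w) * f w) • resolvent T w)
        (fun w => (b w / (w - z)) • resolvent T z - (b w / (w - z)) • resolvent T w)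
        (stolzArc θ') := by
      intro w hw
      simp only
      rw [← smul_sub, ← resolvent_mul_resolvent hzr (hT.stolzArc_subset hω hω' hw), smul_smul,
        div_mul_cancel₀ _ (hne w hw), mul_smul_comm]
    obtain ⟨Mb, hMb⟩ := hbH.2
    rw [hB, ← h2, stolzIntegral_congr hθ1' hEq, stolzIntegral_sub (i1.smul_const _) i2,
      stolzIntegral_smul_const, stolzIntegral_div_sub hθ1' hν hbH.1 hMb
        (RittCalculus.stolzArc_subset hθ1 hθ' hz)]
  -- After Fubini the inner integral runs over the smaller contour with its pole `w` on the larger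
  -- one, so Cauchy's theorem annihilates it. The factors `1-z` and `1-w` keep the double integrand
  -- bounded near the common vertex.
  have hswap : stolzIntegral θ (fun z => a z • Q z) = 0 := by
    have h1 : ∀ z, a z • Q z =
        stolzIntegral θ' (fun w => (a z / (w - z)) • (b w • resolvent T w)) := by
      intro z
      rw [hQ]
      simp only
      rw [← stolzIntegral_const_smul]
      congr 1
      ext1 w
      rw [smul_smul, smul_smul]
      congr 1
      ring
    simp_rw [h1]
    rw [stolzIntegral_swap (M := (c + 1) * Me * (Mf * C)) hθ1 hθ1']
    · rw [stolzIntegral_congr (G := fun _ => 0) hθ1']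
      · simp [stolzIntegral]
      · intro w hw
        simp only
        obtain ⟨Ma, hMa⟩ := haH.2
        rw [stolzIntegral_smul_const, stolzIntegral_div_sub_eq_zero hθ1 hθ' hνθ haH.1 hMa
          (ne_one_of_mem_stolzArc hθ1' hw) (notMem_of_mem_stolzArc hθ1' hw), zero_smul]
    · have h2 : ContinuousOn (fun p : ℂ × ℂ => a p.1 / (p.2 - p.1)) (stolzArc θ ×ˢ stolzArc θ') := by
        refine ContinuousOn.div ?_ (by fun_prop) fun p hp =>
          sub_ne_zero_of_mem_stolzArc hθ1 hθ' hp.1 hp.2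
        exact (haH.1.continuousOn.mono hsubθ).comp continuous_fst.continuousOn fun p hp => hp.1
      have h3 : ContinuousOn (fun p : ℂ × ℂ => b p.2 • resolvent T p.2) (stolzArc θ ×ˢ stolzArc θ') :=
        hbcR.comp continuous_snd.continuousOn fun p hp => hp.2
      exact h2.smul h3
    · intro z hz w hw
      rw [norm_smul]
      refine mul_le_mul ?_ (hbb w hw) (norm_nonneg _) (by positivity)
      refine norm_div_le_of_le_mul (sub_ne_zero_of_mem_stolzArc hθ1 hθ' hz hw) ?_
      rw [ha, norm_mul]
      calc ‖1 - z‖ * ‖e z‖ ≤ ((c + 1) * ‖w - z‖) * Me :=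
            mul_le_mul (hc z hz w hw).2 (hMe z (hsubθ hz)) (norm_nonneg _) (by positivity)
        _ = _ := by ring
  have hAB : A * B = (2 * Real.pi * Complex.I : ℂ) •
      stolzIntegral θ (fun z => (a z * b z) • resolvent T z) := by
    have h2 := stolzIntegral_clm ((ContinuousLinearMap.mul ℂ (X →L[ℂ] X)).flip B) ia
    simp only [ContinuousLinearMap.flip_apply, ContinuousLinearMap.mul_apply'] at h2
    have i3 : StolzIntegrable θ (fun z => (2 * Real.pi * Complex.I : ℂ) •
        ((a z * b z) • resolvent T z)) := by
      have := hT.stolzIntegrable_reg hω hθ hνθ ((he.mul hbH).mul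
        (isHInfty_const ν (2 * Real.pi * Complex.I)))
      refine this.congr hθ1 fun z _ => ?_
      simp only [smul_smul, ha]
      congr 1
      ring
    have i4 : StolzIntegrable θ (fun z => a z • Q z) := by
      have h5 : StolzIntegrable θ (fun z => (((1 - z) * e z) • resolvent T z) * B) := by
        have := IntervalIntegrable.mul_const ia B
        refine this.congr (fun t _ => ?_)
        simp only [smul_mul_assoc]
      refine (i3.sub h5).congr hθ1 fun z hz => ?_
      change (2 * Real.pi * Complex.I : ℂ) • ((a z * b z) • resolvent T z) -
        (a z • resolvent T z) * B = a z • Q z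
      have hab : 2 * Real.pi * Complex.I * (a z * b z) = a z * (2 * Real.pi * Complex.I * b z) := by
        ring
      rw [smul_mul_assoc, hRB z hz, smul_sub, smul_smul, smul_smul, hab, sub_sub_cancel]
    have hEq : EqOn (fun z => ((1 - z) * e z) • resolvent T z * B)
        (fun z => (2 * Real.pi * Complex.I : ℂ) • ((a z * b z) • resolvent T z) - a z • Q z)
        (stolzArc θ) := by
      intro z hz
      simp only
      rw [smul_mul_assoc, hRB z hz, smul_sub, smul_smul, smul_smul]
      congr 2
      simp only [ha]
      ring
    rw [hA, ← h2, stolzIntegral_congr hθ1 hEq, stolzIntegral_sub i3 i4, hswap, sub_zero,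
      stolzIntegral_const_smul]
  rw [regCalculus, regCalculus, regCalculus, cauchyIntegral_eq, cauchyIntegral_eq, cauchyIntegral_eq,
    smul_mul_smul_comm, hAB, smul_smul, mul_assoc, inv_mul_cancel₀ two_pi_I_ne_zero, mul_one]
  congr 2
  ext1 z
  congr 1
  simp only [ha, hb]
  ring

theorem IsHInfty.reg_integrable (hθ : 1 < θ) (hν : θ < ν) (hf : IsHInfty ν f) :
    StolzIntegrable θ (fun z => ((1 - z) * f z) / (1 - z)) :=
  stolzIntegrable_one_sub_mul_div hθ hν hf

theorem IsRittOfType.one_sub_mul_regCalculus (hω : 1 < ω) (hT : IsRittOfType T ω) (hθ : ω < θ)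
    (hν : θ < ν) (hf : IsHInfty ν f) :
    (1 - T) * regCalculus T θ f = regCalculus T θ (fun z => (1 - z) * f z) :=
  hT.one_sub_mul_cauchyIntegral hω hθ hν ((isHInfty_one_sub ν).mul hf)
    (hf.reg_integrable (hω.trans hθ) hν)

/-- The regularised calculus does not depend on the contour. -/
theorem IsRittOfType.regCalculus_eq (hω : 1 < ω) (hT : IsRittOfType T ω)
    (hinj : Function.Injective (1 - T : X →L[ℂ] X)) (hθ : ω < θ) (hν : θ < ν) (hθ' : ω < θ') (hν' : θ' < ν)
    (hf : IsHInfty ν f) : regCalculus T θ f = regCalculus T θ' f := by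
  wlog h : θ < θ' generalizing θ θ'
  · rcases (not_lt.1 h).eq_or_lt with h | h
    · rw [h]
    · exact (this hθ' hν' hθ hν h).symm
  have h1 := hT.regCalculus_mul_regCalculus hω hθ h hν' (isHInfty_const ν 1) hf
  rw [hT.regCalculus_one hω hθ] at h1
  simp only [one_mul] at h1
  rw [← hT.one_sub_mul_regCalculus hω hθ hν hf] at h1
  ext x
  exact hinj (congrArg (fun A : X →L[ℂ] X => A x) h1).symm

theorem IsRittOfType.regCalculus_mul (hω : 1 < ω) (hT : IsRittOfType T ω)
    (hinj : Function.Injective (1 - T : X →L[ℂ] X)) (hθ : ω < θ) (hν : θ < ν) (he : IsHInfty ν e)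
    (hf : IsHInfty ν f) :
    regCalculus T θ e * regCalculus T θ f = (1 - T) * regCalculus T θ (fun z => e z * f z) := by
  obtain ⟨η, hη, hη'⟩ := exists_between hν
  rw [hT.regCalculus_eq hω hinj hθ hν (hθ.trans hη) hη' hf,
    hT.regCalculus_mul_regCalculus hω hθ hη hη' he hf,
    hT.one_sub_mul_regCalculus hω hθ hν (he.mul hf)]

theorem IsRittOfType.regCalculus_commute (hω : 1 < ω) (hT : IsRittOfType T ω)
    (hinj : Function.Injective (1 - T : X →L[ℂ] X)) (hθ : ω < θ) (hν : θ < ν) (hf : IsHInfty ν f) :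
    regCalculus T θ f * (1 - T) = (1 - T) * regCalculus T θ f := by
  have h1 := hT.regCalculus_mul hω hinj hθ hν hf (isHInfty_const ν 1)
  simpa only [mul_one, hT.regCalculus_one hω hθ] using h1

theorem IsRittOfType.injective_one_sub (hω : 1 < ω) (hT : IsRittOfType T ω) {A : X →L[ℂ] X}
    (hA : ElementaryCalculus T ω ν e A) (hAinj : Function.Injective A) :
    Function.Injective (1 - T : X →L[ℂ] X) := by
  obtain ⟨he, θ, hθ, hν, hi, rfl⟩ := hA
  rw [injective_iff_map_eq_zero]
  intro x hx
  have := hT.cauchyIntegral_apply_eq_zero hω hθ hν he hi.stolzIntegrable hx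
  exact (injective_iff_map_eq_zero _).1 hAinj x this

/-- The extended calculus, expressed through the regularised one. -/
theorem IsRittOfType.one_sub_mul_of_extendedCalculus (hω : 1 < ω) (hT : IsRittOfType T ω)
    (hθ : ω < θ) (hν : θ < ν) (hf : IsHInfty ν f) {S : X →L[ℂ] X}
    (hS : ExtendedCalculus T ω ν f S) : (1 - T) * S = regCalculus T θ f := by
  obtain ⟨e, A, B, hA, hAinj, hB, hAS⟩ := hS
  have hinj := hT.injective_one_sub hω hA hAinj
  obtain ⟨he, θ₁, hθ₁, hν₁, hi₁, rfl⟩ := hA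
  obtain ⟨-, θ₂, hθ₂, hν₂, hi₂, rfl⟩ := hB
  have e1 : (1 - T) * cauchyIntegral T θ₁ e = regCalculus T θ e := by
    rw [hT.one_sub_mul_cauchyIntegral hω hθ₁ hν₁ he hi₁.stolzIntegrable]
    exact hT.regCalculus_eq hω hinj hθ₁ hν₁ hθ hν he
  have e2 : (1 - T) * cauchyIntegral T θ₂ (fun z => e z * f z) =
      regCalculus T θ (fun z => e z * f z) := by
    rw [hT.one_sub_mul_cauchyIntegral hω hθ₂ hν₂ (he.mul hf) hi₂.stolzIntegrable]
    exact hT.regCalculus_eq hω hinj hθ₂ hν₂ hθ hν (he.mul hf)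
  have e3 : cauchyIntegral T θ₁ e * S = cauchyIntegral T θ₂ (fun z => e z * f z) := hAS
  have hEinj : Function.Injective (regCalculus T θ e) := by
    rw [← e1]
    exact hinj.comp hAinj
  -- Both sides equal `(1-T)` times the regularised value of `e f`; the injective factor belonging
  -- to `e` is then cancelled.
  have e4 : regCalculus T θ e * ((1 - T) * S) = regCalculus T θ e * regCalculus T θ f := by
    rw [hT.regCalculus_mul hω hinj hθ hν he hf, ← e2, ← e3, ← mul_assoc (1 - T) (cauchyIntegral T θ₁ e) S, e1, ← mul_assoc,
      hT.regCalculus_commute hω hinj hθ hν he, mul_assoc]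
  ext x
  exact hEinj (congrArg (fun A : X →L[ℂ] X => A x) e4)

/-- Raising the degree by one uses `T R(z,T) = z R(z,T) - 1`, whose constant term integrates to
zero. This identifies the abstract value of the calculus at a polynomial with the usual `p(T)`. -/
theorem IsRittOfType.regCalculus_polynomial (hω : 1 < ω) (hT : IsRittOfType T ω)
    (hθ : ω < θ) (p : Polynomial ℂ) :
    regCalculus T θ (fun z => p.eval z) = (1 - T) * Polynomial.aeval T p := by
  have hθ1 := hω.trans hθ
  obtain ⟨ν, hν⟩ := exists_gt θ
  induction p using Polynomial.induction_on with
  | C a =>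
    have h1 := hT.regCalculus_one hω hθ
    rw [regCalculus, cauchyIntegral_eq] at h1 ⊢
    simp only [Polynomial.eval_C, Polynomial.aeval_C, Algebra.algebraMap_eq_smul_one, mul_one,
      mul_smul_comm] at h1 ⊢
    have h3 : stolzIntegral θ (fun z => ((1 - z) * a) • resolvent T z) =
        stolzIntegral θ (fun z => a • (1 - z) • resolvent T z) := by
      congr 1
      funext z
      rw [smul_smul, mul_comm]
    rw [← h1, smul_comm a, h3, stolzIntegral_const_smul]
  | add p q hp hq =>
    have ip := hT.stolzIntegrable_reg hω hθ hν (isHInfty_polynomial ν p)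
    have iq := hT.stolzIntegrable_reg hω hθ hν (isHInfty_polynomial ν q)
    rw [map_add, mul_add, ← hp, ← hq]
    simp only [regCalculus, cauchyIntegral_eq]
    rw [← smul_add, ← stolzIntegral_add ip iq]
    simp only [Polynomial.eval_add, mul_add, add_smul]
  | monomial n a h =>
    have hp := isHInfty_polynomial ν (Polynomial.C a * Polynomial.X ^ n)
    have hp' := (isHInfty_one_sub ν).mul hp
    have ip := hT.stolzIntegrable_reg hω hθ hν hp
    have h2 := stolzIntegral_clm (ContinuousLinearMap.mul ℂ (X →L[ℂ] X) T) ip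
    simp only [ContinuousLinearMap.mul_apply'] at h2
    have hcomm : (1 - T) * Polynomial.aeval T (Polynomial.C a * Polynomial.X ^ (n + 1)) =
        T * ((1 - T) * Polynomial.aeval T (Polynomial.C a * Polynomial.X ^ n)) := by
      rw [pow_succ', ← mul_assoc, mul_comm (Polynomial.C a), mul_assoc, map_mul,
        Polynomial.aeval_X, ← mul_assoc, ← mul_assoc]
      congr 1
      rw [sub_mul, mul_sub, one_mul, mul_one]
    rw [hcomm, ← h, regCalculus, regCalculus, cauchyIntegral_eq, cauchyIntegral_eq, mul_smul_comm,
      ← h2]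
    congr 1
    have hEq : EqOn (fun z => ((1 - z) * Polynomial.eval z
          (Polynomial.C a * Polynomial.X ^ (n + 1))) • resolvent T z)
        (fun z => (T * ((1 - z) * Polynomial.eval z (Polynomial.C a * Polynomial.X ^ n)) •
          resolvent T z) + ((1 - z) * Polynomial.eval z (Polynomial.C a * Polynomial.X ^ n)) •
          (1 : X →L[ℂ] X)) (stolzArc θ) := by
      intro z hz
      simp only
      rw [mul_smul_comm, mul_resolvent (hT.stolzArc_subset hω hθ hz), ← smul_add, sub_add_cancel,
        smul_smul]
      congr 1
      simp only [Polynomial.eval_mul, Polynomial.eval_C, Polynomial.eval_pow, Polynomial.eval_X]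
      ring
    have i5 : StolzIntegrable θ (fun z => T * ((1 - z) *
        Polynomial.eval z (Polynomial.C a * Polynomial.X ^ n)) • resolvent T z) := by
      have := IntervalIntegrable.const_mul ip T
      refine this.congr fun t _ => ?_
      simp only [mul_smul_comm]
    rw [stolzIntegral_congr hθ1 hEq, stolzIntegral_add i5 ((hp'.stolzIntegrable hθ1 hν).smul_const _),
      stolzIntegral_smul_const, hp'.stolzIntegral_eq_zero hθ1 hν, zero_smul, add_zero]

end Multiplicativity

/-! ### Automatic continuity of the calculus -/

section ClosedGraph

/-- Division of a bounded linear map by an element that can be cancelled is bounded. -/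
theorem exists_clm_of_mul_eq {H B : Type*} [NormedAddCommGroup H] [NormedSpace ℂ H]
    [CompleteSpace H] [NormedRing B] [NormedAlgebra ℂ B] [CompleteSpace B] (a : B)
    (ha : ∀ x y : B, a * x = a * y → x = y) (Λ : H →ₗ[ℂ] B) {D : ℝ} (hΛ : ∀ h, ‖Λ h‖ ≤ D * ‖h‖)
    (hex : ∀ h, ∃ x, a * x = Λ h) : ∃ L : H →L[ℂ] B, ∀ h, a * L h = Λ h := by
  choose Φ hΦ using hex
  let L : H →ₗ[ℂ] B :=
    { toFun := Φ
      map_add' := fun g g' => ha _ _ (by rw [mul_add, hΦ, hΦ, hΦ, map_add])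
      map_smul' := fun c g => ha _ _ (by
        rw [RingHom.id_apply, mul_smul_comm, hΦ, hΦ, map_smul]) }
  have hΛc : Continuous Λ := (Λ.mkContinuous D hΛ).continuous
  have hLc : Continuous L := by
    refine L.continuous_of_seq_closed_graph fun u g S hu hS => ha _ _ ?_
    have h1 : Tendsto (fun n => a * L (u n)) atTop (𝓝 (a * S)) := hS.const_mul _
    have h2 : Tendsto (fun n => a * L (u n)) atTop (𝓝 (a * L g)) := by
      have h3 : ∀ h, a * L h = Λ h := hΦ
      simp only [h3]
      exact (hΛc.tendsto g).comp hu
    exact tendsto_nhds_unique h1 h2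
  exact ⟨⟨L, hLc⟩, hΦ⟩

open BoundedContinuousFunction

/-- Extension by zero of a function on `stolz ν`. -/
noncomputable def extendZero (ν : ℝ) (g : stolz ν →ᵇ ℂ) (z : ℂ) : ℂ :=
  open Classical in if h : z ∈ stolz ν then g ⟨z, h⟩ else 0

theorem extendZero_of_mem {ν : ℝ} (g : stolz ν →ᵇ ℂ) {z : ℂ} (h : z ∈ stolz ν) :
    extendZero ν g z = g ⟨z, h⟩ := dif_pos h

theorem extendZero_add {ν : ℝ} (g g' : stolz ν →ᵇ ℂ) :
    extendZero ν (g + g') = fun z => extendZero ν g z + extendZero ν g' z := by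
  funext z
  by_cases h : z ∈ stolz ν <;> simp [extendZero, h]

theorem extendZero_smul {ν : ℝ} (c : ℂ) (g : stolz ν →ᵇ ℂ) :
    extendZero ν (c • g) = fun z => c * extendZero ν g z := by
  funext z
  by_cases h : z ∈ stolz ν <;> simp [extendZero, h]

theorem norm_extendZero_le {ν : ℝ} (g : stolz ν →ᵇ ℂ) (z : ℂ) : ‖extendZero ν g z‖ ≤ ‖g‖ := by
  by_cases h : z ∈ stolz ν
  · rw [extendZero_of_mem g h]; exact g.norm_coe_le_norm _
  · simp [extendZero, h]

/-- The Banach space of bounded holomorphic functions on `stolz ν`. -/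
def hInfty (ν : ℝ) : Submodule ℂ (stolz ν →ᵇ ℂ) where
  carrier := {g | DifferentiableOn ℂ (extendZero ν g) (stolz ν)}
  zero_mem' := by
    have : extendZero ν 0 = fun _ => 0 := by
      funext z
      by_cases h : z ∈ stolz ν <;> simp [extendZero, h]
    simp only [mem_ofPred_eq, this]
    exact differentiableOn_const 0
  add_mem' := by
    intro g g' hg hg'
    simp only [mem_ofPred_eq, extendZero_add] at *
    exact hg.add hg'
  smul_mem' := by
    intro c g hg
    simp only [mem_ofPred_eq, extendZero_smul] at *
    exact hg.const_mul c

/-- A uniform limit of holomorphic functions is holomorphic. The closed graph theorem needs the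
resulting completeness. -/
theorem isClosed_hInfty {ν : ℝ} (hν : 0 < ν) : IsClosed (hInfty ν : Set (stolz ν →ᵇ ℂ)) := by
  refine IsSeqClosed.isClosed fun u g hu hug => ?_
  refine TendstoLocallyUniformlyOn.differentiableOn (F := fun n => extendZero ν (u n)) (φ := atTop)
    ?_ (.of_forall hu) (isOpen_stolz hν)
  refine TendstoUniformlyOn.tendstoLocallyUniformlyOn ?_
  rw [Metric.tendstoUniformlyOn_iff]
  intro ε hε
  filter_upwards [(Metric.tendsto_nhds.1 hug) ε hε] with n hn z hz
  rw [extendZero_of_mem _ hz, extendZero_of_mem _ hz, dist_comm]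
  exact (BoundedContinuousFunction.dist_coe_le_dist _).trans_lt hn

theorem isHInfty_extendZero {ν : ℝ} (g : hInfty ν) : IsHInfty ν (extendZero ν g) :=
  ⟨g.2, ‖(g : stolz ν →ᵇ ℂ)‖, fun z _ => norm_extendZero_le _ z⟩

variable {X : Type*} [NormedAddCommGroup X] [NormedSpace ℂ X]
  {T : X →L[ℂ] X} {ω ν θ : ℝ}

theorem regCalculus_smul (c : ℂ) (f : ℂ → ℂ) :
    regCalculus T θ (fun z => c * f z) = c • regCalculus T θ f := by
  simp only [regCalculus, cauchyIntegral_eq]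
  rw [smul_comm c, ← stolzIntegral_const_smul c]
  simp only [smul_smul, mul_left_comm c]

theorem regCalculus_congr (hθ : 1 < θ) (hν : θ < ν) {f g : ℂ → ℂ} (h : EqOn f g (stolz ν)) :
    regCalculus T θ f = regCalculus T θ g := by
  rw [regCalculus, regCalculus, cauchyIntegral_eq, cauchyIntegral_eq]
  congr 1
  refine stolzIntegral_congr hθ fun z hz => ?_
  rw [h (RittCalculus.stolzArc_subset hθ hν hz)]

/-- Along the contour `(1-z) R(z,T)` is bounded by the Ritt condition, so only the supremum of `f`
and the length of the contour matter. -/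
theorem IsRittOfType.norm_regCalculus_le (hω : 1 < ω) (hT : IsRittOfType T ω) (hθ : ω < θ)
    (hν : θ < ν) : ∃ D : ℝ, 0 ≤ D ∧ ∀ (f : ℂ → ℂ) (M : ℝ), (∀ z ∈ stolz ν, ‖f z‖ ≤ M) →
      ‖regCalculus T θ f‖ ≤ D * M := by
  have hθ1 := hω.trans hθ
  obtain ⟨C, hC0, hC⟩ := hT.exists_bound hθ
  obtain ⟨D, hD0, hD⟩ := norm_stolzIntegral_le (E := X →L[ℂ] X) hθ1
  refine ⟨‖(2 * Real.pi * Complex.I : ℂ)⁻¹‖ * (D * C), by positivity, fun f M hM => ?_⟩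
  rw [regCalculus, cauchyIntegral_eq, norm_smul, mul_assoc (‖_‖), mul_assoc D]
  refine mul_le_mul_of_nonneg_left (hD _ _ fun z hz => ?_) (norm_nonneg _)
  rw [mul_comm, mul_smul, norm_smul, mul_comm C]
  have h1 := hM z (RittCalculus.stolzArc_subset hθ1 hν hz)
  exact mul_le_mul h1 (hC z (notMem_of_mem_stolzArc hθ1 hz)) (norm_nonneg _)
    ((norm_nonneg _).trans h1)

variable [CompleteSpace X]

theorem IsRittOfType.regCalculus_add (hω : 1 < ω) (hT : IsRittOfType T ω) (hθ : ω < θ) (hν : θ < ν)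
    {f g : ℂ → ℂ} (hf : IsHInfty ν f) (hg : IsHInfty ν g) :
    regCalculus T θ (fun z => f z + g z) = regCalculus T θ f + regCalculus T θ g := by
  simp only [regCalculus, cauchyIntegral_eq]
  rw [← smul_add, ← stolzIntegral_add (hT.stolzIntegrable_reg hω hθ hν hf)
    (hT.stolzIntegrable_reg hω hθ hν hg)]
  simp only [mul_add, add_smul]

/-- A bounded `H^∞`-calculus is continuous, by the closed graph theorem. -/
theorem IsRittOfType.exists_continuousLinearMap (hω : 1 < ω) (hθ : ω < θ) (hν : θ < ν)
    (hT : IsRittOfType T ω) (hinj : Function.Injective (1 - T : X →L[ℂ] X))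
    (hcalc : HasBoundedHInftyCalculus T ω ν) :
    ∃ L : hInfty ν →L[ℂ] X →L[ℂ] X, ∀ g : hInfty ν,
      (1 - T) * L g = regCalculus T θ (extendZero ν g) := by
  have hν0 : 0 < ν := by linarith
  obtain ⟨D, hD0, hD⟩ := hT.norm_regCalculus_le hω hθ hν
  have : CompleteSpace (hInfty ν) := (isClosed_hInfty hν0).completeSpace_coe
  let Λ : hInfty ν →ₗ[ℂ] X →L[ℂ] X :=
    { toFun := fun g => regCalculus T θ (extendZero ν g)
      map_add' := fun g g' => by
        rw [Submodule.coe_add, extendZero_add]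
        exact hT.regCalculus_add hω hθ hν (isHInfty_extendZero g) (isHInfty_extendZero g')
      map_smul' := fun c g => by
        rw [Submodule.coe_smul, extendZero_smul]
        exact regCalculus_smul _ _ }
  refine exists_clm_of_mul_eq (1 - T) (fun A B h => ?_) Λ
    (fun g => hD _ _ fun z _ => norm_extendZero_le _ z) fun g => ?_
  · ext x
    exact hinj (congrArg (fun A : X →L[ℂ] X => A x) h)
  · obtain ⟨S, hS⟩ := hcalc _ (isHInfty_extendZero g)
    exact ⟨S, hT.one_sub_mul_of_extendedCalculus hω hθ hν (isHInfty_extendZero g) hS⟩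

/-- A bounded `H^∞`-calculus gives an estimate for polynomials. -/
theorem IsRittOfType.exists_polynomial_bound (hω : 1 < ω) (hων : ω < ν) (hT : IsRittOfType T ω)
    (hcalc : HasBoundedHInftyCalculus T ω ν) :
    ∃ K : ℝ, 0 ≤ K ∧ ∀ (p : Polynomial ℂ) (M : ℝ), 0 ≤ M → (∀ z ∈ stolz ν, ‖p.eval z‖ ≤ M) →
      ‖Polynomial.aeval T p‖ ≤ K * M := by
  obtain ⟨θ, hθ, hν⟩ := exists_between hων
  -- The constant function `1` already requires a regulariser with injective value.
  have hinj : Function.Injective (1 - T : X →L[ℂ] X) := by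
    obtain ⟨S, e, A, B, hA, hAinj, -, -⟩ := hcalc _ (isHInfty_const ν 1)
    exact hT.injective_one_sub hω hA hAinj
  obtain ⟨L, hL⟩ := hT.exists_continuousLinearMap hω hθ hν hinj hcalc
  refine ⟨‖L‖, L.opNorm_nonneg, fun p M hM0 hM => ?_⟩
  let g₀ : stolz ν →ᵇ ℂ := BoundedContinuousFunction.ofNormedAddCommGroup
    (fun z : stolz ν => p.eval (z : ℂ)) (p.continuous.comp continuous_subtype_val) M
    fun z => hM z z.2
  have hg₀ : EqOn (extendZero ν g₀) (fun z => p.eval z) (stolz ν) := fun z hz => by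
    rw [extendZero_of_mem _ hz]; rfl
  let g : hInfty ν := ⟨g₀, p.differentiable.differentiableOn.congr hg₀⟩
  have hgn : ‖g‖ ≤ M := BoundedContinuousFunction.norm_ofNormedAddCommGroup_le _ hM0 fun z : stolz ν => hM z z.2
  have hgp : L g = Polynomial.aeval T p := by
    have h1 : (1 - T) * L g = (1 - T) * Polynomial.aeval T p := by
      rw [hL, ← hT.regCalculus_polynomial hω hθ p]
      exact regCalculus_congr (hω.trans hθ) hν hg₀
    ext x
    exact hinj (congrArg (fun A : X →L[ℂ] X => A x) h1)
  rw [← hgp]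
  exact (L.le_opNorm g).trans (mul_le_mul_of_nonneg_left hgn L.opNorm_nonneg)

end ClosedGraph

/-! ### Cotype and Pisier's factorization argument -/

section Factorization

variable {X : Type*} [NormedAddCommGroup X] {ι : Type*}

/-- The tangent line inequality for `t ↦ t ^ q`. -/
theorem rpow_tangent_le {q a b : ℝ} (hq : 1 < q) (ha : 0 ≤ a) (hb : 0 ≤ b) :
    a ^ q + q * (a ^ (q - 1) * (b - a)) ≤ b ^ q := by
  rcases ha.eq_or_lt with rfl | ha
  · rw [Real.zero_rpow (by linarith), Real.zero_rpow (by linarith)]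
    simp only [zero_mul, mul_zero, add_zero]
    positivity
  · have h1 := one_add_mul_self_le_rpow_one_add (s := b / a - 1)
      (by have : 0 ≤ b / a := by positivity
          linarith) hq.le
    have h2 : 1 + (b / a - 1) = b / a := by ring
    rw [h2, Real.div_rpow hb ha.le, le_div_iff₀ (by positivity)] at h1
    have h3 : a ^ q = a ^ (q - 1) * a := by
      rw [← Real.rpow_add_one ha.ne', sub_add_cancel]
    have h4 : (1 + q * (b / a - 1)) * a ^ q = a ^ q + q * (a ^ (q - 1) * (b - a)) := by
      rw [add_mul, one_mul]
      nth_rw 2 [h3]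
      field_simp
    rw [← h4]
    exact h1

/-- Finite families of multipliers whose absolute values sum up to at most one. -/
def IsSubPartition {n : ℕ} (α : Fin n → ι → ℝ) : Prop := ∀ l, ∑ i, |α i l| ≤ 1

theorem rademacherAverage_le {M : ℝ} {n : ℕ} {x : Fin n → X}
    (h : ∀ ε : Fin n → ℤˣ, ‖∑ i, ((ε i : ℤˣ) : ℤ) • x i‖ ≤ M) : rademacherAverage x ≤ M := by
  rw [rademacherAverage, div_le_iff₀ (by positivity)]
  calc ∑ ε : Fin n → ℤˣ, ‖∑ i, ((ε i : ℤˣ) : ℤ) • x i‖ ≤ ∑ _ε : Fin n → ℤˣ, M :=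
        Finset.sum_le_sum fun ε _ => h ε
    _ = M * 2 ^ n := by
        rw [Finset.sum_const, Finset.card_univ, nsmul_eq_mul, mul_comm, Fintype.card_fun,
          Fintype.card_units_int, Fintype.card_fin]
        push_cast
        rfl

theorem rademacherAverage_nonneg {n : ℕ} (x : Fin n → X) : 0 ≤ rademacherAverage x := by
  unfold rademacherAverage; positivity

/-- The constant of the cotype inequality may be taken nonnegative, and the inequality may be
written without the root. -/
theorem HasCotype.exists_const {q : ℝ} (hq : 0 < q) (h : HasCotype X q) :
    ∃ c : ℝ, 0 ≤ c ∧ ∀ (N : ℕ) (x : Fin N → X) (M : ℝ),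
      (∀ ε : Fin N → ℤˣ, ‖∑ i, ((ε i : ℤˣ) : ℤ) • x i‖ ≤ M) → ∑ n, ‖x n‖ ^ q ≤ (c * M) ^ q := by
  obtain ⟨c, hc⟩ := h
  refine ⟨max c 0, le_max_right _ _, fun N x M hM => ?_⟩
  have h1 := hc N x
  have h2 : (∑ n, ‖x n‖ ^ q) ^ (1 / q) ≤ max c 0 * M :=
    h1.trans (mul_le_mul (le_max_left _ _) (rademacherAverage_le hM)
      (rademacherAverage_nonneg x) (le_max_right _ _))
  have h3 : 0 ≤ ∑ n, ‖x n‖ ^ q := by positivity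
  calc ∑ n, ‖x n‖ ^ q = ((∑ n, ‖x n‖ ^ q) ^ (1 / q)) ^ q := by
        rw [← Real.rpow_mul h3, one_div_mul_cancel hq.ne', Real.rpow_one]
    _ ≤ _ := by gcongr

variable [NormedSpace ℝ X]

/-- Operators on `ℓ_∞` with values in a space of cotype `q` are `(q, 1)`-summing. -/
theorem sum_rpow_le_of_isSubPartition {q c M : ℝ}
    (hc : ∀ (N : ℕ) (x : Fin N → X) (M : ℝ),
      (∀ ε : Fin N → ℤˣ, ‖∑ i, ((ε i : ℤˣ) : ℤ) • x i‖ ≤ M) → ∑ n, ‖x n‖ ^ q ≤ (c * M) ^ q)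
    (u : (ι → ℝ) →ₗ[ℝ] X) (hu : ∀ α : ι → ℝ, (∀ l, |α l| ≤ 1) → ‖u α‖ ≤ M) {n : ℕ}
    {α : Fin n → ι → ℝ} (hα : IsSubPartition α) : ∑ i, ‖u (α i)‖ ^ q ≤ (c * M) ^ q := by
  refine hc n _ M fun ε => ?_
  have h1 : ∑ i, ((ε i : ℤˣ) : ℤ) • u (α i) = u (∑ i, ((ε i : ℤˣ) : ℤ) • α i) := by
    simp only [map_sum, map_zsmul]
  rw [h1]
  refine hu _ fun l => ?_
  rw [Finset.sum_apply]
  refine (Finset.abs_sum_le_sum_abs _ _).trans ((Finset.sum_le_sum fun i _ => ?_).trans (hα l))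
  rw [Pi.smul_apply, zsmul_eq_mul, abs_mul]
  rcases Int.units_eq_one_or (ε i) with h | h <;> simp [h]

/-- Pisier's factorization argument: an almost extremal family gives a functional which dominates
a `(q, 1)`-summing operator. -/
theorem exists_dominating_functional {q V : ℝ} (hq : 1 < q) (u : (ι → ℝ) →ₗ[ℝ] X)
    (hV : ∀ (n : ℕ) (α : Fin n → ι → ℝ), IsSubPartition α → ∑ i, ‖u (α i)‖ ^ q ≤ V) :
    ∃ V' : ℝ, 0 ≤ V' ∧ V' ≤ V ∧ ∀ ε > 0, ∃ Λ : (ι → ℝ) →ₗ[ℝ] ℝ,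
      (∀ f : ι → ℝ, (∀ l, |f l| ≤ 1) → ‖u f‖ ^ q ≤ q * Λ (fun l => |f l|) + ε) ∧
      ∀ h : ι → ℝ, (∀ l, |h l| ≤ 1) → Λ h ≤ V' := by
  set S : Set ℝ := {s | ∃ (n : ℕ) (α : Fin n → ι → ℝ), IsSubPartition α ∧
    s = ∑ i, ‖u (α i)‖ ^ q} with hS
  have hbdd : BddAbove S := ⟨V, by rintro _ ⟨n, α, hα, rfl⟩; exact hV n α hα⟩
  have h0S : (0 : ℝ) ∈ S := ⟨0, Fin.elim0, fun l => by simp, by simp⟩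
  have hle : ∀ (n : ℕ) (α : Fin n → ι → ℝ), IsSubPartition α → ∑ i, ‖u (α i)‖ ^ q ≤ sSup S :=
    fun n α hα => le_csSup hbdd ⟨n, α, hα, rfl⟩
  refine ⟨sSup S, le_csSup hbdd h0S, csSup_le ⟨0, h0S⟩ (by
    rintro _ ⟨n, α, hα, rfl⟩; exact hV n α hα), fun ε hε => ?_⟩
  obtain ⟨_, ⟨n, α, hα, rfl⟩, hlt⟩ := exists_lt_of_lt_csSup ⟨0, h0S⟩ (sub_lt_self (sSup S) hε)
  choose g hg1 hg2 using fun i => exists_dual_vector'' ℝ (u (α i))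
  -- Up to the factor `q`, this is a derivative of `∑ ‖u (α i)‖ ^ q` when every `α i` is perturbed
  -- in the direction `α i * h`, with `g i` a norming functional of `u (α i)`.
  let Λ : (ι → ℝ) →ₗ[ℝ] ℝ := ∑ i, (‖u (α i)‖ ^ (q - 1)) •
    ((g i : X →ₗ[ℝ] ℝ) ∘ₗ u ∘ₗ LinearMap.mulLeft ℝ (α i))
  have hΛ : ∀ h, Λ h = ∑ i, ‖u (α i)‖ ^ (q - 1) * g i (u (α i * h)) := fun h => by
    simp [Λ, LinearMap.sum_apply]
  have hgle : ∀ i x, g i x ≤ ‖x‖ := fun i x =>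
    (le_abs_self _).trans ((g i).le_of_opNorm_le (hg1 i) x |>.trans (by rw [one_mul]))
  refine ⟨Λ, fun f hf => ?_, fun h hh => ?_⟩
  · have hpart : IsSubPartition (Fin.cons f fun i => α i * (fun l => 1 - |f l|) :
        Fin (n + 1) → ι → ℝ) := by
      intro l
      rw [Fin.sum_univ_succ]
      simp only [Fin.cons_zero, Fin.cons_succ, Pi.mul_apply, abs_mul]
      rw [← Finset.sum_mul, abs_of_nonneg (sub_nonneg.2 (hf l))]
      nlinarith [hα l, hf l, abs_nonneg (f l)]
    have h1 := hle _ _ hpart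
    rw [Fin.sum_univ_succ] at h1
    simp only [Fin.cons_zero, Fin.cons_succ] at h1
    have h2 : ∑ i, ‖u (α i)‖ ^ q - q * Λ (fun l => |f l|) ≤
        ∑ i, ‖u (α i * fun l => 1 - |f l|)‖ ^ q := by
      rw [hΛ, Finset.mul_sum, ← Finset.sum_sub_distrib]
      refine Finset.sum_le_sum fun i _ => ?_
      refine le_trans ?_ (rpow_tangent_le hq (norm_nonneg (u (α i))) (norm_nonneg _))
      have h3 : ‖u (α i)‖ - g i (u (α i * fun l => |f l|)) ≤ ‖u (α i * fun l => 1 - |f l|)‖ := by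
        refine le_trans (le_of_eq ?_) (hgle i _)
        have h4 : (α i * fun l => 1 - |f l|) = α i - α i * fun l => |f l| := by
          ext l; simp [mul_sub]
        rw [h4, map_sub, map_sub, hg2]
        rfl
      have h5 : 0 ≤ ‖u (α i)‖ ^ (q - 1) := by positivity
      have h6 := mul_le_mul_of_nonneg_left h3 (mul_nonneg (by linarith : 0 ≤ q) h5)
      linarith
    linarith
  · rw [hΛ]
    have hpart : IsSubPartition (fun i => α i * h) := by
      intro l
      refine le_trans (Finset.sum_le_sum fun i _ => ?_) (hα l)
      simp only [Pi.mul_apply, abs_mul]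
      exact mul_le_of_le_one_right (abs_nonneg _) (hh l)
    have h1 := hle _ _ hpart
    have h2 := hle _ _ hα
    -- The tangent inequality in the form `q a^(q-1) b ≤ (q-1) a^q + b^q`. Both sums on the right
    -- are at most the supremum, so the factor `q` cancels.
    have h3 : q * ∑ i, ‖u (α i)‖ ^ (q - 1) * g i (u (α i * h)) ≤
        (q - 1) * ∑ i, ‖u (α i)‖ ^ q + ∑ i, ‖u (α i * h)‖ ^ q := by
      rw [Finset.mul_sum, Finset.mul_sum, ← Finset.sum_add_distrib]
      refine Finset.sum_le_sum fun i _ => ?_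
      have h4 := rpow_tangent_le hq (norm_nonneg (u (α i))) (norm_nonneg (u (α i * h)))
      have h5 : 0 ≤ ‖u (α i)‖ ^ (q - 1) := by positivity
      have h6 := mul_le_mul_of_nonneg_left (hgle i (u (α i * h)))
        (mul_nonneg (by linarith : 0 ≤ q) h5)
      have h7 : ‖u (α i)‖ ^ (q - 1) * ‖u (α i)‖ = ‖u (α i)‖ ^ q := by
        rcases (norm_nonneg (u (α i))).eq_or_lt with h | h
        · rw [← h, mul_zero, Real.zero_rpow (by linarith)]
        · rw [← Real.rpow_add_one h.ne', sub_add_cancel]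
      rw [← h7] at h4 ⊢
      linarith
    nlinarith

/-- Random multipliers that are small in mean, in spaces of cotype `q`. -/
theorem integral_rpow_norm_le [Fintype ι] {q V : ℝ} (hq : 1 < q) (u : (ι → ℝ) →ₗ[ℝ] X)
    (hV : ∀ (n : ℕ) (α : Fin n → ι → ℝ), IsSubPartition α → ∑ i, ‖u (α i)‖ ^ q ≤ V)
    {Ω : Type*} [MeasurableSpace Ω] (μ : Measure Ω) [IsProbabilityMeasure μ] {ξ : Ω → ι → ℝ}
    (hξm : ∀ l, Measurable fun ω => ξ ω l) (hξ : ∀ ω l, |ξ ω l| ≤ 1) {p : ℝ} (hp : 0 < p)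
    (hξp : ∀ l, ∫ ω, |ξ ω l| ∂μ ≤ p) : ∫ ω, ‖u (ξ ω)‖ ^ q ∂μ ≤ q * p * V := by
  classical
  obtain ⟨V', hV0, hV'V, hex⟩ := exists_dominating_functional hq u hV
  have hint : ∀ l, Integrable (fun ω => |ξ ω l|) μ := fun l =>
    Integrable.of_bound (C := 1) (hξm l).abs.aestronglyMeasurable
      (.of_forall fun ω => by rw [Real.norm_eq_abs, abs_abs]; exact hξ ω l)
  have key : ∀ ε > 0, ∫ ω, ‖u (ξ ω)‖ ^ q ∂μ ≤ q * p * V' + ε := by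
    intro ε hε
    obtain ⟨Λ, hΛ1, hΛ2⟩ := hex ε hε
    have hΛs : ∀ h : ι → ℝ, Λ h = ∑ l, h l * Λ (Pi.single l 1) := fun h => by
      conv_lhs => rw [← Finset.univ_sum_single h, map_sum]
      refine Finset.sum_congr rfl fun l _ => ?_
      rw [← smul_eq_mul, ← map_smul, ← Pi.single_smul, smul_eq_mul, mul_one]
    have hΛω : (fun ω => Λ (fun l => |ξ ω l|)) =
        fun ω => ∑ l, |ξ ω l| * Λ (Pi.single l 1) := funext fun ω => hΛs _
    have hΛint : Integrable (fun ω => Λ (fun l => |ξ ω l|)) μ := by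
      rw [hΛω]
      exact integrable_finsetSum _ fun l _ => (hint l).mul_const _
    have hΛval : ∫ ω, Λ (fun l => |ξ ω l|) ∂μ = Λ (fun l => ∫ ω, |ξ ω l| ∂μ) := by
      rw [hΛs (fun l => ∫ ω, |ξ ω l| ∂μ)]
      rw [hΛω, integral_finsetSum _ fun l _ => (hint l).mul_const _]
      simp_rw [integral_mul_const]
    have h1 : ∫ ω, ‖u (ξ ω)‖ ^ q ∂μ ≤ ∫ ω, (q * Λ (fun l => |ξ ω l|) + ε) ∂μ := by
      refine integral_mono_of_nonneg (.of_forall fun ω => by positivity)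
        ((hΛint.const_mul q).add (integrable_const ε)) (.of_forall fun ω => hΛ1 _ (hξ ω))
    rw [integral_add (hΛint.const_mul q) (integrable_const ε), integral_const_mul, hΛval,
      integral_const] at h1
    -- Linearity lets the expectation enter `Λ`, and the averaged multiplier is `p` times an element
    -- of the unit ball. This produces the factor `p`, whatever the dependence between the
    -- multipliers.
    have h2 : Λ (fun l => ∫ ω, |ξ ω l| ∂μ) ≤ p * V' := by
      have h3 : (fun l => ∫ ω, |ξ ω l| ∂μ) = p • (fun l => p⁻¹ * ∫ ω, |ξ ω l| ∂μ) := by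
        ext l
        simp only [Pi.smul_apply, smul_eq_mul]
        field_simp
      rw [h3, map_smul, smul_eq_mul]
      refine mul_le_mul_of_nonneg_left (hΛ2 _ fun l => ?_) hp.le
      have h4 : 0 ≤ ∫ ω, |ξ ω l| ∂μ := integral_nonneg fun ω => abs_nonneg _
      rw [abs_of_nonneg (by positivity), inv_mul_le_iff₀ hp, mul_one]
      exact hξp l
    have h5 := mul_le_mul_of_nonneg_left h2 (by linarith : 0 ≤ q)
    simp at h1
    linarith
  refine (le_of_forall_pos_le_add key).trans ?_
  have : 0 < q := by linarith
  gcongr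

end Factorization

/-! ### Random multipliers with exponential tails -/

section GaussianMultipliers

/-- The part of a number `t` with `n ≤ |t| < n + 1`, normalised by `n + 1`. -/
noncomputable def levelPart (n : ℕ) (t : ℝ) : ℝ :=
  if ⌊|t|⌋₊ = n then t / (n + 1) else 0

theorem abs_levelPart_le_one (n : ℕ) (t : ℝ) : |levelPart n t| ≤ 1 := by
  unfold levelPart
  split_ifs with h
  · have h1 := Nat.lt_floor_add_one |t|
    rw [h] at h1
    rw [abs_div, abs_of_pos (by positivity : (0 : ℝ) < n + 1), div_le_one (by positivity)]
    exact h1.le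
  · simp

theorem levelPart_eq_zero {n : ℕ} {t : ℝ} (h : |t| < n) : levelPart n t = 0 := by
  rw [levelPart, if_neg]
  intro h1
  have := Nat.floor_le (abs_nonneg t)
  rw [h1] at this
  linarith

theorem measurable_levelPart (n : ℕ) : Measurable (levelPart n) := by
  refine Measurable.ite ?_ (measurable_id.div_const _) measurable_const
  exact (Nat.measurable_floor.comp measurable_abs) (measurableSet_singleton n)

theorem sum_levelPart {t : ℝ} {R : ℕ} (h : |t| < R) :
    ∑ n ∈ Finset.range R, ((n : ℝ) + 1) * levelPart n t = t := by
  have h1 : ⌊|t|⌋₊ < R := (Nat.floor_lt (abs_nonneg t)).2 h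
  rw [Finset.sum_eq_single_of_mem _ (Finset.mem_range.2 h1)]
  · rw [levelPart, if_pos rfl]
    field_simp
  · intro n _ hn
    rw [levelPart, if_neg hn.symm, mul_zero]

/-- A constant in the estimate of random sums whose multipliers have exponential tails. -/
noncomputable def tailConst (q B : ℝ) : ℝ :=
  ∑' n : ℕ, ((n : ℝ) + 1) * (q * (B * Real.exp (-n))) ^ (1 / q)

theorem summable_tailConst {q B : ℝ} (hq : 0 < q) (hB : 0 ≤ B) :
    Summable fun n : ℕ => ((n : ℝ) + 1) * (q * (B * Real.exp (-n))) ^ (1 / q) := by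
  have h1 := Real.summable_pow_mul_exp_neg_nat_mul 1 (one_div_pos.2 hq)
  have h0 := Real.summable_pow_mul_exp_neg_nat_mul 0 (one_div_pos.2 hq)
  refine ((h1.add h0).mul_left ((q * B) ^ (1 / q))).congr fun n => ?_
  rw [← mul_assoc q, Real.mul_rpow (by positivity) (by positivity) (y := Real.exp (-n)),
    ← Real.exp_mul, show -(1 / q) * (n : ℝ) = -n * (1 / q) by ring]
  ring

theorem tailConst_nonneg {q B : ℝ} (hq : 0 < q) (hB : 0 ≤ B) : 0 ≤ tailConst q B :=
  tsum_nonneg fun n => by positivity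

variable {X : Type*} [NormedAddCommGroup X] [NormedSpace ℝ X] {ι : Type*} [Fintype ι]
  {Ω : Type*} [MeasurableSpace Ω]

/-- In a space of cotype `q`, an unconditionally bounded family may be multiplied by any random
multipliers with uniformly exponential tails. -/
theorem eLpNorm_sum_smul_le {q c M B : ℝ} (hq : 2 ≤ q) (hc0 : 0 ≤ c)
    (hc : ∀ (N : ℕ) (x : Fin N → X) (M : ℝ),
      (∀ ε : Fin N → ℤˣ, ‖∑ i, ((ε i : ℤˣ) : ℤ) • x i‖ ≤ M) → ∑ n, ‖x n‖ ^ q ≤ (c * M) ^ q)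
    {y : ι → X} (hy : ∀ α : ι → ℝ, (∀ l, |α l| ≤ 1) → ‖∑ l, α l • y l‖ ≤ M)
    {μ : Measure Ω} [IsProbabilityMeasure μ] {G : Ω → ι → ℝ}
    (hGm : ∀ l, Measurable fun ω => G ω l) (hB : 0 < B)
    (hG : ∀ (l : ι) (n : ℕ), μ.real {ω | (n : ℝ) ≤ |G ω l|} ≤ B * Real.exp (-n)) :
    eLpNorm (fun ω => ∑ l, G ω l • y l) 2 μ ≤ ENNReal.ofReal (tailConst q B * (c * M)) := by
  have hq0 : 0 < q := by linarith
  have hM : 0 ≤ M := (norm_nonneg _).trans (hy 0 (by simp))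
  let u : (ι → ℝ) →ₗ[ℝ] X := Fintype.linearCombination ℝ y
  have hu : ∀ α, u α = ∑ l, α l • y l := fun α => Fintype.linearCombination_apply ..
  let ξ : ℕ → Ω → ι → ℝ := fun n ω l => levelPart n (G ω l)
  have hξm : ∀ n l, Measurable fun ω => ξ n ω l := fun n l =>
    (measurable_levelPart n).comp (hGm l)
  have hsm : ∀ n, StronglyMeasurable fun ω => u (ξ n ω) := fun n => by
    simp only [hu]
    exact Finset.stronglyMeasurable_fun_sum _ fun l _ => (hξm n l).stronglyMeasurable.smul_const _
  -- Here `p = B exp(-n)`: the level part is bounded by one and vanishes unless `|G ω l| ≥ n`.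
  have hint : ∀ n : ℕ, ∫ ω, ‖u (ξ n ω)‖ ^ q ∂μ ≤ q * (B * Real.exp (-n)) * (c * M) ^ q := fun n => by
    refine integral_rpow_norm_le (by linarith) u (fun k α hα =>
      sum_rpow_le_of_isSubPartition hc u (fun α hα => by rw [hu]; exact hy α hα) hα) μ (hξm n)
      (fun ω l => abs_levelPart_le_one n _) (by positivity) fun l => ?_
    refine le_trans ?_ (hG l n)
    have hms : MeasurableSet {ω | (n : ℝ) ≤ |G ω l|} := measurableSet_le measurable_const (hGm l).abs
    rw [← integral_indicator_one hms]
    refine integral_mono_of_nonneg (.of_forall fun ω => abs_nonneg _)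
      ((integrable_const (1 : ℝ)).indicator hms) (.of_forall fun ω => ?_)
    by_cases h : (n : ℝ) ≤ |G ω l|
    · rw [indicator_of_mem (by exact h)]
      exact abs_levelPart_le_one n _
    · rw [indicator_of_notMem (by exact h)]
      simp only [ξ, levelPart_eq_zero (not_le.1 h), abs_zero, le_refl]
  have hnorm : ∀ n : ℕ, eLpNorm (fun ω => ((n : ℝ) + 1) • u (ξ n ω)) 2 μ ≤
      ENNReal.ofReal (((n : ℝ) + 1) * (q * (B * Real.exp (-n))) ^ (1 / q) * (c * M)) := fun n => by
    have hmem : MemLp (fun ω => u (ξ n ω)) (ENNReal.ofReal q) μ := by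
      refine MemLp.of_bound (hsm n).aestronglyMeasurable M (.of_forall fun ω => ?_)
      rw [hu]; exact hy _ fun l => abs_levelPart_le_one n _
    have h1 : eLpNorm (fun ω => u (ξ n ω)) 2 μ ≤
        ENNReal.ofReal ((q * (B * Real.exp (-n))) ^ (1 / q) * (c * M)) := by
      refine (eLpNorm_le_eLpNorm_of_exponent_le (q := ENNReal.ofReal q) ?_
        (hsm n).aestronglyMeasurable).trans ?_
      · rw [show (2 : ENNReal) = ENNReal.ofReal 2 by simp]
        exact ENNReal.ofReal_le_ofReal hq
      rw [hmem.eLpNorm_eq_integral_rpow_norm (by simpa using hq0) (by simp),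
        ENNReal.toReal_ofReal hq0.le]
      refine ENNReal.ofReal_le_ofReal ?_
      have h2 : 0 ≤ ∫ ω, ‖u (ξ n ω)‖ ^ q ∂μ := integral_nonneg fun ω => by positivity
      calc (∫ ω, ‖u (ξ n ω)‖ ^ q ∂μ) ^ q⁻¹ ≤ (q * (B * Real.exp (-n)) * (c * M) ^ q) ^ q⁻¹ := by
            gcongr; exact hint n
        _ = _ := by
            rw [Real.mul_rpow (by positivity) (by positivity), ← Real.rpow_mul (by positivity),
              mul_inv_cancel₀ hq0.ne', Real.rpow_one, one_div]
    have h3 : (fun ω => ((n : ℝ) + 1) • u (ξ n ω)) = ((n : ℝ) + 1) • fun ω => u (ξ n ω) := rfl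
    rw [h3, eLpNorm_const_smul, mul_assoc, ENNReal.ofReal_mul (by positivity),
      Real.enorm_of_nonneg (by positivity)]
    gcongr
  have hS : ∀ R : ℕ, eLpNorm (fun ω => ∑ n ∈ Finset.range R, ((n : ℝ) + 1) • u (ξ n ω)) 2 μ ≤
      ENNReal.ofReal (tailConst q B * (c * M)) := fun R => by
    have h1 : (fun ω => ∑ n ∈ Finset.range R, ((n : ℝ) + 1) • u (ξ n ω)) =
        ∑ n ∈ Finset.range R, fun ω => ((n : ℝ) + 1) • u (ξ n ω) := by
      ext ω; rw [Finset.sum_apply]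
    rw [h1]
    refine (eLpNorm_sum_le (fun n _ => ((hsm n).const_smul _).aestronglyMeasurable)
      (by norm_num)).trans ?_
    refine (Finset.sum_le_sum fun n _ => hnorm n).trans ?_
    rw [← ENNReal.ofReal_sum_of_nonneg (fun n _ => by positivity), ← Finset.sum_mul]
    refine ENNReal.ofReal_le_ofReal (mul_le_mul_of_nonneg_right ?_ (by positivity))
    exact (summable_tailConst hq0 hB.le).sum_le_tsum _ fun n _ => by positivity
  -- For each `ω` finitely many levels reproduce the multipliers exactly, but their number depends
  -- on `ω`; Fatou's lemma passes to the limit.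
  refine (Lp.eLpNorm_lim_le_liminf_eLpNorm (fun R =>
    (Finset.stronglyMeasurable_fun_sum _ fun n _ => (hsm n).const_smul _).aestronglyMeasurable)
    _ (.of_forall fun ω => ?_)).trans (liminf_le_of_frequently_le'
      (Frequently.of_forall hS))
  obtain ⟨R₀, hR₀⟩ : ∃ R₀ : ℕ, ∀ l, |G ω l| < R₀ := by
    obtain ⟨R₀, h⟩ := exists_nat_gt (∑ l, |G ω l|)
    exact ⟨R₀, fun l => (Finset.single_le_sum (f := fun l => |G ω l|) (fun _ _ => abs_nonneg _)
      (Finset.mem_univ l)).trans_lt h⟩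
  refine tendsto_const_nhds.congr' ?_
  filter_upwards [eventually_ge_atTop R₀] with R hR
  simp only [hu, ξ, Pi.smul_apply, Finset.smul_sum, smul_smul]
  rw [Finset.sum_comm]
  refine Finset.sum_congr rfl fun l _ => ?_
  rw [← Finset.sum_smul, sum_levelPart ((hR₀ l).trans_le (by exact_mod_cast hR))]

end GaussianMultipliers

/-! ### Linear combinations of independent Gaussians -/

section GaussianCombinations

/-- Finite linear combinations of the variables `γₙ` are Gaussian. -/
theorem map_sum_coord (s : Finset ℕ) (b : ℕ → ℝ) :
    gaussianSeq.map (fun ω : ℕ → ℝ => ∑ k ∈ s, b k * ω k) =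
      gaussianReal 0 (.mk (∑ k ∈ s, b k ^ 2) (Finset.sum_nonneg fun _ _ => sq_nonneg _)) := by
  classical
  induction s using Finset.induction_on with
  | empty =>
    simp only [Finset.sum_empty]
    rw [Measure.map_const, measure_univ, one_smul]
    exact (gaussianReal_zero_var 0).symm
  | insert n s hn ih =>
    have hind := iIndepFun_infinitePi (P := fun _ : ℕ => gaussianReal 0 1)
      (X := fun k x => b k * x) (fun k => by fun_prop)
    have h1 : IndepFun (∑ k ∈ s, fun ω : ℕ → ℝ => b k * ω k) (fun ω : ℕ → ℝ => b n * ω n)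
        gaussianSeq := hind.indepFun_finsetSum_of_notMem (fun k => by fun_prop) hn
    have h2 : (∑ k ∈ s, fun ω : ℕ → ℝ => b k * ω k) = fun ω => ∑ k ∈ s, b k * ω k := by
      ext ω; rw [Finset.sum_apply]
    rw [h2] at h1
    have h3 : HasLaw (fun ω : ℕ → ℝ => ω n) (gaussianReal 0 1) gaussianSeq :=
      ⟨(measurable_pi_apply n).aemeasurable,
        (measurePreserving_eval_infinitePi (fun _ : ℕ => gaussianReal 0 1) n).map_eq⟩
    have h4 := gaussianReal_add_gaussianReal_of_indepFun h1 ih (gaussianReal_const_mul h3 (b n)).map_eq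
    simp_rw [Finset.sum_insert hn]
    have h5 : (fun ω : ℕ → ℝ => b n * ω n + ∑ k ∈ s, b k * ω k) =
        (fun ω => ∑ k ∈ s, b k * ω k) + fun ω => b n * ω n := by
      ext ω; simp [add_comm]
    rw [h5, h4, mul_zero, add_zero]
    congr 1
    ext
    simp [add_comm]

theorem measurable_sum_coord (s : Finset ℕ) (b : ℕ → ℝ) :
    Measurable fun ω : ℕ → ℝ => ∑ k ∈ s, b k * ω k := by fun_prop

/-- Chernoff's bound at parameter `1`. The moment generating function there is `exp (v/2)` with
variance `v ≤ 1`, so the constant `exp 1` is generous; the Gaussian decay is not needed. -/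
theorem measureReal_le_sum_coord {s : Finset ℕ} {b : ℕ → ℝ} (hb : ∑ k ∈ s, b k ^ 2 ≤ 1) (t : ℝ) :
    gaussianSeq.real {ω | t ≤ ∑ k ∈ s, b k * ω k} ≤ Real.exp 1 * Real.exp (-t) := by
  have hint : Integrable (fun ω : ℕ → ℝ => Real.exp (1 * ∑ k ∈ s, b k * ω k)) gaussianSeq := by
    have h := integrable_exp_mul_gaussianReal (μ := 0)
      (v := (.mk (∑ k ∈ s, b k ^ 2) (Finset.sum_nonneg fun _ _ => sq_nonneg _))) 1
    rw [← map_sum_coord] at h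
    exact h.comp_measurable (measurable_sum_coord s b)
  refine (measure_ge_le_exp_mul_mgf t zero_le_one hint).trans ?_
  rw [mgf_gaussianReal (map_sum_coord s b), mul_comm, neg_one_mul]
  gcongr
  simp only [NNReal.coe_mk]
  linarith

/-- Normalised combinations of the variables `γₙ` have uniformly exponential tails. -/
theorem measureReal_abs_sum_coord_le {s : Finset ℕ} {b : ℕ → ℝ} (hb : ∑ k ∈ s, b k ^ 2 ≤ 1) (t : ℝ) :
    gaussianSeq.real {ω | t ≤ |∑ k ∈ s, b k * ω k|} ≤ 2 * Real.exp 1 * Real.exp (-t) := by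
  have h1 : {ω : ℕ → ℝ | t ≤ |∑ k ∈ s, b k * ω k|} ⊆
      {ω | t ≤ ∑ k ∈ s, b k * ω k} ∪ {ω | t ≤ ∑ k ∈ s, (-b k) * ω k} := by
    intro ω hω
    simpa [le_abs, Finset.sum_neg_distrib] using hω
  have h2 := measureReal_le_sum_coord hb t
  have h3 := measureReal_le_sum_coord (s := s) (b := fun k => -b k) (by simpa using hb) t
  refine (measureReal_mono h1).trans ((measureReal_union_le _ _).trans ?_)
  linarith

theorem integral_cexp_sum_coord (s : Finset ℕ) (b : ℕ → ℝ) :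
    ∫ ω : ℕ → ℝ, Complex.exp ((∑ k ∈ s, b k * ω k : ℝ) * Complex.I) ∂gaussianSeq =
      Complex.exp (-((∑ k ∈ s, b k ^ 2 : ℝ) : ℂ) / 2) := by
  have h := charFun_gaussianReal (μ := 0)
    (v := (.mk (∑ k ∈ s, b k ^ 2) (Finset.sum_nonneg fun _ _ => sq_nonneg _))) 1
  rw [← map_sum_coord, charFun_apply_real,
    integral_map (measurable_sum_coord s b).aemeasurable (by fun_prop)] at h
  simp only [Complex.ofReal_one, one_mul] at h
  rw [h]
  congr 1
  simp
  ring

/-- Gaussian integration by parts for `γₙ sin (∑ bₖ γₖ)`. -/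
theorem integral_sin_sum_coord_mul (s : Finset ℕ) (b : ℕ → ℝ) {n : ℕ} (hn : n ∈ s) :
    ∫ ω : ℕ → ℝ, Real.sin (∑ k ∈ s, b k * ω k) * ω n ∂gaussianSeq =
      b n * Real.exp (-(∑ k ∈ s, b k ^ 2) / 2) := by
  classical
  have hid : Integrable (fun ω : ℕ → ℝ => ω n) gaussianSeq :=
    (memLp_coord n).integrable (by norm_num)
  -- The characteristic function of the combination shifted by `t γ_n` is differentiated at `t = 0`,
  -- under the integral here and through its closed form in `hd`. The real parts of the two results
  -- give the identity.
  have key : HasDerivAt (fun t : ℝ => ∫ ω : ℕ → ℝ,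
      Complex.exp ((∑ k ∈ s, b k * ω k + t * ω n : ℝ) * Complex.I) ∂gaussianSeq)
      (∫ ω : ℕ → ℝ, Complex.exp ((∑ k ∈ s, b k * ω k + 0 * ω n : ℝ) * Complex.I) *
        (ω n * Complex.I) ∂gaussianSeq) 0 := by
    refine (hasDerivAt_integral_of_dominated_loc_of_deriv_le (μ := gaussianSeq)
      (F := fun (t : ℝ) (ω : ℕ → ℝ) =>
        Complex.exp ((∑ k ∈ s, b k * ω k + t * ω n : ℝ) * Complex.I))
      (F' := fun (t : ℝ) (ω : ℕ → ℝ) =>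
        Complex.exp ((∑ k ∈ s, b k * ω k + t * ω n : ℝ) * Complex.I) * (ω n * Complex.I))
      (bound := fun ω => |ω n|) (s := univ) univ_mem (.of_forall fun t => ?_) ?_ ?_
      (.of_forall fun ω t _ => ?_) hid.abs (.of_forall fun ω t _ => ?_)).2
    · exact Measurable.aestronglyMeasurable (by fun_prop)
    · exact Integrable.of_bound (C := 1) (Measurable.aestronglyMeasurable (by fun_prop))
        (.of_forall fun ω => by rw [Complex.norm_exp_ofReal_mul_I])
    · exact Measurable.aestronglyMeasurable (by fun_prop)
    · rw [norm_mul, Complex.norm_exp_ofReal_mul_I]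
      simp
    · refine HasDerivAt.cexp (HasDerivAt.mul_const ?_ _)
      refine HasDerivAt.ofReal_comp ?_
      simpa using ((hasDerivAt_id t).mul_const (ω n)).const_add (∑ k ∈ s, b k * ω k)
  have hval : ∀ t : ℝ, ∫ ω : ℕ → ℝ,
      Complex.exp ((∑ k ∈ s, b k * ω k + t * ω n : ℝ) * Complex.I) ∂gaussianSeq =
      ((Real.exp (-(∑ k ∈ s, b k ^ 2 + (2 * b n * t + t ^ 2)) / 2) : ℝ) : ℂ) := fun t => by
    have h1 : ∀ ω : ℕ → ℝ, ∑ k ∈ s, b k * ω k + t * ω n =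
        ∑ k ∈ s, (b k + if k = n then t else 0) * ω k := fun ω => by
      simp [add_mul, Finset.sum_add_distrib, hn]
    have h2 : ∑ k ∈ s, (b k + if k = n then t else 0) ^ 2 =
        ∑ k ∈ s, b k ^ 2 + (2 * b n * t + t ^ 2) := by
      have h3 : ∀ k, (b k + if k = n then t else 0) ^ 2 =
          b k ^ 2 + if k = n then 2 * b n * t + t ^ 2 else 0 := fun k => by
        split_ifs with h
        · subst h; ring
        · ring
      simp [h3, Finset.sum_add_distrib, hn]
    simp_rw [h1]
    rw [integral_cexp_sum_coord, h2]
    push_cast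
    rfl
  simp_rw [hval] at key
  have hd : HasDerivAt (fun t : ℝ =>
      ((Real.exp (-(∑ k ∈ s, b k ^ 2 + (2 * b n * t + t ^ 2)) / 2) : ℝ) : ℂ))
      ((-(b n * Real.exp (-(∑ k ∈ s, b k ^ 2) / 2)) : ℝ) : ℂ) 0 := by
    refine HasDerivAt.ofReal_comp ?_
    have h1 : HasDerivAt (fun t : ℝ => -(∑ k ∈ s, b k ^ 2 + (2 * b n * t + t ^ 2)) / 2)
        (-(b n)) 0 := by
      have h2 := (((((hasDerivAt_id (0 : ℝ)).const_mul (2 * b n)).add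
        ((hasDerivAt_id (0 : ℝ)).pow 2)).const_add (∑ k ∈ s, b k ^ 2)).neg).div_const 2
      refine h2.congr_deriv ?_
      simp
      ring
    refine h1.exp.congr_deriv ?_
    simp [mul_comm]
  have h1 := key.unique hd
  have h2 : ∫ ω : ℕ → ℝ, Real.sin (∑ k ∈ s, b k * ω k) * ω n ∂gaussianSeq =
      -(∫ ω : ℕ → ℝ, Complex.exp ((∑ k ∈ s, b k * ω k + 0 * ω n : ℝ) * Complex.I) *
        (ω n * Complex.I) ∂gaussianSeq).re := by
    have hint : Integrable (fun ω : ℕ → ℝ =>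
        Complex.exp ((∑ k ∈ s, b k * ω k + 0 * ω n : ℝ) * Complex.I) * (ω n * Complex.I))
        gaussianSeq := by
      refine Integrable.mono' hid.abs (Measurable.aestronglyMeasurable (by fun_prop))
        (.of_forall fun ω => ?_)
      rw [norm_mul, Complex.norm_exp_ofReal_mul_I]
      simp
    have h3 : (∫ ω : ℕ → ℝ, Complex.exp ((∑ k ∈ s, b k * ω k + 0 * ω n : ℝ) * Complex.I) *
        (ω n * Complex.I) ∂gaussianSeq).re = ∫ ω : ℕ → ℝ,
          (Complex.exp ((∑ k ∈ s, b k * ω k + 0 * ω n : ℝ) * Complex.I) *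
            (ω n * Complex.I)).re ∂gaussianSeq := (integral_re hint).symm
    rw [h3, ← integral_neg]
    refine integral_congr_ae (.of_forall fun ω => ?_)
    simp only [zero_mul, add_zero, Complex.mul_re, Complex.exp_ofReal_mul_I_im,
      Complex.exp_ofReal_mul_I_re, Complex.mul_im, Complex.ofReal_re, Complex.ofReal_im,
      Complex.I_re, Complex.I_im]
    ring
  rw [h2, h1, Complex.ofReal_re, neg_neg]

end GaussianCombinations

/-! ### Polynomial estimates on Stolz domains -/

section SquareFunctionPolynomials

theorem add_one_pow_succ_le {s : ℝ} (hs : 1 ≤ s) (k : ℕ) :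
    (s + 1) ^ (k + 1) ≤ s ^ (k + 1) + (2 ^ (k + 1) - 1) * s ^ k := by
  induction k with
  | zero => norm_num
  | succ k ih =>
    have h1 : (1 : ℝ) ≤ 2 ^ (k + 1) := one_le_pow₀ (by norm_num)
    have h2 : s ^ k ≤ s ^ (k + 1) := pow_le_pow_right₀ hs (by omega)
    calc (s + 1) ^ (k + 1 + 1) = (s + 1) ^ (k + 1) * (s + 1) := pow_succ _ _
      _ ≤ (s ^ (k + 1) + (2 ^ (k + 1) - 1) * s ^ k) * (s + 1) := by gcongr
      _ ≤ _ := by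
        have h3 : (2 ^ (k + 1) - 1) * s ^ k ≤ (2 ^ (k + 1) - 1) * s ^ (k + 1) :=
          mul_le_mul_of_nonneg_left h2 (by linarith)
        have h4 : s ^ (k + 1 + 1) = s ^ (k + 1) * s := pow_succ _ _
        have h5 : s ^ (k + 1) = s ^ k * s := pow_succ _ _
        have h6 : (2 : ℝ) ^ (k + 1 + 1) = 2 ^ (k + 1) * 2 := pow_succ _ _
        rw [h4, h6]
        nlinarith

theorem pow_le_factorial_mul_choose (l m : ℕ) :
    ((l : ℝ) + 1) ^ m ≤ m.factorial * ((l + m).choose m : ℝ) := by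
  have h1 := Nat.pow_succ_le_ascFactorial (l + 1) m
  rw [Nat.ascFactorial_eq_factorial_mul_choose] at h1
  exact_mod_cast h1

/-- Replacing the power by a binomial coefficient makes the series summable in closed form: `∑
C(l+m, m) r^l = (1-r)^(-m-1)`. -/
theorem sum_pow_mul_geometric_le {r : ℝ} (hr0 : 0 ≤ r) (hr1 : r < 1) (m : ℕ) (F : Finset ℕ) :
    ∑ l ∈ F, (((l : ℝ) + 1) ^ m * r ^ l) * (1 - r) ^ (m + 1) ≤ m.factorial := by
  have h1 := hasSum_choose_mul_geometric_of_norm_lt_one m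
    (r := r) (by rwa [Real.norm_of_nonneg hr0])
  have h2 : ∑ l ∈ F, (((l + m).choose m : ℕ) : ℝ) * r ^ l ≤ 1 / (1 - r) ^ (m + 1) :=
    sum_le_hasSum F (fun l _ => by positivity) h1
  have h3 : 0 < (1 - r) ^ (m + 1) := pow_pos (by linarith) _
  rw [← Finset.sum_mul, ← le_div_iff₀ h3]
  calc ∑ l ∈ F, ((l : ℝ) + 1) ^ m * r ^ l
      ≤ ∑ l ∈ F, m.factorial * ((((l + m).choose m : ℕ) : ℝ) * r ^ l) := by
        refine Finset.sum_le_sum fun l _ => ?_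
        rw [← mul_assoc]
        gcongr
        exact pow_le_factorial_mul_choose l m
    _ = m.factorial * ∑ l ∈ F, (((l + m).choose m : ℕ) : ℝ) * r ^ l := by rw [Finset.mul_sum]
    _ ≤ m.factorial * (1 / (1 - r) ^ (m + 1)) := by gcongr
    _ = _ := by rw [mul_one_div]

/-- After the same replacement the left side is `m!` times one term of the binomial expansion of
`((1-r) + r)^(R+m) = 1`. -/
theorem pow_mul_geometric_le {r : ℝ} (hr0 : 0 ≤ r) (hr1 : r < 1) (m R : ℕ) :
    ((R : ℝ) + 1) ^ m * r ^ R * (1 - r) ^ m ≤ m.factorial := by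
  have h1 := add_pow (1 - r) r (R + m)
  have h0 : 0 ≤ 1 - r := by linarith
  rw [sub_add_cancel, one_pow] at h1
  have h2 := Finset.single_le_sum (s := Finset.range (R + m + 1))
    (f := fun i => (1 - r) ^ i * r ^ (R + m - i) * ((R + m).choose i : ℝ))
    (fun i _ => by positivity) (Finset.mem_range.2 (by omega : m < R + m + 1))
  rw [← h1] at h2
  simp only [Nat.add_sub_cancel] at h2
  calc ((R : ℝ) + 1) ^ m * r ^ R * (1 - r) ^ m
      ≤ (m.factorial * ((R + m).choose m : ℝ)) * r ^ R * (1 - r) ^ m := by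
        gcongr
        exact pow_le_factorial_mul_choose R m
    _ = m.factorial * ((1 - r) ^ m * r ^ R * ((R + m).choose m : ℝ)) := by ring
    _ ≤ m.factorial * 1 := by gcongr
    _ = _ := mul_one _

/-- The weight `(n + 1) ^ (m - 1/2)`. -/
noncomputable def sqWeight (m n : ℕ) : ℝ := ((n : ℝ) + 1) ^ ((m : ℝ) - 1 / 2)

theorem sqWeight_mul_sqrt (m n : ℕ) : sqWeight m n * √((n : ℝ) + 1) = ((n : ℝ) + 1) ^ m := by
  rw [sqWeight, Real.sqrt_eq_rpow, ← Real.rpow_add (by positivity), sub_add_cancel,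
    Real.rpow_natCast]

theorem sqWeight_nonneg (m n : ℕ) : 0 ≤ sqWeight m n := by unfold sqWeight; positivity

theorem sqWeight_le_sqWeight_succ {m : ℕ} (hm : 1 ≤ m) (n : ℕ) :
    sqWeight m n ≤ sqWeight m (n + 1) := by
  unfold sqWeight
  have : (1 : ℝ) ≤ m := by exact_mod_cast hm
  refine Real.rpow_le_rpow (by positivity) ?_ (by linarith)
  push_cast
  linarith

/-- Enlarging `√(n+1)` to `√(n+2)` in the first term turns the half-integer powers into `(n+2)^(k+1)
- (n+1)^(k+1)`, to which `add_one_pow_succ_le` applies. -/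
theorem sqrt_mul_sqWeight_succ_sub_le (k n : ℕ) :
    √((n : ℝ) + 1) * (sqWeight (k + 1) (n + 1) - sqWeight (k + 1) n) ≤
      2 ^ (k + 1) * ((n : ℝ) + 1) ^ k := by
  have h1 := sqWeight_mul_sqrt (k + 1) n
  have h2 := sqWeight_mul_sqrt (k + 1) (n + 1)
  have h3 : √((n : ℝ) + 1) ≤ √(((n + 1 : ℕ) : ℝ) + 1) := Real.sqrt_le_sqrt (by push_cast; linarith)
  have h4 := mul_le_mul_of_nonneg_left h3 (sqWeight_nonneg (k + 1) (n + 1))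
  have h5 := add_one_pow_succ_le (s := (n : ℝ) + 1) (by linarith [n.cast_nonneg (α := ℝ)]) k
  have h6 : 0 ≤ ((n : ℝ) + 1) ^ k := by positivity
  push_cast at h2 h4
  nlinarith

/-- The polynomials `(n + 1) ^ (m - 1/2) z ^ n (1 - z) ^ m`. -/
noncomputable def sqPoly (m n : ℕ) : Polynomial ℂ :=
  Polynomial.C (sqWeight m n : ℂ) * (Polynomial.X ^ n * (1 - Polynomial.X) ^ m)

/-- The normalised differences of the polynomials `sqPoly m n`. -/
noncomputable def sqDiffPoly (m n : ℕ) : Polynomial ℂ :=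
  Polynomial.C ((√((n : ℝ) + 1) : ℝ) : ℂ) * (sqPoly m n - sqPoly m (n + 1))

theorem norm_one_sub_le_of_mem_stolz {ν : ℝ} {z : ℂ} (hz : z ∈ stolz ν) :
    ‖1 - z‖ ≤ ν * (1 - ‖z‖) :=
  ((div_lt_iff₀ (sub_pos.2 hz.1)).1 hz.2).le

/-- The decay in `R`, uniform on the domain, makes the telescoped sums of differences recover `A n`
without a remainder at infinity. -/
theorem norm_eval_sqPoly_le {ν : ℝ} {z : ℂ} (hz : z ∈ stolz ν) (hν : 0 ≤ ν) (m R : ℕ) :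
    ‖(sqPoly m R).eval z‖ ≤ ν ^ m * m.factorial / √((R : ℝ) + 1) := by
  have hs : 0 < √((R : ℝ) + 1) := by positivity
  have hr1 : ‖z‖ < 1 := hz.1
  rw [le_div_iff₀ hs]
  have h1 : ‖(sqPoly m R).eval z‖ = sqWeight m R * (‖z‖ ^ R * ‖1 - z‖ ^ m) := by
    simp [sqPoly, abs_of_nonneg (sqWeight_nonneg m R)]
  have h0 : 0 ≤ 1 - ‖z‖ := by linarith
  calc ‖(sqPoly m R).eval z‖ * √((R : ℝ) + 1)
      = ((R : ℝ) + 1) ^ m * (‖z‖ ^ R * ‖1 - z‖ ^ m) := by rw [h1, ← sqWeight_mul_sqrt]; ring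
    _ ≤ ((R : ℝ) + 1) ^ m * (‖z‖ ^ R * (ν * (1 - ‖z‖)) ^ m) := by
        gcongr
        exact norm_one_sub_le_of_mem_stolz hz
    _ = ν ^ m * (((R : ℝ) + 1) ^ m * ‖z‖ ^ R * (1 - ‖z‖) ^ m) := by rw [mul_pow]; ring
    _ ≤ _ := by
        gcongr
        exact pow_mul_geometric_le (norm_nonneg z) hr1 m R

/-- A discrete product rule: differencing `z^l` yields another factor `1-z`, while differencing the
weight loses one power of `l`. In both terms the exponent of `1-‖z‖` exceeds that of `l+1` by one,
exactly what summability over `l` requires. -/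
theorem norm_eval_sqDiffPoly_le {ν : ℝ} {z : ℂ} (hz : z ∈ stolz ν) (k l : ℕ) :
    ‖(sqDiffPoly (k + 1) l).eval z‖ ≤
      ν ^ (k + 2) * ((((l : ℝ) + 1) ^ (k + 1) * ‖z‖ ^ l) * (1 - ‖z‖) ^ (k + 2)) +
        2 ^ (k + 1) * ν ^ (k + 1) * ((((l : ℝ) + 1) ^ k * ‖z‖ ^ l) * (1 - ‖z‖) ^ (k + 1)) := by
  set s : ℝ := √((l : ℝ) + 1) with hs
  have hs0 : 0 ≤ s := Real.sqrt_nonneg _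
  set a := sqWeight (k + 1) l with ha
  set a' := sqWeight (k + 1) (l + 1) with ha'
  have haa : a ≤ a' := sqWeight_le_sqWeight_succ (by omega) l
  have h1 : (sqDiffPoly (k + 1) l).eval z = z ^ l * (1 - z) ^ (k + 1) *
      (((a * s : ℝ) : ℂ) * (1 - z) - ((s * (a' - a) : ℝ) : ℂ) * z) := by
    simp only [sqDiffPoly, sqPoly, Polynomial.eval_mul, Polynomial.eval_C, Polynomial.eval_sub,
      Polynomial.eval_pow, Polynomial.eval_X, Polynomial.eval_one, ← ha, ← ha', ← hs]
    push_cast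
    ring
  have hr1 : ‖z‖ < 1 := hz.1
  have hd := norm_one_sub_le_of_mem_stolz hz
  have h2 : ‖((a * s : ℝ) : ℂ) * (1 - z) - ((s * (a' - a) : ℝ) : ℂ) * z‖ ≤
      ((l : ℝ) + 1) ^ (k + 1) * (ν * (1 - ‖z‖)) + 2 ^ (k + 1) * ((l : ℝ) + 1) ^ k := by
    refine (norm_sub_le _ _).trans (add_le_add ?_ ?_)
    · rw [norm_mul, Complex.norm_real, sqWeight_mul_sqrt, Real.norm_of_nonneg (by positivity)]
      gcongr
    · rw [norm_mul, Complex.norm_real, Real.norm_of_nonneg (mul_nonneg hs0 (by linarith))]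
      have h3 := sqrt_mul_sqWeight_succ_sub_le k l
      have h4 : 0 ≤ s * (a' - a) := mul_nonneg hs0 (by linarith)
      exact (mul_le_of_le_one_right h4 hr1.le).trans h3
  rw [h1, norm_mul, norm_mul, norm_pow, norm_pow]
  calc ‖z‖ ^ l * ‖1 - z‖ ^ (k + 1) * _
      ≤ ‖z‖ ^ l * (ν * (1 - ‖z‖)) ^ (k + 1) *
        (((l : ℝ) + 1) ^ (k + 1) * (ν * (1 - ‖z‖)) + 2 ^ (k + 1) * ((l : ℝ) + 1) ^ k) := by
        have : 0 ≤ ν * (1 - ‖z‖) := (norm_nonneg _).trans hd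
        gcongr
    _ = _ := by rw [mul_pow]; ring

theorem sum_norm_eval_sqDiffPoly_le {ν : ℝ} {z : ℂ} (hz : z ∈ stolz ν) (hν : 0 ≤ ν) (k : ℕ)
    (F : Finset ℕ) : ∑ l ∈ F, ‖(sqDiffPoly (k + 1) l).eval z‖ ≤
      ν ^ (k + 2) * (k + 1).factorial + 2 ^ (k + 1) * ν ^ (k + 1) * k.factorial := by
  refine (Finset.sum_le_sum fun l _ => norm_eval_sqDiffPoly_le hz k l).trans ?_
  rw [Finset.sum_add_distrib, ← Finset.mul_sum, ← Finset.mul_sum]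
  have h1 := sum_pow_mul_geometric_le (norm_nonneg z) hz.1 (k + 1) F
  have h2 := sum_pow_mul_geometric_le (norm_nonneg z) hz.1 k F
  gcongr

variable {X : Type*} [NormedAddCommGroup X] [NormedSpace ℂ X]

theorem squareFunctionSeq_eq_aeval (T : X →L[ℂ] X) (m : ℕ) (x : X) (n : ℕ) :
    squareFunctionSeq T m x n = Polynomial.aeval T (sqPoly m n) x := by
  simp [squareFunctionSeq, sqPoly, sqWeight, Algebra.algebraMap_eq_smul_one]

theorem aeval_sqPoly_sub_aeval_sqPoly (T : X →L[ℂ] X) (m : ℕ) {n R : ℕ} (h : n ≤ R) :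
    Polynomial.aeval T (sqPoly m n) - Polynomial.aeval T (sqPoly m R) =
      ∑ l ∈ Finset.Ico n R, (((√((l : ℝ) + 1))⁻¹ : ℝ) : ℂ) • Polynomial.aeval T (sqDiffPoly m l) := by
  have h1 : ∀ l : ℕ, (((√((l : ℝ) + 1))⁻¹ : ℝ) : ℂ) • Polynomial.aeval T (sqDiffPoly m l) =
      Polynomial.aeval T (sqPoly m l) - Polynomial.aeval T (sqPoly m (l + 1)) := fun l => by
    have h2 : ((√((l : ℝ) + 1) : ℝ) : ℂ) ≠ 0 := by
      rw [Complex.ofReal_ne_zero]; positivity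
    rw [sqDiffPoly, map_mul, Polynomial.aeval_C, Algebra.algebraMap_eq_smul_one, smul_one_mul,
      smul_smul, Complex.ofReal_inv, inv_mul_cancel₀ h2, one_smul, map_sub]
  simp_rw [h1]
  rw [← neg_sub, ← Finset.sum_Ico_sub (fun l => Polynomial.aeval T (sqPoly m l)) h,
    ← Finset.sum_neg_distrib]
  simp

variable [CompleteSpace X] {T : X →L[ℂ] X} {ω ν : ℝ}

/-- The functional calculus estimates behind the square functions. -/
theorem IsRittOfType.exists_unconditional_bound (hω : 1 < ω) (hων : ω < ν)
    (hT : IsRittOfType T ω) (hcalc : HasBoundedHInftyCalculus T ω ν) {m : ℕ} (hm : 1 ≤ m) :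
    (∃ K : ℝ, 0 ≤ K ∧ ∀ (F : Finset ℕ) (α : ℕ → ℂ), (∀ l, ‖α l‖ ≤ 1) →
      ‖∑ l ∈ F, α l • Polynomial.aeval T (sqDiffPoly m l)‖ ≤ K) ∧
      Tendsto (fun R => Polynomial.aeval T (sqPoly m R)) atTop (𝓝 0) := by
  obtain ⟨K, hK0, hK⟩ := hT.exists_polynomial_bound hω hων hcalc
  have hν : 0 ≤ ν := by linarith
  obtain ⟨k, rfl⟩ := Nat.exists_eq_add_of_le' hm
  constructor
  · refine ⟨K * (ν ^ (k + 2) * (k + 1).factorial + 2 ^ (k + 1) * ν ^ (k + 1) * k.factorial),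
      by positivity, fun F α hα => ?_⟩
    have h1 : ∑ l ∈ F, α l • Polynomial.aeval T (sqDiffPoly (k + 1) l) =
        Polynomial.aeval T (∑ l ∈ F, α l • sqDiffPoly (k + 1) l) := by
      simp only [map_sum, map_smul]
    rw [h1]
    refine hK _ _ (by positivity) fun z hz => ?_
    rw [Polynomial.eval_finsetSum]
    refine (norm_sum_le _ _).trans (le_trans (Finset.sum_le_sum fun l _ => ?_)
      (sum_norm_eval_sqDiffPoly_le hz hν k F))
    rw [Polynomial.eval_smul, smul_eq_mul, norm_mul]
    exact mul_le_of_le_one_left (norm_nonneg _) (hα l)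
  · refine squeeze_zero_norm (a := fun R : ℕ =>
      K * (ν ^ (k + 1) * (k + 1).factorial / √((R : ℝ) + 1))) (fun R => ?_) ?_
    · exact hK _ _ (by positivity) fun z hz => norm_eval_sqPoly_le hz hν _ _
    · rw [← mul_zero K]
      refine Tendsto.const_mul K (Tendsto.div_atTop tendsto_const_nhds ?_)
      exact Real.tendsto_sqrt_atTop.comp
        (tendsto_atTop_add_const_right _ _ tendsto_natCast_atTop_atTop)

end SquareFunctionPolynomials

/-! ### The square function -/

section PrimalSquareFunction

variable {X : Type*} [NormedAddCommGroup X] [NormedSpace ℂ X]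

theorem coeFn_gaussianTerm (n : ℕ) (x : X) :
    (gaussianTerm X n x : (ℕ → ℝ) → X) =ᵐ[gaussianSeq] fun ω => ω n • x := by
  filter_upwards [(memLp_gaussianTerm n x).coeFn_toLp] with ω h
  exact h.trans (Complex.coe_smul (ω n) x)

theorem norm_gaussianTerm_le (n : ℕ) (x : X) :
    ‖gaussianTerm X n x‖ ≤ ‖x‖ * ‖gaussianTerm ℂ n 1‖ := by
  refine Lp.norm_le_mul_norm_of_ae_le_mul ?_
  filter_upwards [coeFn_gaussianTerm n x, coeFn_gaussianTerm n (1 : ℂ)] with ω h1 h2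
  rw [h1, h2, norm_smul, norm_smul, norm_one, mul_one, mul_comm]

theorem tendsto_gaussianTerm_zero (n : ℕ) {A : ℕ → X} (hA : Tendsto A atTop (𝓝 0)) :
    Tendsto (fun R => gaussianTerm X n (A R)) atTop (𝓝 0) := by
  refine squeeze_zero_norm (fun R => norm_gaussianTerm_le n (A R)) ?_
  simpa using hA.norm.mul_const ‖gaussianTerm ℂ n 1‖

theorem coeFn_sum_gaussianTerm (s : Finset ℕ) (x : ℕ → X) :
    (∑ n ∈ s, gaussianTerm X n (x n) : Lp X 2 gaussianSeq) =ᵐ[gaussianSeq]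
      fun ω => ∑ n ∈ s, ω n • x n := by
  have h : ∀ᵐ ω ∂gaussianSeq, ∀ n, (gaussianTerm X n (x n) : (ℕ → ℝ) → X) ω = ω n • x n :=
    ae_all_iff.2 fun n => coeFn_gaussianTerm n (x n)
  filter_upwards [h, Lp.coeFn_finsetSum s fun n => gaussianTerm X n (x n)] with ω h1 h2
  rw [h2, Finset.sum_apply]
  exact Finset.sum_congr rfl fun n _ => h1 n

/-- The coefficients `(l + 1) ^ (-1/2)` for `n ≤ l`, and `0` for `n > l`. -/
noncomputable def avgCoeff (l n : ℕ) : ℝ := if n ≤ l then (√((l : ℝ) + 1))⁻¹ else 0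

/-- Row `l` has at most `l+1` nonzero entries, each with square `1/(l+1)`. Thus all multipliers
arising from summation by parts have variance at most one, which is why the differences are
normalised by `√(l+1)`. -/
theorem sum_avgCoeff_sq_le (s : Finset ℕ) (l : ℕ) : ∑ n ∈ s, avgCoeff l n ^ 2 ≤ 1 := by
  have h1 : ∀ n, avgCoeff l n ^ 2 = if n ∈ Finset.range (l + 1) then ((l : ℝ) + 1)⁻¹ else 0 := by
    intro n
    simp only [avgCoeff, Finset.mem_range, Nat.lt_succ_iff]
    split_ifs
    · rw [inv_pow, Real.sq_sqrt (by positivity)]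
    · simp
  simp_rw [h1]
  rw [← Finset.sum_filter, Finset.sum_const, nsmul_eq_mul, ← div_eq_mul_inv,
    div_le_one (by positivity)]
  have h2 : (s.filter (· ∈ Finset.range (l + 1))).card ≤ l + 1 := by
    refine (Finset.card_le_card fun n hn => (Finset.mem_filter.1 hn).2).trans ?_
    rw [Finset.card_range]
  exact_mod_cast h2

/-- Telescoping: `A` as a sum of its normalised differences. -/
theorem sub_eq_sum_avgCoeff_smul {E : Type*} [AddCommGroup E] [Module ℝ E] {A D : ℕ → E}
    (hAD : ∀ n R, n ≤ R → A n - A R = ∑ l ∈ Finset.Ico n R, (√((l : ℝ) + 1))⁻¹ • D l)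
    {M n R : ℕ} (hMn : M ≤ n) (hnR : n ≤ R) :
    A n - A R = ∑ l ∈ Finset.Ico M R, avgCoeff l n • D l := by
  rw [hAD n R hnR, ← Finset.sum_subset (Finset.Ico_subset_Ico_left hMn)]
  · refine Finset.sum_congr rfl fun l hl => ?_
    rw [avgCoeff, if_pos (Finset.mem_Ico.1 hl).1]
  · intro l hl hl'
    rw [Finset.mem_Ico] at hl hl'
    rw [avgCoeff, if_neg (by omega), zero_smul]

/-- Summation by parts: random sums of `A` are random sums of its differences. -/
theorem sum_Ico_smul_sub {A D : ℕ → X} (hAD : ∀ n R, n ≤ R →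
      A n - A R = ∑ l ∈ Finset.Ico n R, (√((l : ℝ) + 1))⁻¹ • D l) (g : ℕ → ℝ) {M N R : ℕ}
    (hNR : N ≤ R) : ∑ n ∈ Finset.Ico M N, g n • (A n - A R) =
      ∑ l ∈ Finset.Ico M R, (∑ n ∈ Finset.Ico M N, avgCoeff l n * g n) • D l := by
  have h1 : ∀ n ∈ Finset.Ico M N, g n • (A n - A R) =
      ∑ l ∈ Finset.Ico M R, (avgCoeff l n * g n) • D l := fun n hn => by
    rw [Finset.mem_Ico] at hn
    rw [sub_eq_sum_avgCoeff_smul hAD hn.1 (by omega), Finset.smul_sum]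
    exact Finset.sum_congr rfl fun l _ => by rw [smul_smul, mul_comm]
  rw [Finset.sum_congr rfl h1, Finset.sum_comm]
  simp_rw [Finset.sum_smul]

/-- Summation by parts presents `∑ γ_n (A n - A R)` as a sum of the `D l` with Gaussian multipliers
of variance at most one, to which the estimate for exponential tails applies. The bound does not
depend on `R`, so `A R` can be removed in the limit. Keeping `M` free makes the estimate usable for
tails as well. -/
theorem norm_sum_gaussianTerm_le {q c K : ℝ} (hq : 2 ≤ q) (hc0 : 0 ≤ c)
    (hc : ∀ (N : ℕ) (x : Fin N → X) (M : ℝ),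
      (∀ ε : Fin N → ℤˣ, ‖∑ i, ((ε i : ℤˣ) : ℤ) • x i‖ ≤ M) → ∑ n, ‖x n‖ ^ q ≤ (c * M) ^ q)
    {A D : ℕ → X} (hAD : ∀ n R, n ≤ R →
      A n - A R = ∑ l ∈ Finset.Ico n R, (√((l : ℝ) + 1))⁻¹ • D l)
    (hA : Tendsto A atTop (𝓝 0)) {M N : ℕ}
    (hK : ∀ (R : ℕ) (α : ℕ → ℝ), (∀ l, |α l| ≤ 1) → ‖∑ l ∈ Finset.Ico M R, α l • D l‖ ≤ K) :
    ‖∑ n ∈ Finset.Ico M N, gaussianTerm X n (A n)‖ ≤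
      tailConst q (2 * Real.exp 1) * (c * K) := by
  have hK0 : 0 ≤ K := (norm_nonneg _).trans (hK 0 0 (by simp))
  have hC0 : 0 ≤ tailConst q (2 * Real.exp 1) := tailConst_nonneg (by linarith) (by positivity)
  have hR : ∀ R, N ≤ R → ‖∑ n ∈ Finset.Ico M N, gaussianTerm X n (A n - A R)‖ ≤
      tailConst q (2 * Real.exp 1) * (c * K) := fun R hNR => by
    have h1 := eLpNorm_sum_smul_le (ι := Finset.Ico M R) (μ := gaussianSeq) hq hc0 hc
      (y := fun l => D l) (M := K) (G := fun ω l => ∑ n ∈ Finset.Ico M N, avgCoeff l n * ω n)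
      (fun α hα => ?_) (fun l => measurable_sum_coord _ _) (B := 2 * Real.exp 1) (by positivity)
      (fun l n => measureReal_abs_sum_coord_le (sum_avgCoeff_sq_le _ _) _)
    · rw [Lp.norm_def, eLpNorm_congr_ae (coeFn_sum_gaussianTerm _ fun n => A n - A R)]
      refine ENNReal.toReal_le_of_le_ofReal (by positivity) (le_trans (le_of_eq ?_) h1)
      congr 1
      ext ω
      rw [sum_Ico_smul_sub hAD ω hNR]
      exact (Finset.sum_coe_sort (Finset.Ico M R)
        fun l => (∑ n ∈ Finset.Ico M N, avgCoeff l n * ω n) • D l).symm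
    · have h2 := hK R (fun l => if h : l ∈ Finset.Ico M R then α ⟨l, h⟩ else 0) fun l => by
        split_ifs with h
        · exact hα _
        · simp
      rw [← Finset.sum_coe_sort] at h2
      simpa using h2
  have hlim : Tendsto (fun R => ∑ n ∈ Finset.Ico M N, gaussianTerm X n (A n - A R)) atTop
      (𝓝 (∑ n ∈ Finset.Ico M N, gaussianTerm X n (A n))) := by
    refine tendsto_finsetSum _ fun n _ => ?_
    simp_rw [map_sub]
    simpa using tendsto_const_nhds.sub (tendsto_gaussianTerm_zero n hA)
  exact le_of_tendsto hlim.norm ((eventually_ge_atTop N).mono hR)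

/-- In a space of finite cotype, weakly unconditionally Cauchy series are unconditionally
convergent: their tails are small. -/
theorem exists_tail_le {q c K : ℝ} (hq : 0 < q)
    (hc : ∀ (N : ℕ) (x : Fin N → X) (M : ℝ),
      (∀ ε : Fin N → ℤˣ, ‖∑ i, ((ε i : ℤˣ) : ℤ) • x i‖ ≤ M) → ∑ n, ‖x n‖ ^ q ≤ (c * M) ^ q)
    {D : ℕ → X} (hK : ∀ (R : ℕ) (α : ℕ → ℝ), (∀ l, |α l| ≤ 1) →
      ‖∑ l ∈ Finset.range R, α l • D l‖ ≤ K) {ε : ℝ} (hε : 0 < ε) :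
    ∃ M : ℕ, ∀ (R : ℕ) (α : ℕ → ℝ), (∀ l, |α l| ≤ 1) →
      ‖∑ l ∈ Finset.Ico M R, α l • D l‖ ≤ ε := by
  by_contra! hcon
  choose R α hα hlt using hcon
  have hMR : ∀ M, M < R M := fun M => by
    by_contra h
    have := hlt M
    rw [Finset.Ico_eq_empty (by omega), Finset.sum_empty, norm_zero] at this
    linarith
  -- If every tail were large, consecutive blocks `[B i, B (i+1))` could be chosen, each carrying
  -- multipliers with a sum of norm above `ε`. Being disjointly supported they form a subpartition,
  -- so cotype gives `n ε^q ≤ (c K)^q` for every `n`.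
  let B : ℕ → ℕ := fun i => Nat.rec 0 (fun _ M => R M) i
  have hB : ∀ i, B (i + 1) = R (B i) := fun i => rfl
  have hBm : Monotone B := monotone_nat_of_le_succ fun i => by rw [hB]; exact (hMR _).le
  have key : ∀ n : ℕ, n * ε ^ q ≤ (c * K) ^ q := fun n => by
    let u : (ℕ → ℝ) →ₗ[ℝ] X := ∑ l ∈ Finset.range (B n),
      (LinearMap.toSpanSingleton ℝ X (D l)) ∘ₗ LinearMap.proj l
    have hu : ∀ β, u β = ∑ l ∈ Finset.range (B n), β l • D l := fun β => by
      simp [u, LinearMap.sum_apply]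
    let β : Fin n → ℕ → ℝ := fun i l => if l ∈ Finset.Ico (B i) (B (i + 1)) then α (B i) l else 0
    have hβ : IsSubPartition β := fun l => by
      by_cases h : ∃ i : Fin n, l ∈ Finset.Ico (B i) (B (i + 1))
      · obtain ⟨i, hi⟩ := h
        rw [Finset.sum_eq_single_of_mem i (Finset.mem_univ _)]
        · simp only [β, if_pos hi]
          exact hα _ _
        · intro j _ hj
          have hd := hBm.pairwise_disjoint_on_Ico_succ (fun h => hj (Fin.ext h) : (j : ℕ) ≠ i)
          rw [Function.onFun, Set.disjoint_left] at hd
          simp only [β]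
          rw [if_neg, abs_zero]
          intro hl
          exact hd (Finset.mem_Ico.1 hl) (Finset.mem_Ico.1 hi)
      · push Not at h
        simp only [β]
        rw [Finset.sum_eq_zero]
        · exact zero_le_one
        · intro i _
          rw [if_neg (h i), abs_zero]
    have h1 := sum_rpow_le_of_isSubPartition hc u (M := K)
      (fun β hβ => by rw [hu]; exact hK _ β hβ) hβ
    refine le_trans ?_ h1
    have h2 : ∀ i : Fin n, ε ^ q ≤ ‖u (β i)‖ ^ q := fun i => by
      have h3 : u (β i) = ∑ l ∈ Finset.Ico (B i) (R (B i)), α (B i) l • D l := by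
        rw [hu, ← hB]
        simp only [β, ite_smul, zero_smul]
        rw [← Finset.sum_filter]
        refine Finset.sum_congr ?_ fun _ _ => rfl
        ext l
        have := hBm (show (i : ℕ) + 1 ≤ n from i.2)
        simp only [Finset.mem_filter, Finset.mem_range, Finset.mem_Ico]
        omega
      rw [h3]
      have := hlt (B i)
      gcongr
    calc (n : ℝ) * ε ^ q = ∑ _i : Fin n, ε ^ q := by simp
      _ ≤ _ := Finset.sum_le_sum fun i _ => h2 i
  obtain ⟨n, hn⟩ := exists_nat_gt ((c * K) ^ q / ε ^ q)
  have h1 : 0 < ε ^ q := by positivity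
  rw [div_lt_iff₀ h1] at hn
  linarith [key n]

variable [CompleteSpace X] {T : X →L[ℂ] X} {ω ν : ℝ}

/-- The Gaussian estimate from index `0` gives boundedness; applied to small tails it shows that the
partial sums are Cauchy. -/
theorem hasSquareFunction (hX : HasFiniteCotype X) (hω : 1 < ω) (hων : ω < ν)
    (hT : IsRittOfType T ω) (hcalc : HasBoundedHInftyCalculus T ω ν) {m : ℕ} (hm : 1 ≤ m) :
    HasSquareFunction T m := by
  obtain ⟨q, hq, hqX⟩ := hX
  obtain ⟨c, hc0, hc⟩ := hqX.exists_const (by linarith)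
  obtain ⟨⟨K, hK0, hK⟩, hlim⟩ := hT.exists_unconditional_bound hω hων hcalc hm
  set C := tailConst q (2 * Real.exp 1)
  have hC0 : 0 ≤ C := tailConst_nonneg (by linarith) (by positivity)
  have hA : ∀ x, Tendsto (squareFunctionSeq T m x) atTop (𝓝 0) := fun x => by
    have h1 := ((ContinuousLinearMap.apply ℂ X x).continuous.tendsto 0).comp hlim
    rw [map_zero] at h1
    exact h1.congr fun R => (squareFunctionSeq_eq_aeval T m x R).symm
  have hAD : ∀ x n R, n ≤ R → squareFunctionSeq T m x n - squareFunctionSeq T m x R =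
      ∑ l ∈ Finset.Ico n R, (√((l : ℝ) + 1))⁻¹ • Polynomial.aeval T (sqDiffPoly m l) x := by
    intro x n R hnR
    rw [squareFunctionSeq_eq_aeval, squareFunctionSeq_eq_aeval, ← _root_.sub_apply,
      aeval_sqPoly_sub_aeval_sqPoly T m hnR, _root_.sum_apply]
    exact Finset.sum_congr rfl fun l _ => Complex.coe_smul _ _
  have hKx : ∀ x (F : Finset ℕ) (α : ℕ → ℝ), (∀ l, |α l| ≤ 1) →
      ‖∑ l ∈ F, α l • Polynomial.aeval T (sqDiffPoly m l) x‖ ≤ K * ‖x‖ := fun x F α hα => by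
    have h1 := (∑ l ∈ F, (α l : ℂ) • Polynomial.aeval T (sqDiffPoly m l)).le_of_opNorm_le
      (hK F (fun l => α l) fun l => by simpa using hα l) x
    rw [_root_.sum_apply] at h1
    simpa using h1
  have hbound : ∀ x N, ‖gaussianPartialSum (squareFunctionSeq T m x) N‖ ≤ C * (c * K) * ‖x‖ := by
    intro x N
    have h1 := norm_sum_gaussianTerm_le hq hc0 hc (hAD x) (hA x) (M := 0) (N := N)
      (fun R α hα => hKx x _ α hα)
    rw [← Finset.range_eq_Ico] at h1
    refine h1.trans (le_of_eq ?_)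
    ring
  have hcauchy : ∀ x, CauchySeq (gaussianPartialSum (squareFunctionSeq T m x)) := fun x => by
    rw [Metric.cauchySeq_iff']
    intro ε hε
    -- The summand `1` keeps the denominator positive when `C * c` vanishes.
    have hε' : 0 < ε / 2 / (C * c + 1) := by positivity
    obtain ⟨M, hM⟩ := exists_tail_le (by linarith) hc
      (fun R α hα => hKx x (Finset.range R) α hα) hε'
    refine ⟨M, fun N hN => ?_⟩
    rw [dist_eq_norm, gaussianPartialSum, gaussianPartialSum, ← Finset.sum_Ico_eq_sub _ hN]
    refine (norm_sum_gaussianTerm_le hq hc0 hc (hAD x) (hA x) hM).trans_lt ?_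
    have h1 : 0 ≤ C * c := by positivity
    calc C * (c * (ε / 2 / (C * c + 1))) = (C * c) / (C * c + 1) * (ε / 2) := by ring
      _ ≤ 1 * (ε / 2) := by
        gcongr
        rw [div_le_one (by linarith)]
        linarith
      _ < ε := by linarith
  have hmem : ∀ x, squareFunctionSeq T m x ∈ gammaSubmodule X := fun x =>
    cauchySeq_tendsto_of_complete (hcauchy x)
  let Φ : X →ₗ[ℂ] GammaSpace X :=
    { toFun := fun x => (⟨squareFunctionSeq T m x, hmem x⟩ : gammaSubmodule X)
      map_add' := fun x y => Subtype.ext <| funext fun n => by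
        change squareFunctionSeq T m (x + y) n =
          squareFunctionSeq T m x n + squareFunctionSeq T m y n
        simp only [squareFunctionSeq_eq_aeval, map_add]
      map_smul' := fun a x => Subtype.ext <| funext fun n => by
        change squareFunctionSeq T m (a • x) n = a • squareFunctionSeq T m x n
        simp only [squareFunctionSeq_eq_aeval, map_smul] }
  refine ⟨Φ.mkContinuous (C * (c * K)) fun x => ?_, fun x n => rfl⟩
  change ‖GammaSpace.gaussianSum (Φ x)‖ ≤ _
  exact le_of_tendsto (GammaSpace.tendsto_gaussianSum (Φ x)).norm
    (.of_forall fun N => hbound x N)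

end PrimalSquareFunction

/-! ### The dual square function -/

section DualSquareFunction

variable {X : Type*} [NormedAddCommGroup X] [NormedSpace ℂ X]

theorem adjoint_iterate_apply (T : X →L[ℂ] X) (n : ℕ) (φ : StrongDual ℂ X) (x : X) :
    ((adjoint T)^[n] φ) x = φ (T^[n] x) := by
  induction n generalizing φ with
  | zero => rfl
  | succ n ih =>
    rw [Function.iterate_succ_apply, ih, Function.iterate_succ_apply']
    rfl

set_option synthInstance.maxHeartbeats 100000 in
theorem aeval_adjoint_apply (T : X →L[ℂ] X) (p : Polynomial ℂ) (φ : StrongDual ℂ X) (x : X) :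
    Polynomial.aeval (adjoint T) p φ x = φ (Polynomial.aeval T p x) := by
  induction p using Polynomial.induction_on' with
  | add p q hp hq => simp [hp, hq]
  | monomial n a =>
    simp [Polynomial.aeval_monomial, Algebra.algebraMap_eq_smul_one, adjoint_iterate_apply]

theorem integral_norm_le_norm {E : Type*} [NormedAddCommGroup E] (f : Lp E 2 gaussianSeq) : ∫ ω, ‖f ω‖ ∂gaussianSeq ≤ ‖f‖ := by
  rw [integral_norm_eq_lintegral_enorm (Lp.aestronglyMeasurable f),
    ← eLpNorm_one_eq_lintegral_enorm, Lp.norm_def]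
  exact ENNReal.toReal_mono (Lp.eLpNorm_ne_top f)
    (eLpNorm_le_eLpNorm_of_exponent_le (by norm_num) (Lp.aestronglyMeasurable f))

/-- The dual pairing is the expectation of a pairing with random unconditional multipliers. -/
theorem norm_sum_mul_apply_le {A D : ℕ → X →L[ℂ] X} (hAD : ∀ n R, n ≤ R →
      A n - A R = ∑ l ∈ Finset.Ico n R, (√((l : ℝ) + 1))⁻¹ • D l)
    (hA : Tendsto A atTop (𝓝 0)) {K : ℝ}
    (hK : ∀ (F : Finset ℕ) (α : ℕ → ℝ), (∀ l, |α l| ≤ 1) → ‖∑ l ∈ F, α l • D l‖ ≤ K)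
    (φ : StrongDual ℂ X) (x : ℕ → X) {η : ℕ → ℝ} (hη : ∀ n, |η n| ≤ 1) (N : ℕ) :
    ‖∑ n ∈ Finset.range N, (η n : ℂ) * φ (A n (x n))‖ ≤
      Real.exp (1 / 2) * K * ‖φ‖ * ‖gaussianPartialSum x N‖ := by
  let b : ℕ → ℕ → ℝ := fun l n => avgCoeff l n * η n
  let v : ℕ → ℝ := fun l => ∑ n ∈ Finset.range N, b l n ^ 2
  have hv : ∀ l, v l ≤ 1 := fun l => by
    refine le_trans (Finset.sum_le_sum fun n _ => ?_) (sum_avgCoeff_sq_le (Finset.range N) l)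
    simp only [b, mul_pow]
    exact mul_le_of_le_one_right (sq_nonneg _) ((sq_le_one_iff_abs_le_one _).2 (hη n))
  -- The factor `exp (v l / 2)` is chosen to cancel the Gaussian factor in
  -- `integral_sin_sum_coord_mul`, so that `E[α_l γ_n] = b l n` exactly. As `v l ≤ 1`, these
  -- multipliers are bounded by `exp (1/2)`.
  let α : (ℕ → ℝ) → ℕ → ℝ := fun ω l =>
    Real.exp (v l / 2) * Real.sin (∑ n ∈ Finset.range N, b l n * ω n)
  have hαm : ∀ l, Measurable fun ω => α ω l := fun l => by fun_prop
  have hα : ∀ ω l, |α ω l| ≤ Real.exp (1 / 2) := fun ω l => by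
    rw [abs_mul, Real.abs_exp]
    refine (mul_le_of_le_one_right (Real.exp_pos _).le (Real.abs_sin_le_one _)).trans ?_
    have := hv l
    gcongr
  have hid : ∀ n, Integrable (fun ω : ℕ → ℝ => ω n) gaussianSeq := fun n =>
    (memLp_coord n).integrable (by norm_num)
  have hint : ∀ l n, Integrable (fun ω : ℕ → ℝ => α ω l * ω n) gaussianSeq := fun l n =>
    (hid n).bdd_mul (hαm l).aestronglyMeasurable (c := Real.exp (1 / 2))
      (.of_forall fun ω => hα ω l)
  have hval : ∀ l, ∀ n ∈ Finset.range N, ∫ ω : ℕ → ℝ, α ω l * ω n ∂gaussianSeq = b l n := by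
    intro l n hn
    simp only [α, mul_assoc]
    rw [integral_const_mul, integral_sin_sum_coord_mul _ _ hn, mul_left_comm, ← Real.exp_add]
    simp only [v]
    rw [neg_div, add_neg_cancel, Real.exp_zero, mul_one]
  have hαK : ∀ ω R, ‖∑ l ∈ Finset.Ico 0 R, α ω l • D l‖ ≤ Real.exp (1 / 2) * K := fun ω R => by
    have h1 := hK (Finset.Ico 0 R) (fun l => (Real.exp (1 / 2))⁻¹ * α ω l) fun l => by
      rw [abs_mul, abs_inv, Real.abs_exp, inv_mul_le_iff₀ (Real.exp_pos _), mul_one]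
      exact hα ω l
    simp_rw [mul_smul] at h1
    rwa [← Finset.smul_sum, norm_smul, norm_inv, Real.norm_of_nonneg (Real.exp_pos _).le,
      inv_mul_le_iff₀ (Real.exp_pos _)] at h1
  have hR : ∀ R, N ≤ R → ‖∑ n ∈ Finset.range N, (η n : ℂ) * φ ((A n - A R) (x n))‖ ≤
      Real.exp (1 / 2) * K * ‖φ‖ * ‖gaussianPartialSum x N‖ := fun R hNR => by
    -- When the product of the two random sums is expanded, the expectation of each term restores
    -- the coefficient `avgCoeff l n * η n`, and the sum over `l` telescopes to `A n - A R`.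
    have h1 : ∑ n ∈ Finset.range N, (η n : ℂ) * φ ((A n - A R) (x n)) =
        ∫ ω : ℕ → ℝ, φ ((∑ l ∈ Finset.Ico 0 R, α ω l • D l)
          (∑ n ∈ Finset.range N, ω n • x n)) ∂gaussianSeq := by
      have h2 : ∀ ω : ℕ → ℝ, φ ((∑ l ∈ Finset.Ico 0 R, α ω l • D l)
          (∑ n ∈ Finset.range N, ω n • x n)) = ∑ n ∈ Finset.range N, ∑ l ∈ Finset.Ico 0 R,
            ((α ω l * ω n : ℝ) : ℂ) * φ (D l (x n)) := fun ω => by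
        simp only [map_sum, _root_.sum_apply, ← Complex.coe_smul, map_smul,
          _root_.smul_apply, smul_eq_mul, Finset.mul_sum]
        refine Finset.sum_congr rfl fun n _ => Finset.sum_congr rfl fun l _ => ?_
        push_cast
        ring
      simp_rw [h2]
      have h3 : ∀ l n, Integrable (fun ω : ℕ → ℝ => ((α ω l * ω n : ℝ) : ℂ) * φ (D l (x n)))
          gaussianSeq := fun l n => (hint l n).ofReal.mul_const _
      rw [integral_finsetSum _ fun n _ => integrable_finsetSum _ fun l _ => h3 l n]
      refine Finset.sum_congr rfl fun n hn => ?_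
      rw [integral_finsetSum _ fun l _ => h3 l n, sub_eq_sum_avgCoeff_smul hAD (Nat.zero_le n)
        ((Finset.mem_range.1 hn).le.trans hNR), _root_.sum_apply, map_sum, Finset.mul_sum]
      refine Finset.sum_congr rfl fun l _ => ?_
      rw [integral_mul_const, integral_complex_ofReal, hval l n hn, ← Complex.coe_smul,
        _root_.smul_apply, map_smul, smul_eq_mul]
      simp only [b]
      push_cast
      ring
    have hsum := coeFn_sum_gaussianTerm (Finset.range N) x
    have hS : Integrable (fun ω => ‖(gaussianPartialSum x N : (ℕ → ℝ) → X) ω‖) gaussianSeq :=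
      ((Lp.memLp _).integrable (by norm_num)).norm
    have hC : 0 ≤ Real.exp (1 / 2) * K := (norm_nonneg _).trans (hαK 0 0)
    rw [h1]
    calc _ ≤ ∫ ω, (‖φ‖ * (Real.exp (1 / 2) * K)) *
          ‖(gaussianPartialSum x N : (ℕ → ℝ) → X) ω‖ ∂gaussianSeq := by
          refine norm_integral_le_of_norm_le (hS.const_mul _) ?_
          filter_upwards [hsum] with ω hω
          rw [gaussianPartialSum, hω, mul_assoc]
          refine (φ.le_opNorm _).trans ?_
          gcongr
          exact ContinuousLinearMap.le_of_opNorm_le _ (hαK ω R) _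
      _ = (‖φ‖ * (Real.exp (1 / 2) * K)) *
          ∫ ω, ‖(gaussianPartialSum x N : (ℕ → ℝ) → X) ω‖ ∂gaussianSeq := integral_const_mul _ _
      _ ≤ (‖φ‖ * (Real.exp (1 / 2) * K)) * ‖gaussianPartialSum x N‖ := by
          gcongr
          exact integral_norm_le_norm _
      _ = _ := by ring
  have hlim : Tendsto (fun R => ∑ n ∈ Finset.range N, (η n : ℂ) * φ ((A n - A R) (x n))) atTop
      (𝓝 (∑ n ∈ Finset.range N, (η n : ℂ) * φ (A n (x n)))) := by
    refine tendsto_finsetSum _ fun n _ => Tendsto.const_mul _ ?_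
    have h1 : Tendsto (fun R => A n - A R) atTop (𝓝 (A n)) := by
      simpa using tendsto_const_nhds.sub hA
    exact (φ.continuous.tendsto _).comp
      (((ContinuousLinearMap.apply ℂ X (x n)).continuous.tendsto _).comp h1)
  exact le_of_tendsto hlim.norm ((eventually_ge_atTop N).mono hR)

/-- Taking for `η` the signs of the real parts, then of the imaginary parts, bounds the sums of
their absolute values. -/
theorem summable_of_forall_sign_sum_le {a : ℕ → ℂ} {B : ℝ}
    (h : ∀ (η : ℕ → ℝ), (∀ n, |η n| ≤ 1) → ∀ N, ‖∑ n ∈ Finset.range N, (η n : ℂ) * a n‖ ≤ B) :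
    Summable a := by
  have hsign : ∀ t : ℝ, |(SignType.sign t : ℝ)| ≤ 1 := fun t => by
    rcases lt_trichotomy t 0 with h | h | h <;> simp [h]
  have hre : Summable fun n => |(a n).re| := by
    refine summable_of_sum_range_le (c := B) (fun n => abs_nonneg _) fun N => ?_
    refine le_trans (le_of_eq ?_) ((Complex.re_le_norm _).trans
      (h (fun n => SignType.sign (a n).re) (fun n => hsign _) N))
    rw [Complex.re_sum]
    refine Finset.sum_congr rfl fun n _ => ?_
    rw [Complex.re_ofReal_mul, sign_mul_self]
  have him : Summable fun n => |(a n).im| := by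
    refine summable_of_sum_range_le (c := B) (fun n => abs_nonneg _) fun N => ?_
    refine le_trans (le_of_eq ?_) ((Complex.im_le_norm _).trans
      (h (fun n => SignType.sign (a n).im) (fun n => hsign _) N))
    rw [Complex.im_sum]
    refine Finset.sum_congr rfl fun n _ => ?_
    rw [Complex.im_ofReal_mul, sign_mul_self]
  exact Summable.of_norm_bounded (hre.add him) fun n => Complex.norm_le_abs_re_add_abs_im _

variable [CompleteSpace X] {T : X →L[ℂ] X} {ω ν : ℝ}

/-- Arbitrary `η` give the absolute convergence that `HasSum` demands, using that the partial sums
of `u` are bounded in norm. The choice `η = 1` then gives the norm estimate in the limit. -/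
theorem hasDualSquareFunction (hω : 1 < ω) (hων : ω < ν) (hT : IsRittOfType T ω)
    (hcalc : HasBoundedHInftyCalculus T ω ν) {m : ℕ} (hm : 1 ≤ m) :
    HasDualSquareFunction T m := by
  obtain ⟨⟨K, hK0, hK⟩, hlim⟩ := hT.exists_unconditional_bound hω hων hcalc hm
  set C := Real.exp (1 / 2) * K with hC
  let a : StrongDual ℂ X → GammaSpace X → ℕ → ℂ := fun φ u n =>
    squareFunctionSeq (adjoint T) m φ n (u.seq n)
  have ha : ∀ φ u n, a φ u n = φ (Polynomial.aeval T (sqPoly m n) (u.seq n)) := fun φ u n => by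
    simp only [a]
    rw [squareFunctionSeq_eq_aeval, aeval_adjoint_apply]
  have hbound : ∀ φ u (η : ℕ → ℝ), (∀ n, |η n| ≤ 1) → ∀ N,
      ‖∑ n ∈ Finset.range N, (η n : ℂ) * a φ u n‖ ≤
        C * ‖φ‖ * ‖gaussianPartialSum u.seq N‖ := fun φ u η hη N => by
    simp only [ha]
    refine norm_sum_mul_apply_le (D := fun l => Polynomial.aeval T (sqDiffPoly m l))
      (fun n R hnR => ?_) hlim (fun F α hα => ?_) φ u.seq hη N
    · rw [aeval_sqPoly_sub_aeval_sqPoly T m hnR]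
      exact Finset.sum_congr rfl fun l _ => Complex.coe_smul _ _
    · refine le_trans (le_of_eq ?_) (hK F (fun l => α l) fun l => by simpa using hα l)
      congr 1
  have hlimu : ∀ u : GammaSpace X,
      Tendsto (fun N => ‖gaussianPartialSum u.seq N‖) atTop (𝓝 ‖u‖) := fun u =>
    u.tendsto_gaussianSum.norm
  have hsummable : ∀ φ u, Summable (a φ u) := fun φ u => by
    obtain ⟨B, hB⟩ := (hlimu u).bddAbove_range
    refine summable_of_forall_sign_sum_le (B := C * ‖φ‖ * B) fun η hη N => ?_
    refine (hbound φ u η hη N).trans ?_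
    have : ‖gaussianPartialSum u.seq N‖ ≤ B := hB ⟨N, rfl⟩
    gcongr
  let Ψ : StrongDual ℂ X →ₗ[ℂ] GammaSpace X →ₗ[ℂ] ℂ := LinearMap.mk₂ ℂ
    (fun φ u => ∑' n, a φ u n)
    (fun φ ψ u => by
      rw [← (hsummable φ u).tsum_add (hsummable ψ u)]
      exact tsum_congr fun n => by simp only [ha, _root_.add_apply])
    (fun c φ u => by
      rw [smul_eq_mul, ← tsum_mul_left]
      exact tsum_congr fun n => by simp only [ha]; rfl)
    (fun φ u w => by
      rw [← (hsummable φ u).tsum_add (hsummable φ w)]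
      exact tsum_congr fun n => by
        have h : (u + w).seq n = u.seq n + w.seq n := rfl
        simp only [ha, h, map_add])
    (fun c φ u => by
      rw [smul_eq_mul, ← tsum_mul_left]
      exact tsum_congr fun n => by
        have h : (c • u).seq n = c • u.seq n := rfl
        simp only [ha, h, map_smul, smul_eq_mul])
  refine ⟨Ψ.mkContinuous₂ C fun φ u => ?_, fun φ u => (hsummable φ u).hasSum⟩
  have h1 := (hsummable φ u).hasSum.tendsto_sum_nat.norm
  refine le_of_tendsto_of_tendsto' h1 ((hlimu u).const_mul (C * ‖φ‖)) fun N => ?_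
  simpa using hbound φ u (fun _ => 1) (fun _ => by simp) N

end DualSquareFunction

end RittCalculus

theorem proposition4p1 {X : Type*} [NormedAddCommGroup X] [NormedSpace ℂ X] [CompleteSpace X]
    (hX : RittCalculus.HasFiniteCotype X) (T : X →L[ℂ] X) (ω ν : ℝ) (hω : 1 < ω) (hων : ω < ν)
    (hT : RittCalculus.IsRittOfType T ω)
    (hcalc : RittCalculus.HasBoundedHInftyCalculus T ω ν) (m : ℕ) (hm : 1 ≤ m) :
    RittCalculus.HasSquareFunction T m ∧ RittCalculus.HasDualSquareFunction T m :=
  ⟨RittCalculus.hasSquareFunction hX hω hων hT hcalc hm,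
    RittCalculus.hasDualSquareFunction hω hων hT hcalc hm⟩
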